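/- For a probability distribution $\mathcal P$ on a measurable space $\mathcal X$, $t\in\mathbb N$ and measurable $\phi:\mathcal X^t\to\mathbb R$, write $\mathcal P^t[\phi]=\mathbb E_{Z\sim\mathcal P^t}[\phi(Z)]$, $\mathrm{MAD}(\phi(\mathcal P^t))=\mathbb E_{Z\sim\mathcal P^t}\big|\phi(Z)-\mathcal P^t[\phi]\big|$ and $\mathrm{sd}(\phi(\mathcal P^t))=\sqrt{\mathrm{Var}_{Z\sim\mathcal P^t}\,\phi(Z)}$. Let $\mathcal F_{\mathcal P,t}$ be the set of integrable $\phi$ with $\mathcal P^t[\phi]\in[-1,1]$ and $\mathrm{MAD}(\phi(\mathcal P^t))\le 1$, and let $\mathcal F^{\mathrm{sd}}_{\mathcal P,t}$ be the set of square-integrable $\phi$ with $\mathcal P^t[\phi]\in[-1,1]$ and $\mathrm{sd}(\phi(\mathcal P^t))\le 1$. An algorithm $M$ holds a dataset $s\in\mathcal X^n$ and answers queries $\phi_1,\dots,\phi_k:\mathcal X^t\to\mathbb R$ with numbers $v_1,\dots,v_k$. The queries are chosen adaptively by a (randomized, arbitrary) analyst $A$: $\phi_j$ may depend on $v_1,\dots,v_{j-1}$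 and on the internal randomness of $A$. Running time is the number of steps of a randomized real RAM (unit-cost arithmetic, $\exp$, $\log$, comparisons, indirect addressing, uniform draws from $[0,1]$, no rounding), where one evaluation of a query on a block of $t$ sample points counts as one step. There are universal constants $C,c$ and a single program $M$, which receives $n,t,k,\zeta,\beta$ as input, with the following properties. Let $t,k\ge 1$, $n\ge 0$ be integers, $\zeta>0$, $\beta>0$, put $\beta'=\min\{\beta,1/2\}$, and suppose that $$n\ \ge\ C\,t\,\sqrt{k\log(1/\beta')}\;\log\!\big(k/(\zeta\beta')\big).$$ Then for every $\mathcal X$: 1. (Efficiency) on every dataset $s\in\mathcal X^n$, every query and every outcome of its random draws, $M$ answers the query within $c\,(n+1)^c$ steps, and its answer lies in $[-1,1]$; 2. for every distribution $\mathcal P$ on $\mathcal X$ and every analyst $A$, if $S\sim\mathcal P^n$ and $(\phi_1,\dots,\phi_k,v_1,\dots,v_k)$ is the transcript of the interaction of $A$ with $M$ on $S$, then $$\Pr\Big[\forall j\in[k]\text{ with }\phi_j\in\mathcal F_{\mathcal P,t}:\ \big|v_j-\mathcal P^t[\phi_j]\big|\le 4\,\mathrm{MAD}(\phi_j(\mathcal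 P^t))+\zeta\Big]\ \ge\ 1-\beta$$ and $$\Pr\Big[\forall j\in[k]\text{ with }\phi_j\in\mathcal F^{\mathrm{sd}}_{\mathcal P,t}:\ \big|v_j-\mathcal P^t[\phi_j]\big|\le 2\,\mathrm{sd}(\phi_j(\mathcal P^t))+\zeta\Big]\ \ge\ 1-\beta .$$ -/

import Mathlib

open MeasureTheory ProbabilityTheory

/-! ### The machine

A randomized real RAM with unit-cost steps.  It has an unbounded memory of natural numbers and an
unbounded memory of real numbers, indirect addressing, real arithmetic with `exp` and `log`, and
comparisons; there is no rounding from reals to integers.  It can draw independent uniform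
elements of `[0,1]`, and its only access to the data is by evaluating the current query on a block
of consecutive sample points.  Every instruction, test and evaluation of the query costs one
step. -/

/-- Memory contents: naturals, reals, and the number of random draws made so far. -/
structure RAMState where
  nat : ℕ → ℕ
  real : ℕ → ℝ
  draws : ℕ

/-- Basic instructions; the numbers `d a b` are memory addresses. -/
inductive Instr where
  /-- `nat[d] := c` -/
  | natConst (d c : ℕ)
  /-- `nat[d] := nat[a] + nat[b]` -/
  | natAdd (d a b : ℕ)
  /-- `nat[d] := nat[a] - nat[b]`, truncated at zero -/
  | natSub (d a b : ℕ)
  /-- `nat[d] := nat[nat[a]]` -/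
  | natLoad (d a : ℕ)
  /-- `nat[nat[d]] := nat[a]` -/
  | natStore (d a : ℕ)
  /-- `real[d] := q` for a rational literal `q` -/
  | realConst (d : ℕ) (q : ℚ)
  /-- `real[d] := nat[a]` -/
  | realCast (d a : ℕ)
  /-- `real[d] := real[a] + real[b]` -/
  | realAdd (d a b : ℕ)
  /-- `real[d] := real[a] - real[b]` -/
  | realSub (d a b : ℕ)
  /-- `real[d] := real[a] * real[b]` -/
  | realMul (d a b : ℕ)
  /-- `real[d] := real[a] / real[b]` (and `0` if `real[b] = 0`) -/
  | realDiv (d a b : ℕ)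
  /-- `real[d] := exp real[a]` -/
  | realExp (d a : ℕ)
  /-- `real[d] := log real[a]` -/
  | realLog (d a : ℕ)
  /-- `real[d] := real[nat[a]]` -/
  | realLoad (d a : ℕ)
  /-- `real[nat[d]] := real[a]` -/
  | realStore (d a : ℕ)
  /-- `real[d] :=` a fresh uniform element of `[0,1]` -/
  | draw (d : ℕ)
  /-- `real[d] :=` the value of the query on the block of sample points starting at `nat[a]` -/
  | evalQuery (d a : ℕ)

/-- Tests on which a program may branch. -/
inductive RAMTest where
  | natLt (a b : ℕ)
  | natLe (a b : ℕ)
  | realLt (a b : ℕ)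
  | realLe (a b : ℕ)

/-- Programs: finite structured code over the basic instructions. -/
inductive Program where
  | instr (i : Instr)
  | seq (p q : Program)
  | ite (b : RAMTest) (p q : Program)
  | while (b : RAMTest) (p : Program)

def RAMTest.holds : RAMTest → RAMState → Prop
  | natLt a b, σ => σ.nat a < σ.nat b
  | natLe a b, σ => σ.nat a ≤ σ.nat b
  | realLt a b, σ => σ.real a < σ.real b
  | realLe a b, σ => σ.real a ≤ σ.real b

def RAMState.setNat (σ : RAMState) (d v : ℕ) : RAMState :=
  { σ with nat := Function.update σ.nat d v }

noncomputable def RAMState.setReal (σ : RAMState) (d : ℕ) (v : ℝ) : RAMState :=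
  { σ with real := Function.update σ.real d v }

/-- Effect of one instruction, where `u` is the stream of random numbers and `ev a` is the value
of the query on the block of sample points starting at position `a`. -/
noncomputable def Instr.exec (ev : ℕ → ℝ) (u : ℕ → unitInterval) : Instr → RAMState → RAMState
  | natConst d c, σ => σ.setNat d c
  | natAdd d a b, σ => σ.setNat d (σ.nat a + σ.nat b)
  | natSub d a b, σ => σ.setNat d (σ.nat a - σ.nat b)
  | natLoad d a, σ => σ.setNat d (σ.nat (σ.nat a))
  | natStore d a, σ => σ.setNat (σ.nat d) (σ.nat a)
  | realConst d q, σ => σ.setReal d (q : ℝ)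
  | realCast d a, σ => σ.setReal d (σ.nat a : ℝ)
  | realAdd d a b, σ => σ.setReal d (σ.real a + σ.real b)
  | realSub d a b, σ => σ.setReal d (σ.real a - σ.real b)
  | realMul d a b, σ => σ.setReal d (σ.real a * σ.real b)
  | realDiv d a b, σ => σ.setReal d (σ.real a / σ.real b)
  | realExp d a, σ => σ.setReal d (Real.exp (σ.real a))
  | realLog d a, σ => σ.setReal d (Real.log (σ.real a))
  | realLoad d a, σ => σ.setReal d (σ.real (σ.nat a))
  | realStore d a, σ => σ.setReal (σ.nat d) (σ.real a)
  | draw d, σ => { σ.setReal d (u σ.draws : ℝ) with draws := σ.draws + 1 }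
  | evalQuery d a, σ => σ.setReal d (ev (σ.nat a))

/-- A configuration: the code that remains to be executed (a stack) and the memory. -/
abbrev RAMConfig : Type := List Program × RAMState

open Classical in
/-- One step of the machine; a configuration with nothing left to execute has halted. -/
noncomputable def RAMConfig.step (ev : ℕ → ℝ) (u : ℕ → unitInterval) : RAMConfig → RAMConfig
  | ([], σ) => ([], σ)
  | (.instr i :: K, σ) => (K, i.exec ev u σ)
  | (.seq p q :: K, σ) => (p :: q :: K, σ)
  | (.ite b p q :: K, σ) => if b.holds σ then (p :: K, σ) else (q :: K, σ)
  | (.while b p :: K, σ) => if b.holds σ then (p :: .while b p :: K, σ) else (K, σ)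

/-- The public parameters: the size `n` of the dataset, the number `t` of sample points that a
query takes, the number `k` of queries, the precision `ζ` and the failure probability `β`. -/
structure Params where
  n : ℕ
  t : ℕ
  k : ℕ
  ζ : ℝ
  β : ℝ

/-- The memory at the start: the parameters in the first cells, and zero elsewhere. -/
noncomputable def Params.initState (p : Params) : RAMState where
  nat := fun i => if i = 0 then p.n else if i = 1 then p.t else if i = 2 then p.k else 0
  real := fun i => if i = 0 then p.ζ else if i = 1 then p.β else 0
  draws := 0

/-- The value of the query `φ` on `(s_a, …, s_{a+t-1})`, and `0` if the block does not fit into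
the dataset. -/
def blockEval {X : Type*} {n t : ℕ} (s : Fin n → X) (φ : (Fin t → X) → ℝ) (a : ℕ) : ℝ :=
  if h : a + t ≤ n then φ (fun l => s ⟨a + l, by omega⟩) else 0

section Run

variable {X : Type*} (M : Program) (p : Params)
  (s : Fin p.n → X) (φ : (Fin p.t → X) → ℝ) (u : ℕ → unitInterval)

/-- The configuration after `T` steps of `M` on dataset `s`, query `φ` and random numbers `u`. -/
noncomputable def Program.configAt (T : ℕ) : RAMConfig :=
  (RAMConfig.step (blockEval s φ) u)^[T] ([M], p.initState)

/-- `M` has halted after `T` steps. -/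
def Program.HaltedAt (T : ℕ) : Prop :=
  (M.configAt p s φ u T).1 = []

open Classical in
/-- The answer of `M` to the query `φ`: the content of the first real cell when `M` halts
(`0` if it never does). -/
noncomputable def Program.answer : ℝ :=
  if h : ∃ T, M.HaltedAt p s φ u T then (M.configAt p s φ u (Nat.find h)).2.real 0 else 0

end Run

/-! ### The interaction -/

/-- A randomized adaptive analyst with internal randomness `ω : Ω`.  The next query is a function
of `ω` and of the list of answers received so far (oldest first); the earlier queries are
themselves functions of these. -/
structure Analyst (X : Type*) [MeasurableSpace X] (t : ℕ) (Ω : Type*) [MeasurableSpace Ω] where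
  query : Ω → List ℝ → (Fin t → X) → ℝ
  measurable_query : ∀ hist : List ℝ,
    Measurable (fun q : Ω × (Fin t → X) => query q.1 hist q.2)

section Interact

variable {X : Type*} [MeasurableSpace X] {Ω : Type*} [MeasurableSpace Ω]
  (M : Program) (p : Params) (A : Analyst X p.t Ω)
  (s : Fin p.n → X) (u : Fin p.k → ℕ → unitInterval) (ω : Ω)

/-- The answer to the `j`-th query in the interaction of the analyst `A` with the algorithm that
runs `M` on `s` with fresh memory and fresh random numbers `u j` for each query. -/
noncomputable def interactAnswer (j : Fin p.k) : ℝ :=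
  M.answer p s
    (A.query ω (List.ofFn fun i : Fin j.val => interactAnswer ⟨i.val, i.isLt.trans j.isLt⟩)) (u j)
termination_by j.val

/-- The `j`-th query in the interaction. -/
noncomputable def interactQuery (j : Fin p.k) : (Fin p.t → X) → ℝ :=
  A.query ω
    (List.ofFn fun i : Fin j.val => interactAnswer M p A s u ω ⟨i.val, i.isLt.trans j.isLt⟩)

end Interact

/-- The joint law of the dataset (`n` independent samples from `P`), of the random numbers of the
algorithm (for each of the `k` queries a sequence of independent uniform elements of `[0,1]`) and
of the internal randomness of the analyst; the three are independent. -/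
noncomputable def interactMeasure {X : Type*} [MeasurableSpace X] {Ω : Type*} [MeasurableSpace Ω]
    (p : Params) (P : Measure X) [IsProbabilityMeasure P] (ν : Measure Ω)
    [IsProbabilityMeasure ν] :
    Measure ((Fin p.n → X) × (Fin p.k → ℕ → unitInterval) × Ω) :=
  (Measure.pi fun _ => P).prod
    ((Measure.pi fun _ => Measure.infinitePi fun _ : ℕ => (volume : Measure unitInterval)).prod ν)

/-! ### Deviations and query classes -/

/-- Mean absolute deviation of the distribution of `f` under `μ`. -/
noncomputable def meanAbsDev {Z : Type*} [MeasurableSpace Z] (f : Z → ℝ) (μ : Measure Z) : ℝ :=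
  ∫ z, |f z - ∫ y, f y ∂μ| ∂μ

/-- Standard deviation of the distribution of `f` under `μ`. -/
noncomputable def stdDev {Z : Type*} [MeasurableSpace Z] (f : Z → ℝ) (μ : Measure Z) : ℝ :=
  Real.sqrt (variance f μ)

/-- The law of `t` independent samples from `P`. -/
noncomputable abbrev iidLaw {X : Type*} [MeasurableSpace X] (P : Measure X) (t : ℕ) :
    Measure (Fin t → X) :=
  Measure.pi fun _ => P

/-- Queries whose mean lies in `[-1,1]` and whose mean absolute deviation is at most `1`. -/
def madClass {X : Type*} [MeasurableSpace X] (P : Measure X) (t : ℕ) :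
    Set ((Fin t → X) → ℝ) :=
  {φ | Integrable φ (iidLaw P t) ∧ ∫ z, φ z ∂(iidLaw P t) ∈ Set.Icc (-1 : ℝ) 1 ∧
    meanAbsDev φ (iidLaw P t) ≤ 1}

/-- Queries whose mean lies in `[-1,1]` and whose standard deviation is (finite and) at most
`1`. -/
def sdClass {X : Type*} [MeasurableSpace X] (P : Measure X) (t : ℕ) :
    Set ((Fin t → X) → ℝ) :=
  {φ | MemLp φ 2 (iidLaw P t) ∧ ∫ z, φ z ∂(iidLaw P t) ∈ Set.Icc (-1 : ℝ) 1 ∧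
    stdDev φ (iidLaw P t) ≤ 1}

/-- The expression `t √(k log(1/β)) log(k/(ζβ))` inside the bound on the number of samples.  For
`β > 1/2` it is frozen at its value for `β = 1/2`, since `log (1/β)` degenerates as `β → 1`. -/
noncomputable def Params.sampleRate (p : Params) : ℝ :=
  p.t * Real.sqrt (p.k * Real.log (1 / min p.β (1 / 2))) *
    Real.log (p.k / (p.ζ * min p.β (1 / 2)))

/-! The data are cut into `m = n / t` disjoint blocks, and a query is evaluated and truncated to
`[-1,1]` on each. The answer is a random approximate median of these values. A point `x` gets the
density `weight`, equal to one unless clearly more than half of the values lie on one side of `x` at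
distance more than `h = ζ/2`, and decaying exponentially in the excess at rate `η`. The interval
`[-1,1]` is divided into `2 ^ D` cells of width at most `ζ/2`; a cell is drawn with its share of the
total weight and its left endpoint is returned.

Efficiency. After sorting by value, each one-sided factor telescopes along the ranks, and at any
point at least one of the two factors is one (`weight_eq_sum`). The density is thus an explicit sum
of step functions, and its primitive `cumWeight` is evaluated exactly in `O(m²)` operations
(`cumWeight_eq_integral`). One uniform number and bisection on the primitive then sample a cell
exactly (`volume_selectCell`), in a number of rounds logarithmic in `1/ζ`.

Sample accuracy. The total weight is at least `h`, since the weight is one near a median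
(`le_cumWeight_one`). A cell with fewer than three eighths of the values on one of its sides, up to
the tolerance `h`, has density at most `exp (-η m / 8)`. Such cells are therefore rarely chosen
(`sum_cellProb_not_accurateAt_le`).

Stability. Changing one block changes every cell probability by a factor of at most `exp (8 η)`
(`cellProb_le_of_eq_off`). For `k` adaptive answers, the moments of the likelihood ratio multiply
along the transcript, and a Chernoff argument gives a factor `exp θ` and a small additive error
(`sum_treeProd_mul_le`). Only `k η²` enters, and this is the source of the square root of `k` in the
sample size.

Generalization. If an answer errs by more than `4 MAD + ζ` or `2 sd + ζ`, then Markov's or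
Chebyshev's inequality puts it in a tail: some event of probability at most `1/4` holds on three
eighths of the blocks whenever the answer is accurate on the sample. Exchanging a block with a fresh
one preserves the joint law, and by stability it hardly changes the law of the transcript. A
transcript therefore cannot often select an event that is so overrepresented in the sample: `3/8`
exceeds `5/4 · 1/4` (`integral_sum_le_of_stable`). One event is selected per transcript, so this
step costs no union bound over the queries.

For `ζ ≥ 1` the constant answer `0` suffices, because the means lie in `[-1,1]`. -/

/-! ### Execution of programs with a bound on the number of steps -/

section Semantics

variable {ev : ℕ → ℝ} {u : ℕ → unitInterval}

/-- `p` leads from the memory `σ` to the memory `σ'` in at most `b` steps. -/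
def RunsWithin (ev : ℕ → ℝ) (u : ℕ → unitInterval) (p : Program) (σ σ' : RAMState) (b : ℕ) :
    Prop :=
  ∃ T ≤ b, ∀ K : List Program, (RAMConfig.step ev u)^[T] (p :: K, σ) = (K, σ')

theorem RunsWithin.mono {p : Program} {σ σ' : RAMState} {b b' : ℕ}
    (h : RunsWithin ev u p σ σ' b) (hb : b ≤ b') : RunsWithin ev u p σ σ' b' := by
  obtain ⟨T, hT, h⟩ := h
  exact ⟨T, hT.trans hb, h⟩

theorem RunsWithin.instr (i : Instr) (σ : RAMState) :
    RunsWithin ev u (.instr i) σ (i.exec ev u σ) 1 :=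
  ⟨1, le_rfl, fun _ => rfl⟩

theorem RunsWithin.seq {p q : Program} {σ σ' σ'' : RAMState} {b b' : ℕ}
    (hp : RunsWithin ev u p σ σ' b) (hq : RunsWithin ev u q σ' σ'' b') :
    RunsWithin ev u (.seq p q) σ σ'' (b + b' + 1) := by
  obtain ⟨T, hT, hp⟩ := hp
  obtain ⟨T', hT', hq⟩ := hq
  refine ⟨T' + (T + 1), by omega, fun K => ?_⟩
  rw [Function.iterate_add_apply, Function.iterate_succ_apply]
  simp only [RAMConfig.step]
  rw [hp, hq]

theorem RunsWithin.ite_pos {t : RAMTest} {p q : Program} {σ σ' : RAMState} {b : ℕ}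
    (ht : t.holds σ) (hp : RunsWithin ev u p σ σ' b) :
    RunsWithin ev u (.ite t p q) σ σ' (b + 1) := by
  obtain ⟨T, hT, hp⟩ := hp
  refine ⟨T + 1, by omega, fun K => ?_⟩
  rw [Function.iterate_succ_apply]
  simp only [RAMConfig.step, if_pos ht]
  exact hp K

theorem RunsWithin.ite_neg {t : RAMTest} {p q : Program} {σ σ' : RAMState} {b : ℕ}
    (ht : ¬ t.holds σ) (hq : RunsWithin ev u q σ σ' b) :
    RunsWithin ev u (.ite t p q) σ σ' (b + 1) := by
  obtain ⟨T, hT, hq⟩ := hq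
  refine ⟨T + 1, by omega, fun K => ?_⟩
  rw [Function.iterate_succ_apply]
  simp only [RAMConfig.step, if_neg ht]
  exact hq K

theorem RunsWithin.while_neg {t : RAMTest} {p : Program} {σ : RAMState}
    (ht : ¬ t.holds σ) : RunsWithin ev u (.while t p) σ σ 1 := by
  refine ⟨1, le_rfl, fun K => ?_⟩
  simp only [Function.iterate_one, RAMConfig.step, if_neg ht]

theorem RunsWithin.while_pos {t : RAMTest} {p : Program} {σ σ' σ'' : RAMState} {b b' : ℕ}
    (ht : t.holds σ) (hp : RunsWithin ev u p σ σ' b)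
    (hw : RunsWithin ev u (.while t p) σ' σ'' b') :
    RunsWithin ev u (.while t p) σ σ'' (b + b' + 1) := by
  obtain ⟨T, hT, hp⟩ := hp
  obtain ⟨T', hT', hw⟩ := hw
  refine ⟨T' + (T + 1), by omega, fun K => ?_⟩
  rw [Function.iterate_add_apply, Function.iterate_succ_apply]
  simp only [RAMConfig.step, if_pos ht]
  rw [hp, hw]

/-- A loop that preserves an invariant and stops after exactly `N` rounds. -/
theorem RunsWithin.exists_while {t : RAMTest} {p : Program} {b N : ℕ}
    {I : ℕ → RAMState → Prop}
    (hstep : ∀ i < N, ∀ σ, I i σ → t.holds σ ∧ ∃ σ', RunsWithin ev u p σ σ' b ∧ I (i + 1) σ')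
    (hexit : ∀ σ, I N σ → ¬ t.holds σ) {σ : RAMState} (h0 : I 0 σ) :
    ∃ σ', RunsWithin ev u (.while t p) σ σ' (N * (b + 1) + 1) ∧ I N σ' := by
  suffices H : ∀ r i σ, i + r = N → I i σ →
      ∃ σ', RunsWithin ev u (.while t p) σ σ' (r * (b + 1) + 1) ∧ I N σ' from
    H N 0 σ (by omega) h0
  intro r
  induction r with
  | zero =>
    rintro i σ rfl hI
    exact ⟨σ, (RunsWithin.while_neg (hexit σ hI)).mono (by omega), hI⟩
  | succ r ih =>
    intro i σ hi hI
    obtain ⟨ht, σ', hrun, hI'⟩ := hstep i (by omega) σ hI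
    obtain ⟨σ'', hrun', hI''⟩ := ih (i + 1) σ' (by omega) hI'
    exact ⟨σ'', (hrun.while_pos ht hrun').mono (by ring_nf; omega), hI''⟩

/-- Programs without loops. -/
def Program.LoopFree : Program → Prop
  | .instr _ => True
  | .seq p q => p.LoopFree ∧ q.LoopFree
  | .ite _ p q => p.LoopFree ∧ q.LoopFree
  | .while _ _ => False

open Classical in
/-- The effect of a loop-free program. -/
noncomputable def Program.effect (ev : ℕ → ℝ) (u : ℕ → unitInterval) :
    Program → RAMState → RAMState
  | .instr i, σ => i.exec ev u σ
  | .seq p q, σ => q.effect ev u (p.effect ev u σ)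
  | .ite t p q, σ => if t.holds σ then p.effect ev u σ else q.effect ev u σ
  | .while _ _, σ => σ

/-- A bound on the number of steps of a loop-free program. -/
def Program.cost : Program → ℕ
  | .instr _ => 1
  | .seq p q => p.cost + q.cost + 1
  | .ite _ p q => max p.cost q.cost + 1
  | .while _ _ => 0

/-- Straight-line code is handled by computing `effect` symbolically, so step counting remains only
for the loops. -/
theorem Program.LoopFree.runsWithin : ∀ {p : Program}, p.LoopFree → ∀ σ : RAMState,
    RunsWithin ev u p σ (p.effect ev u σ) p.cost
  | .instr i, _, σ => RunsWithin.instr i σ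
  | .seq _ _, hp, σ =>
    (Program.LoopFree.runsWithin hp.1 σ).seq (Program.LoopFree.runsWithin hp.2 _)
  | .ite t p q, hp, σ => by
    by_cases ht : t.holds σ
    · simp only [Program.effect, if_pos ht]
      exact ((Program.LoopFree.runsWithin hp.1 σ).ite_pos ht).mono (by simp [Program.cost])
    · simp only [Program.effect, if_neg ht]
      exact ((Program.LoopFree.runsWithin hp.2 σ).ite_neg ht).mono (by simp [Program.cost])
  | .while _ _, hp, _ => hp.elim

end Semantics

theorem RAMConfig.step_iterate_nil (ev : ℕ → ℝ) (u : ℕ → unitInterval) (σ : RAMState) (T : ℕ) :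
    (RAMConfig.step ev u)^[T] ([], σ) = ([], σ) := by
  induction T with
  | zero => rfl
  | succ T ih => rw [Function.iterate_succ_apply]; exact ih

/-- A run from the initial memory determines halting and the answer. -/
theorem Program.halts_and_answer_of_runsWithin {X : Type*} {M : Program} {p : Params}
    {s : Fin p.n → X} {φ : (Fin p.t → X) → ℝ} {u : ℕ → unitInterval} {σ : RAMState} {b : ℕ}
    (h : RunsWithin (blockEval s φ) u M p.initState σ b) :
    (∃ T ≤ b, M.HaltedAt p s φ u T) ∧ M.answer p s φ u = σ.real 0 := by
  classical
  obtain ⟨T, hT, h⟩ := h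
  have hcfg : M.configAt p s φ u T = ([], σ) := h []
  have hhalt : M.HaltedAt p s φ u T := by rw [Program.HaltedAt, hcfg]
  refine ⟨⟨T, hT, hhalt⟩, ?_⟩
  have hex : ∃ T, M.HaltedAt p s φ u T := ⟨T, hhalt⟩
  rw [Program.answer, dif_pos hex]
  have hle : Nat.find hex ≤ T := Nat.find_min' hex hhalt
  have hfind : (M.configAt p s φ u (Nat.find hex)).1 = [] := Nat.find_spec hex
  have hpair : M.configAt p s φ u (Nat.find hex)
      = ([], (M.configAt p s φ u (Nat.find hex)).2) := Prod.ext hfind rfl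
  -- Halted configurations are fixed points of the step map, so the first halting time and `T` see
  -- the same memory.
  have : M.configAt p s φ u T = M.configAt p s φ u (Nat.find hex) := by
    obtain ⟨d, rfl⟩ := Nat.exists_eq_add_of_le hle
    conv_lhs => rw [Program.configAt, Nat.add_comm, Function.iterate_add_apply]
    change (RAMConfig.step (blockEval s φ) u)^[d] (M.configAt p s φ u (Nat.find hex)) = _
    rw [hpair, RAMConfig.step_iterate_nil]
  rw [← this, hcfg]

/-! ### The selection rule -/

/-- Truncation to `[-1,1]`. -/
noncomputable def clampUnit (x : ℝ) : ℝ := 1 - max (2 - max (x + 1) 0) 0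

/-- The penalty `exp (-η q⁺)`. -/
noncomputable def expPos (η q : ℝ) : ℝ := Real.exp (0 - max q 0 * η)

/-- The order on indices by values, ties being broken by the indices. -/
def LexLE (y : ℕ → ℝ) (j i : ℕ) : Prop := if j ≤ i then y j ≤ y i else y j < y i

open Classical in
/-- `2 r - 1 - m`, where `r` is the rank of `y i` among `y 0, …, y (m - 1)`. -/
noncomputable def centeredRank (m : ℕ) (y : ℕ → ℝ) (i : ℕ) : ℝ :=
  -1 + ∑ j ∈ Finset.range m, if LexLE y j i then 1 else -1

/-- The contribution of the value `y` of centered rank `R` to the cumulative weight at `x`. -/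
noncomputable def rankTerm (η h R y x : ℝ) : ℝ :=
  (expPos η R - expPos η (R - 2)) * max (x - y - h) 0 +
    (expPos η (-R) - expPos η (-R - 2)) * max (x + 1 - max (x - y + h) 0) 0

/-- The cumulative weight of `[-1,x]`. -/
noncomputable def cumWeight (η h : ℝ) (m : ℕ) (y : ℕ → ℝ) (x : ℝ) : ℝ :=
  (x + 1) + ∑ i ∈ Finset.range m, rankTerm η h (centeredRank m y i) (y i) x

open Classical in
/-- The left endpoint found after `r` rounds of bisection of `[-1,1]` for the level `τ` of `F`. -/
noncomputable def bisect (F : ℝ → ℝ) (τ : ℝ) : ℕ → ℝ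
  | 0 => -1
  | r + 1 => if F (bisect F τ r + 2 / 2 ^ (r + 1)) ≤ τ then bisect F τ r + 2 / 2 ^ (r + 1)
      else bisect F τ r

/-! ### The program -/

namespace MedianProgram

/-- Sequential composition of a nonempty list of programs. -/
def block : Program → List Program → Program
  | p, [] => p
  | p, q :: l => .seq p (block q l)

/-- `real[d] := max real[d] 0`, when `real[8] = 0`. -/
def relu (d : ℕ) : Program :=
  .ite (.realLt d 8) (.instr (.realConst d 0)) (.instr (.realAdd d d 8))

/-- `real[d] :=` the truncated value of the query on the block at `nat[a]`. -/
def loadClamped (d a : ℕ) : Program :=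
  block (.instr (.evalQuery d a)) [.instr (.realAdd d d 9), relu d, .instr (.realSub d 10 d),
    relu d, .instr (.realSub d 9 d)]

/-- `real[d] := exp (- real[3] * max real[d] 0)`. -/
def expPosOf (d : ℕ) : Program :=
  block (relu d) [.instr (.realMul d d 3), .instr (.realSub d 8 d), .instr (.realExp d d)]

/-- One comparison in the computation of a rank. -/
def rankBody : Program :=
  block (loadClamped 14 5)
    [.ite (.natLe 5 3)
      (.ite (.realLe 14 12) (.instr (.realAdd 13 13 9)) (.instr (.realSub 13 13 9)))
      (.ite (.realLt 14 12) (.instr (.realAdd 13 13 9)) (.instr (.realSub 13 13 9))),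
    .instr (.natAdd 5 5 1), .instr (.natAdd 6 6 1)]

/-- The cells `nat[5]` and `nat[6]` hold the start and the end of the current block. The loop test
`nat[6] ≤ nat[0]` says that the block fits into the sample, so `n / t` is never computed. -/
def rankInit : Program :=
  block (.instr (.realSub 13 8 9)) [.instr (.natConst 5 0), .instr (.natAdd 6 5 1)]

/-- `real[13] :=` the centered rank of `real[12]`, the value at the block at `nat[3]`. -/
def rank : Program := .seq rankInit (.while (.natLe 6 0) rankBody)

/-- Add the term of the current block to `real[11]` and go to the next block. -/
def termBody : Program :=
  block (.instr (.realAdd 15 13 8))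
    [expPosOf 15, .instr (.realSub 16 13 10), expPosOf 16, .instr (.realSub 15 15 16),
     .instr (.realSub 16 7 12), .instr (.realSub 16 16 4), relu 16,
     .instr (.realMul 15 15 16), .instr (.realAdd 11 11 15),
     .instr (.realSub 15 8 13), .instr (.realSub 16 15 10), expPosOf 15, expPosOf 16,
     .instr (.realSub 15 15 16),
     .instr (.realSub 16 7 12), .instr (.realAdd 16 16 4), relu 16,
     .instr (.realAdd 17 7 9), .instr (.realSub 17 17 16), relu 17,
     .instr (.realMul 15 15 17), .instr (.realAdd 11 11 15),
     .instr (.natAdd 3 3 1), .instr (.natAdd 4 4 1)]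

def cumInit : Program :=
  block (.instr (.realAdd 11 7 9)) [.instr (.natConst 3 0), .instr (.natAdd 4 3 1)]

/-- `real[11] :=` the cumulative weight at `real[7]`. -/
def cum : Program :=
  .seq cumInit (.while (.natLe 4 0) (.seq (loadClamped 12 3) (.seq rank termBody)))

def constants : Program :=
  block (.instr (.realConst 8 0)) [.instr (.realConst 9 1), .instr (.realConst 10 2)]

/-- Compute `η` and `h`, draw a random number and prepare the evaluation at `1`. -/
def setup : Program :=
  block (.instr (.realDiv 4 0 10))
    [.instr (.realDiv 11 9 10), .instr (.realSub 12 1 11), relu 12, .instr (.realSub 12 1 12),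
     .instr (.realMul 12 0 12), .instr (.realCast 13 2), .instr (.realDiv 13 13 12),
     .instr (.realLog 13 13), .instr (.realCast 14 1), .instr (.realMul 13 13 14),
     .instr (.realCast 14 0), .instr (.realDiv 13 13 14), .instr (.realConst 14 128),
     .instr (.realMul 3 13 14), .instr (.draw 2), .instr (.realAdd 7 8 9)]

/-- At this point `real[11]` holds the total weight, so `real[2]` turns from a uniform number into
the level sought. `real[5]` and `real[6]` become the left endpoint and the width of the current
interval. -/
def bisectInit : Program :=
  block (.instr (.realMul 2 2 11)) [.instr (.realSub 5 8 9), .instr (.realAdd 6 8 10)]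

def halve : Program := .seq (.instr (.realDiv 6 6 10)) (.instr (.realAdd 7 5 6))

def choose : Program :=
  .ite (.realLe 11 2) (.instr (.realAdd 5 7 8)) (.instr (.realAdd 5 5 8))

/-- The loop stops once the width is at most `real[4] = h`. -/
def search : Program := .while (.realLt 4 6) (.seq halve (.seq cum choose))

/-- The program that answers a query by a stable approximate median. -/
def main : Program :=
  .seq constants (.ite (.realLe 9 0) (.instr (.realConst 0 0))
    (.seq setup (.seq cum (.seq bisectInit (.seq search (.instr (.realAdd 0 5 8)))))))

/-! ### Correctness and running time of the program. -/

section Correctness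

variable {ev : ℕ → ℝ} {u : ℕ → unitInterval}

/-- The registers `8, 9, 10` hold the constants `0, 1, 2`. -/
def HasConstants (σ : RAMState) : Prop := σ.real 8 = 0 ∧ σ.real 9 = 1 ∧ σ.real 10 = 2

/-- With no skip instruction available, adding the zero in `real[8]` serves as the empty branch. -/
theorem effect_relu {d : ℕ} {σ : RAMState} (h : σ.real 8 = 0) :
    (relu d).effect ev u σ = σ.setReal d (max (σ.real d) 0) := by
  simp only [relu, Program.effect, RAMTest.holds, Instr.exec, h]
  split_ifs with hd
  · rw [max_eq_right hd.le]; simp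
  · rw [max_eq_left (not_lt.1 hd)]; simp

theorem effect_expPosOf {d : ℕ} {σ : RAMState} (h : σ.real 8 = 0) (h8 : d ≠ 8) (h3 : d ≠ 3) :
    (expPosOf d).effect ev u σ = σ.setReal d (expPos (σ.real 3) (σ.real d)) := by
  simp [expPosOf, block, Program.effect, effect_relu h, Instr.exec, RAMState.setReal, expPos,
    Function.update_of_ne h8.symm, Function.update_of_ne h3.symm, h]

theorem effect_loadClamped {d a : ℕ} {σ : RAMState} (h : HasConstants σ) (hd : 10 < d) :
    (loadClamped d a).effect ev u σ = σ.setReal d (clampUnit (ev (σ.nat a))) := by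
  obtain ⟨h8, h9, h10⟩ := h
  have n8 : 8 ≠ d := by omega
  have n9 : 9 ≠ d := by omega
  have n10 : 10 ≠ d := by omega
  simp [loadClamped, block, Program.effect, effect_relu, Instr.exec, RAMState.setReal,
    Function.update_of_ne n8, Function.update_of_ne n9, Function.update_of_ne n10, h8, h9, h10,
    clampUnit]

/-- The truncated values of the query on the successive blocks of length `t`. -/
noncomputable def blockValues (ev : ℕ → ℝ) (t : ℕ) (j : ℕ) : ℝ := clampUnit (ev (j * t))

/-- Translates the loop test of the program into a number of rounds. -/
theorem block_le_iff {t n j : ℕ} (ht : 0 < t) : j * t + t ≤ n ↔ j < n / t := by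
  rw [Nat.lt_iff_add_one_le, Nat.le_div_iff_mul_le ht, add_mul, one_mul]

theorem effect_rankBody {σ : RAMState} (h : HasConstants σ) {t i j : ℕ} (ht : 0 < t)
    (h1 : σ.nat 1 = t) (h3 : σ.nat 3 = i * t) (h5 : σ.nat 5 = j * t)
    (h12 : σ.real 12 = blockValues ev t i) :
    (rankBody.effect ev u σ).real 13
        = σ.real 13 + (open Classical in if LexLE (blockValues ev t) j i then 1 else -1) ∧
      (∀ r < 13, (rankBody.effect ev u σ).real r = σ.real r) ∧
      (∀ r < 5, (rankBody.effect ev u σ).nat r = σ.nat r) ∧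
      (rankBody.effect ev u σ).nat 5 = σ.nat 5 + t ∧
      (rankBody.effect ev u σ).nat 6 = σ.nat 6 + t ∧
      (rankBody.effect ev u σ).draws = σ.draws := by
  classical
  have h9 := h.2.1
  -- The machine breaks ties by comparing block offsets; for `t > 0` this is the order of the
  -- indices.
  have hle : j * t ≤ i * t ↔ j ≤ i := Nat.mul_le_mul_right_iff ht
  have hval : clampUnit (ev (j * t)) = blockValues ev t j := rfl
  simp only [rankBody, block, Program.effect, effect_loadClamped h (show 10 < 14 by norm_num),
    RAMTest.holds, Instr.exec, RAMState.setReal, RAMState.setNat]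
  by_cases hji : j ≤ i
  · by_cases hv : blockValues ev t j ≤ blockValues ev t i
    · simp [Function.update_apply, h1, h3, h5, h9, h12, hle, hval, hji, hv, LexLE]
      grind
    · simp [Function.update_apply, h1, h3, h5, h9, h12, hle, hval, hji, hv, LexLE]
      grind
  · by_cases hv : blockValues ev t j < blockValues ev t i
    · simp [Function.update_apply, h1, h3, h5, h9, h12, hle, hval, hji, hv, LexLE]
      grind
    · simp [Function.update_apply, h1, h3, h5, h9, h12, hle, hval, hji, hv, LexLE]
      grind

theorem runs_rank {σ : RAMState} (h : HasConstants σ) {n t i : ℕ} (ht : 0 < t)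
    (h0 : σ.nat 0 = n) (h1 : σ.nat 1 = t) (h3 : σ.nat 3 = i * t)
    (h12 : σ.real 12 = blockValues ev t i) :
    ∃ σ', RunsWithin ev u rank σ σ' (n / t * 30 + 10) ∧
      σ'.real 13 = centeredRank (n / t) (blockValues ev t) i ∧
      (∀ r < 13, σ'.real r = σ.real r) ∧ (∀ r < 5, σ'.nat r = σ.nat r) ∧
      σ'.draws = σ.draws := by
  classical
  obtain ⟨h8, h9, h10⟩ := id h
  -- After `j` rounds the sum defining the centered rank has been accumulated up to index `j`, and
  -- the outer loop's registers are untouched.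
  let I : ℕ → RAMState → Prop := fun j τ =>
    τ.real 13 = -1 + ∑ l ∈ Finset.range j, (if LexLE (blockValues ev t) l i then 1 else -1) ∧
      (∀ r < 13, τ.real r = σ.real r) ∧ (∀ r < 5, τ.nat r = σ.nat r) ∧
      τ.nat 5 = j * t ∧ τ.nat 6 = j * t + t ∧ τ.draws = σ.draws
  have hinit : I 0 (rankInit.effect ev u σ) := by
    simp only [rankInit, block, Program.effect, Instr.exec, RAMState.setReal, RAMState.setNat, I]
    simp [Function.update_apply, h8, h9, h1]
    grind
  have hstep : ∀ j < n / t, ∀ τ, I j τ → (RAMTest.natLe 6 0).holds τ ∧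
      ∃ τ', RunsWithin ev u rankBody τ τ' rankBody.cost ∧ I (j + 1) τ' := by
    rintro j hj τ ⟨hr, hreal, hnat, h5, h6, hd⟩
    have hc : HasConstants τ := by
      simp only [HasConstants, hreal 8 (by norm_num), hreal 9 (by norm_num),
        hreal 10 (by norm_num)]
      exact h
    obtain ⟨e1, e2, e3, e4, e5, e6⟩ := effect_rankBody (ev := ev) (u := u) hc ht
      ((hnat 1 (by norm_num)).trans h1) ((hnat 3 (by norm_num)).trans h3) h5
      ((hreal 12 (by norm_num)).trans h12)
    refine ⟨?_, rankBody.effect ev u τ, Program.LoopFree.runsWithin ?_ τ, ?_, ?_, ?_, ?_, ?_, ?_⟩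
    · simp only [RAMTest.holds, h6, hnat 0 (by norm_num), h0]
      exact (block_le_iff ht).2 hj
    · simp [rankBody, block, loadClamped, relu, Program.LoopFree]
    · rw [e1, hr, Finset.sum_range_succ, add_assoc]
    · intro r hr
      rw [e2 r hr, hreal r hr]
    · intro r hr
      rw [e3 r hr, hnat r hr]
    · rw [e4, h5]; ring
    · rw [e5, h6]; ring
    · rw [e6, hd]
  have hexit : ∀ τ, I (n / t) τ → ¬ (RAMTest.natLe 6 0).holds τ := by
    rintro τ ⟨-, -, hnat, -, h6, -⟩
    simp only [RAMTest.holds, h6, hnat 0 (by norm_num), h0]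
    exact fun hle => lt_irrefl _ ((block_le_iff ht).1 hle)
  obtain ⟨σ', hrun, hI⟩ := RunsWithin.exists_while hstep hexit hinit
  refine ⟨σ', ((Program.LoopFree.runsWithin (p := rankInit) ?_ σ).seq hrun).mono ?_, ?_⟩
  · simp [rankInit, block, Program.LoopFree]
  · have : rankBody.cost ≤ 29 := by decide
    have h' : rankInit.cost ≤ 8 := by decide
    have := Nat.mul_le_mul_left (n / t) (show rankBody.cost + 1 ≤ 30 by omega)
    omega
  · obtain ⟨e1, e2, e3, -, -, e6⟩ := hI
    exact ⟨e1, e2, e3, e6⟩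

theorem effect_termBody {σ : RAMState} (h : HasConstants σ) :
    (termBody.effect ev u σ).real 11
        = σ.real 11 + rankTerm (σ.real 3) (σ.real 4) (σ.real 13) (σ.real 12) (σ.real 7) ∧
      (∀ r < 11, (termBody.effect ev u σ).real r = σ.real r) ∧
      (∀ r < 3, (termBody.effect ev u σ).nat r = σ.nat r) ∧
      (termBody.effect ev u σ).nat 3 = σ.nat 3 + σ.nat 1 ∧
      (termBody.effect ev u σ).nat 4 = σ.nat 4 + σ.nat 1 ∧
      (termBody.effect ev u σ).draws = σ.draws := by
  obtain ⟨h8, h9, h10⟩ := id h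
  simp [termBody, block, Program.effect, effect_relu, effect_expPosOf, Instr.exec,
    RAMState.setReal, RAMState.setNat, Function.update_apply, h8, h9, h10]
  refine ⟨by rw [rankTerm]; ring_nf, ?_, ?_⟩
  · grind
  · grind

/-- Each of the `n / t` terms recomputes a rank by a full pass over the blocks, hence the quadratic
cost. -/
theorem runs_cum {σ : RAMState} (h : HasConstants σ) {n t : ℕ} (ht : 0 < t)
    (h0 : σ.nat 0 = n) (h1 : σ.nat 1 = t) :
    ∃ σ', RunsWithin ev u cum σ σ' (n / t * (n / t * 30 + 200) + 10) ∧
      σ'.real 11 = cumWeight (σ.real 3) (σ.real 4) (n / t) (blockValues ev t) (σ.real 7) ∧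
      (∀ r < 11, σ'.real r = σ.real r) ∧ (∀ r < 3, σ'.nat r = σ.nat r) ∧
      σ'.draws = σ.draws := by
  obtain ⟨h8, h9, h10⟩ := id h
  let y := blockValues ev t
  let I : ℕ → RAMState → Prop := fun i τ =>
    τ.real 11 = (σ.real 7 + 1) + ∑ l ∈ Finset.range i,
        rankTerm (σ.real 3) (σ.real 4) (centeredRank (n / t) y l) (y l) (σ.real 7) ∧
      (∀ r < 11, τ.real r = σ.real r) ∧ (∀ r < 3, τ.nat r = σ.nat r) ∧
      τ.nat 3 = i * t ∧ τ.nat 4 = i * t + t ∧ τ.draws = σ.draws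
  have hinit : I 0 (cumInit.effect ev u σ) := by
    simp only [cumInit, block, Program.effect, Instr.exec, RAMState.setReal, RAMState.setNat, I]
    simp [Function.update_apply, h9, h1]
    grind
  have hstep : ∀ i < n / t, ∀ τ, I i τ → (RAMTest.natLe 4 0).holds τ ∧
      ∃ τ', RunsWithin ev u (.seq (loadClamped 12 3) (.seq rank termBody)) τ τ'
        (n / t * 30 + 199) ∧ I (i + 1) τ' := by
    rintro i hi τ ⟨hr, hreal, hnat, h3, h4, hd⟩
    have hc : HasConstants τ := by
      simp only [HasConstants, hreal 8 (by norm_num), hreal 9 (by norm_num),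
        hreal 10 (by norm_num)]
      exact h
    have hload := effect_loadClamped (ev := ev) (u := u) (d := 12) (a := 3) hc (by norm_num)
    have hrun1 := Program.LoopFree.runsWithin (ev := ev) (u := u) (p := loadClamped 12 3)
      (by simp [block, loadClamped, relu, Program.LoopFree]) τ
    rw [hload] at hrun1
    set τ₁ := τ.setReal 12 (clampUnit (ev (τ.nat 3))) with hτ₁
    have hreal₁ : ∀ r < 12, τ₁.real r = τ.real r := fun r hr => by
      simp [hτ₁, RAMState.setReal, Function.update_of_ne hr.ne]
    have hnat₁ : τ₁.nat = τ.nat := rfl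
    have hc₁ : HasConstants τ₁ := by
      simp only [HasConstants, hreal₁ 8 (by norm_num), hreal₁ 9 (by norm_num),
        hreal₁ 10 (by norm_num)]
      exact hc
    have h12 : τ₁.real 12 = y i := by
      simp [hτ₁, RAMState.setReal, h3, y, blockValues]
    obtain ⟨τ₂, hrun2, hrank, hreal₂, hnat₂, hd₂⟩ := runs_rank (ev := ev) (u := u) hc₁ ht
      (by rw [hnat₁, hnat 0 (by norm_num), h0]) (by rw [hnat₁, hnat 1 (by norm_num), h1])
      (by rw [hnat₁, h3]) h12
    have hc₂ : HasConstants τ₂ := by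
      simp only [HasConstants, hreal₂ 8 (by norm_num), hreal₂ 9 (by norm_num),
        hreal₂ 10 (by norm_num)]
      exact hc₁
    obtain ⟨e1, e2, e3, e4, e5, e6⟩ := effect_termBody (ev := ev) (u := u) hc₂
    have hrun3 := Program.LoopFree.runsWithin (ev := ev) (u := u) (p := termBody)
      (by simp [termBody, block, expPosOf, relu, Program.LoopFree]) τ₂
    have keep : ∀ r < 11, τ₂.real r = σ.real r := fun r hr => by
      rw [hreal₂ r (by omega), hreal₁ r (by omega), hreal r hr]
    have keepn : ∀ r < 3, τ₂.nat r = σ.nat r := fun r hr => by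
      rw [hnat₂ r (by omega), hnat₁, hnat r hr]
    refine ⟨?_, termBody.effect ev u τ₂, (hrun1.seq (hrun2.seq hrun3)).mono ?_,
      ?_, ?_, ?_, ?_, ?_, ?_⟩
    · simp only [RAMTest.holds, h4, hnat 0 (by norm_num), h0]
      exact (block_le_iff ht).2 hi
    · have c1 : (loadClamped 12 3).cost ≤ 30 := by decide
      have c2 : termBody.cost ≤ 150 := by decide
      omega
    · rw [e1, hrank, keep 3 (by norm_num), keep 4 (by norm_num), keep 7 (by norm_num),
        hreal₂ 12 (by norm_num), h12, hreal₂ 11 (by norm_num), hreal₁ 11 (by norm_num), hr,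
        Finset.sum_range_succ, add_assoc]
    · intro r hr
      rw [e2 r hr, keep r hr]
    · intro r hr
      rw [e3 r hr, keepn r hr]
    · rw [e4, hnat₂ 3 (by norm_num), hnat₁, h3, keepn 1 (by norm_num), h1]; ring
    · rw [e5, hnat₂ 4 (by norm_num), hnat₁, h4, keepn 1 (by norm_num), h1]; ring
    · rw [e6, hd₂]; exact hd
  have hexit : ∀ τ, I (n / t) τ → ¬ (RAMTest.natLe 4 0).holds τ := by
    rintro τ ⟨-, -, hnat, -, h4, -⟩
    simp only [RAMTest.holds, h4, hnat 0 (by norm_num), h0]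
    exact fun hle => lt_irrefl _ ((block_le_iff ht).1 hle)
  obtain ⟨σ', hrun, hI⟩ := RunsWithin.exists_while hstep hexit hinit
  refine ⟨σ', ((Program.LoopFree.runsWithin (p := cumInit) ?_ σ).seq hrun).mono ?_, ?_⟩
  · simp [cumInit, block, Program.LoopFree]
  · have h' : cumInit.cost ≤ 8 := by decide
    rw [add_assoc (n / t * 30) 199 1]
    omega
  · obtain ⟨e1, e2, e3, -, -, e6⟩ := hI
    exact ⟨e1, e2, e3, e6⟩

/-- The two conditions on `D` say that it is the first depth at which the cell width is at most `h`.
The number of rounds is therefore the same for all data, and all answers lie on one grid. -/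
theorem runs_search {σ : RAMState} (h : HasConstants σ) {n t D : ℕ} (ht : 0 < t)
    (h0 : σ.nat 0 = n) (h1 : σ.nat 1 = t) (h5 : σ.real 5 = -1) (h6 : σ.real 6 = 2)
    (hD : 2 / 2 ^ D ≤ σ.real 4) (hD' : ∀ r < D, σ.real 4 < 2 / 2 ^ r) :
    ∃ σ', RunsWithin ev u search σ σ' (D * (n / t * (n / t * 30 + 200) + 30) + 1) ∧
      σ'.real 5 = bisect (cumWeight (σ.real 3) (σ.real 4) (n / t) (blockValues ev t))
        (σ.real 2) D ∧ HasConstants σ' := by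
  obtain ⟨h8, h9, h10⟩ := id h
  set F := cumWeight (σ.real 3) (σ.real 4) (n / t) (blockValues ev t) with hF
  let I : ℕ → RAMState → Prop := fun r τ =>
    τ.real 5 = bisect F (σ.real 2) r ∧ τ.real 6 = 2 / 2 ^ r ∧
      (∀ r < 5, τ.real r = σ.real r) ∧ HasConstants τ ∧ (∀ r < 3, τ.nat r = σ.nat r)
  have hinit : I 0 σ := ⟨h5, by simpa using h6, fun _ _ => rfl, h, fun _ _ => rfl⟩
  have hstep : ∀ r < D, ∀ τ, I r τ → (RAMTest.realLt 4 6).holds τ ∧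
      ∃ τ', RunsWithin ev u (.seq halve (.seq cum choose)) τ τ'
        (n / t * (n / t * 30 + 200) + 29) ∧ I (r + 1) τ' := by
    rintro r hr τ ⟨hlo, hδ, hreal, hc, hnat⟩
    refine ⟨by simpa only [RAMTest.holds, hδ, hreal 4 (by norm_num)] using hD' r hr, ?_⟩
    have hrun1 := Program.LoopFree.runsWithin (ev := ev) (u := u) (p := halve)
      (by simp [halve, Program.LoopFree]) τ
    have hhalf : (2 : ℝ) / 2 ^ r / 2 = 2 / 2 ^ (r + 1) := by rw [pow_succ, div_div]
    have f5 : (halve.effect ev u τ).real 5 = bisect F (σ.real 2) r := by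
      simp [halve, Program.effect, Instr.exec, RAMState.setReal, hlo]
    have f6 : (halve.effect ev u τ).real 6 = 2 / 2 ^ (r + 1) := by
      simp [halve, Program.effect, Instr.exec, RAMState.setReal, hδ, hc.2.2, hhalf]
    have f7 : (halve.effect ev u τ).real 7 = bisect F (σ.real 2) r + 2 / 2 ^ (r + 1) := by
      simp [halve, Program.effect, Instr.exec, RAMState.setReal, hδ, hlo, hc.2.2, hhalf]
    have fr : ∀ r, r ≠ 6 → r ≠ 7 → (halve.effect ev u τ).real r = τ.real r := by
      intro r h6 h7
      simp [halve, Program.effect, Instr.exec, RAMState.setReal, h6, h7]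
    have fn : (halve.effect ev u τ).nat = τ.nat := rfl
    set τ₁ := halve.effect ev u τ
    have hc₁ : HasConstants τ₁ := by
      simp only [HasConstants, fr 8 (by norm_num) (by norm_num), fr 9 (by norm_num) (by norm_num),
        fr 10 (by norm_num) (by norm_num)]
      exact hc
    obtain ⟨τ₂, hrun2, g11, greal, gnat, -⟩ := runs_cum (ev := ev) (u := u) hc₁ ht
      (by rw [fn, hnat 0 (by norm_num), h0]) (by rw [fn, hnat 1 (by norm_num), h1])
    rw [fr 3 (by norm_num) (by norm_num), fr 4 (by norm_num) (by norm_num),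
      hreal 3 (by norm_num), hreal 4 (by norm_num), f7, ← hF] at g11
    have hrun3 := Program.LoopFree.runsWithin (ev := ev) (u := u) (p := choose)
      (by simp [choose, Program.LoopFree]) τ₂
    have keep : ∀ r < 5, τ₂.real r = σ.real r := fun r hr => by
      rw [greal r (by omega), fr r (by omega) (by omega), hreal r hr]
    have hc₂ : HasConstants τ₂ := by
      simp only [HasConstants, greal 8 (by norm_num), greal 9 (by norm_num),
        greal 10 (by norm_num)]
      exact hc₁
    have e5 : (choose.effect ev u τ₂).real 5 = bisect F (σ.real 2) (r + 1) := by
      simp only [choose, Program.effect, RAMTest.holds, g11, keep 2 (by norm_num), bisect,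
        Instr.exec, RAMState.setReal]
      split_ifs
      · simp [greal 7, f7, hc₂.1]
      · simp [greal 5, f5, hc₂.1]
    have er : ∀ r, r ≠ 5 → (choose.effect ev u τ₂).real r = τ₂.real r := by
      intro r h5
      simp only [choose, Program.effect, Instr.exec, RAMState.setReal]
      split_ifs <;> simp [h5]
    have en : (choose.effect ev u τ₂).nat = τ₂.nat := by
      simp only [choose, Program.effect, Instr.exec, RAMState.setReal]
      split_ifs <;> rfl
    refine ⟨choose.effect ev u τ₂, (hrun1.seq (hrun2.seq hrun3)).mono ?_, e5, ?_, ?_, ?_, ?_⟩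
    · have c1 : halve.cost ≤ 5 := by decide
      have c2 : choose.cost ≤ 5 := by decide
      omega
    · rw [er 6 (by norm_num), greal 6 (by norm_num), f6]
    · intro r hr
      rw [er r (by omega), keep r hr]
    · simp only [HasConstants, er 8 (by norm_num), er 9 (by norm_num), er 10 (by norm_num)]
      exact hc₂
    · intro r hr
      rw [en, gnat r hr, fn, hnat r hr]
  have hexit : ∀ τ, I D τ → ¬ (RAMTest.realLt 4 6).holds τ := by
    rintro τ ⟨-, hδ, hreal, -, -⟩
    simpa only [RAMTest.holds, hδ, hreal 4 (by norm_num), not_lt] using hD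
  obtain ⟨σ', hrun, e1, -, -, e4, -⟩ := RunsWithin.exists_while hstep hexit hinit
  exact ⟨σ', hrun, e1, e4⟩

/-- The rate of the penalty used by the program. -/
noncomputable def rate (p : Params) : ℝ :=
  Real.log (p.k / (p.ζ * min p.β (1 / 2))) * p.t / p.n * 128

theorem effect_constants_hasConstants (σ : RAMState) :
    HasConstants (constants.effect ev u σ) := by
  simp [HasConstants, constants, block, Program.effect, Instr.exec, RAMState.setReal]

theorem effect_constants_real {σ : RAMState} {r : ℕ} (hr : r < 8) :
    (constants.effect ev u σ).real r = σ.real r := by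
  simp [constants, block, Program.effect, Instr.exec, RAMState.setReal, hr.ne,
    show r ≠ 9 by omega, show r ≠ 10 by omega]

theorem runs_main_of_one_le {p : Params} (h : 1 ≤ p.ζ) :
    ∃ σ, RunsWithin ev u main p.initState σ 20 ∧ σ.real 0 = 0 := by
  have hrun := Program.LoopFree.runsWithin (ev := ev) (u := u) (p := constants)
    (by simp [constants, block, Program.LoopFree]) p.initState
  have ht : (RAMTest.realLe 9 0).holds (constants.effect ev u p.initState) := by
    simp only [RAMTest.holds, (effect_constants_hasConstants _).2.1,
      effect_constants_real (show 0 < 8 by norm_num)]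
    simpa [Params.initState] using h
  refine ⟨_, (hrun.seq ((RunsWithin.instr (.realConst 0 0) _).ite_pos ht)).mono ?_, ?_⟩
  · have : constants.cost ≤ 8 := by decide
    omega
  · simp [Instr.exec, RAMState.setReal]

theorem runs_main {p : Params} (hζ : p.ζ < 1) (ht : 0 < p.t) {D : ℕ}
    (hD : 2 / 2 ^ D ≤ p.ζ / 2) (hD' : ∀ r < D, p.ζ / 2 < 2 / 2 ^ r) :
    ∃ σ, RunsWithin ev u main p.initState σ
        ((D + 1) * (p.n / p.t * (p.n / p.t * 30 + 200) + 30) + 150) ∧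
      σ.real 0 = bisect (cumWeight (rate p) (p.ζ / 2) (p.n / p.t) (blockValues ev p.t))
        (u 0 * cumWeight (rate p) (p.ζ / 2) (p.n / p.t) (blockValues ev p.t) 1) D := by
  have hrun0 := Program.LoopFree.runsWithin (ev := ev) (u := u) (p := constants)
    (by simp [constants, block, Program.LoopFree]) p.initState
  set σ₀ := constants.effect ev u p.initState with hσ₀
  have hc₀ : HasConstants σ₀ := effect_constants_hasConstants _
  have r0 : σ₀.real 0 = p.ζ := effect_constants_real (by norm_num)
  have r1 : σ₀.real 1 = p.β := effect_constants_real (by norm_num)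
  have n0 : σ₀.nat = p.initState.nat := rfl
  have d0 : σ₀.draws = 0 := rfl
  have htest : ¬ (RAMTest.realLe 9 0).holds σ₀ := by
    simp only [RAMTest.holds, hc₀.2.1, r0, not_le]
    exact hζ
  have hrun1 := Program.LoopFree.runsWithin (ev := ev) (u := u) (p := setup)
    (by simp [setup, block, relu, Program.LoopFree]) σ₀
  -- The program computes the minimum by one truncation at zero.
  have hmin : p.β - max (p.β - 2⁻¹) 0 = min p.β 2⁻¹ := by
    rcases le_total p.β 2⁻¹ with h | h
    · rw [min_eq_left h, max_eq_right (by linarith)]; ring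
    · rw [min_eq_right h, max_eq_left (by linarith)]; ring
  have s_all : HasConstants (setup.effect ev u σ₀) ∧
      (setup.effect ev u σ₀).real 2 = u 0 ∧ (setup.effect ev u σ₀).real 3 = rate p ∧
      (setup.effect ev u σ₀).real 4 = p.ζ / 2 ∧ (setup.effect ev u σ₀).real 7 = 1 ∧
      (setup.effect ev u σ₀).nat = σ₀.nat := by
    obtain ⟨h8, h9, h10⟩ := hc₀
    simp [HasConstants, setup, block, Program.effect, effect_relu, Instr.exec, RAMState.setReal,
      h8, h9, h10, r0, r1, d0, n0, Params.initState, rate, hmin]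
  obtain ⟨hc₁, s2, s3, s4, s7, sn⟩ := s_all
  set σ₁ := setup.effect ev u σ₀
  obtain ⟨σ₂, hrun2, g11, greal, gnat, -⟩ := runs_cum (ev := ev) (u := u) hc₁ ht
    (n := p.n) (by rw [sn, n0]; simp [Params.initState]) (by rw [sn, n0]; simp [Params.initState])
  rw [s3, s4, s7] at g11
  have hc₂ : HasConstants σ₂ := by
    simp only [HasConstants, greal 8 (by norm_num), greal 9 (by norm_num),
      greal 10 (by norm_num)]
    exact hc₁
  have hrun3 := Program.LoopFree.runsWithin (ev := ev) (u := u) (p := bisectInit)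
    (by simp [bisectInit, block, Program.LoopFree]) σ₂
  have b_all : HasConstants (bisectInit.effect ev u σ₂) ∧
      (bisectInit.effect ev u σ₂).real 2 = u 0 * σ₂.real 11 ∧
      (bisectInit.effect ev u σ₂).real 3 = rate p ∧
      (bisectInit.effect ev u σ₂).real 4 = p.ζ / 2 ∧
      (bisectInit.effect ev u σ₂).real 5 = -1 ∧ (bisectInit.effect ev u σ₂).real 6 = 2 ∧
      (bisectInit.effect ev u σ₂).nat = σ₂.nat := by
    obtain ⟨h8, h9, h10⟩ := hc₂
    simp [HasConstants, bisectInit, block, Program.effect, Instr.exec, RAMState.setReal,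
      h8, h9, h10, greal, s2, s3, s4]
  obtain ⟨hc₃, b2, b3, b4, b5, b6, bn⟩ := b_all
  set σ₃ := bisectInit.effect ev u σ₂
  obtain ⟨σ₄, hrun4, e5, hc₄⟩ := runs_search (ev := ev) (u := u) hc₃ ht (n := p.n) (D := D)
    (by rw [bn, gnat 0 (by norm_num), sn, n0]; simp [Params.initState])
    (by rw [bn, gnat 1 (by norm_num), sn, n0]; simp [Params.initState])
    b5 b6 (by rwa [b4]) (by rwa [b4])
  rw [b2, b3, b4, g11] at e5
  refine ⟨_, (hrun0.seq ((hrun1.seq (hrun2.seq (hrun3.seq (hrun4.seq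
    (RunsWithin.instr (.realAdd 0 5 8) σ₄))))).ite_neg htest)).mono ?_, ?_⟩
  · have c0 : constants.cost ≤ 8 := by decide
    have c1 : setup.cost ≤ 60 := by decide
    have c2 : bisectInit.cost ≤ 8 := by decide
    rw [add_mul, one_mul]
    omega
  · simp [Instr.exec, RAMState.setReal, e5, hc₄.1]

end Correctness

end MedianProgram

/-! ### The weight of the selection rule -/

section ExpPos

theorem expPos_pos (η q : ℝ) : 0 < expPos η q := Real.exp_pos _

theorem expPos_of_nonpos {η q : ℝ} (hq : q ≤ 0) : expPos η q = 1 := by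
  simp [expPos, max_eq_right hq]

theorem expPos_le_one {η q : ℝ} (hη : 0 ≤ η) : expPos η q ≤ 1 := by
  rw [expPos, Real.exp_le_one_iff]
  have := mul_nonneg (le_max_right q 0) hη
  linarith

theorem expPos_le_exp {η q c : ℝ} (hη : 0 ≤ η) (hq : c ≤ q) : expPos η q ≤ Real.exp (-(η * c)) := by
  rw [expPos, Real.exp_le_exp]
  nlinarith [mul_le_mul_of_nonneg_right (hq.trans (le_max_left q 0)) hη]

/-- Moving one value changes a count by at most one, hence the argument of the penalty by at most
two; the positive part is 1-Lipschitz. -/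
theorem expPos_le_mul_expPos {η q q' : ℝ} (hη : 0 ≤ η) (hq : q' ≤ q + 2) :
    expPos η q ≤ Real.exp (2 * η) * expPos η q' := by
  rw [expPos, expPos, ← Real.exp_add, Real.exp_le_exp]
  have : max q' 0 ≤ max q 0 + 2 :=
    max_le (hq.trans (by linarith [le_max_left q 0])) (by linarith [le_max_right q 0])
  nlinarith [mul_le_mul_of_nonneg_right this hη]

end ExpPos

/-! ### Ranks with ties broken by the index, and telescoping sums over them. -/

section Rank

variable {m : ℕ} {y : ℕ → ℝ}

theorem LexLE.refl (y : ℕ → ℝ) (i : ℕ) : LexLE y i i := by simp [LexLE]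

theorem LexLE.trans {i j l : ℕ} (h : LexLE y i j) (h' : LexLE y j l) : LexLE y i l := by
  unfold LexLE at *
  split_ifs at * <;> first | omega | (apply le_of_lt; linarith) | linarith

theorem LexLE.total (y : ℕ → ℝ) (i j : ℕ) : LexLE y i j ∨ LexLE y j i := by
  unfold LexLE
  rcases lt_trichotomy (y i) (y j) with h | h | h
  · left; split_ifs <;> linarith
  · rcases le_total i j with h' | h'
    · left; rw [if_pos h']; exact h.le
    · right; rw [if_pos h']; exact h.ge
  · right; split_ifs <;> linarith

theorem LexLE.antisymm {i j : ℕ} (h : LexLE y i j) (h' : LexLE y j i) : i = j := by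
  unfold LexLE at *
  split_ifs at * <;> first | omega | (exfalso; linarith)

theorem LexLE.le {i j : ℕ} (h : LexLE y i j) : y i ≤ y j := by
  unfold LexLE at h
  split_ifs at h
  exacts [h, h.le]

open Classical in
/-- The rank of `y i` among `y 0, …, y (m - 1)`. -/
noncomputable def lexRank (m : ℕ) (y : ℕ → ℝ) (i : ℕ) : ℕ :=
  ((Finset.range m).filter fun j => LexLE y j i).card

theorem centeredRank_eq (m : ℕ) (y : ℕ → ℝ) (i : ℕ) :
    centeredRank m y i = 2 * lexRank m y i - 1 - m := by
  classical
  have hcard := Finset.card_filter_add_card_filter_not (s := Finset.range m)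
    (fun j => LexLE y j i)
  rw [Finset.card_range] at hcard
  rw [centeredRank, Finset.sum_ite]
  simp only [Finset.sum_const, nsmul_eq_mul, mul_one, lexRank]
  have : ((Finset.range m).filter fun j => ¬ LexLE y j i).card
      = (m : ℝ) - ((Finset.range m).filter fun j => LexLE y j i).card := by
    rw [eq_sub_iff_add_eq', ← Nat.cast_add, hcard]
  rw [this]
  ring

theorem lexRank_lt {i j : ℕ} (hj : j < m) (hij : LexLE y i j) (hne : i ≠ j) :
    lexRank m y i < lexRank m y j := by
  classical
  apply Finset.card_lt_card
  rw [Finset.ssubset_iff_of_subset]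
  · refine ⟨j, by simp [hj, LexLE.refl], ?_⟩
    simp only [Finset.mem_filter, not_and]
    exact fun _ h => hne (hij.antisymm h)
  · intro l hl
    rw [Finset.mem_filter] at hl ⊢
    exact ⟨hl.1, hl.2.trans hij⟩

/-- The elements of an initial segment have the ranks `1, …, card S`. -/
theorem image_lexRank {S : Finset ℕ} (hS : S ⊆ Finset.range m)
    (hdown : ∀ i ∈ S, ∀ j < m, LexLE y j i → j ∈ S) :
    S.image (lexRank m y) = Finset.Icc 1 S.card ∧ Set.InjOn (lexRank m y) S := by
  classical
  have hinj : Set.InjOn (lexRank m y) S := by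
    intro i hi j hj hij
    by_contra hne
    rcases LexLE.total y i j with h | h
    · exact (lexRank_lt (Finset.mem_range.1 (hS hj)) h hne).ne hij
    · exact (lexRank_lt (Finset.mem_range.1 (hS hi)) h (Ne.symm hne)).ne hij.symm
  -- In an initial segment no rank exceeds the cardinality, so injectivity forces all ranks to
  -- occur.
  refine ⟨Finset.eq_of_subset_of_card_le ?_ ?_, hinj⟩
  · intro r hr
    obtain ⟨i, hi, rfl⟩ := Finset.mem_image.1 hr
    rw [Finset.mem_Icc]
    constructor
    · apply Finset.card_pos.2
      exact ⟨i, by simp [Finset.mem_range.1 (hS hi), LexLE.refl]⟩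
    · apply Finset.card_le_card
      intro j hj
      rw [Finset.mem_filter, Finset.mem_range] at hj
      exact hdown i hi j hj.1 hj.2
  · rw [Finset.card_image_of_injOn hinj, Nat.card_Icc]
    omega

/-- Telescoping over an initial segment. -/
theorem sum_lexRank_sub {S : Finset ℕ} (hS : S ⊆ Finset.range m)
    (hdown : ∀ i ∈ S, ∀ j < m, LexLE y j i → j ∈ S) (g : ℕ → ℝ) :
    ∑ i ∈ S, (g (lexRank m y i) - g (lexRank m y i - 1)) = g S.card - g 0 := by
  classical
  obtain ⟨himg, hinj⟩ := image_lexRank hS hdown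
  rw [← Finset.sum_image (f := fun r => g r - g (r - 1)) hinj, himg]
  induction S.card with
  | zero => simp
  | succ n ih => rw [Finset.sum_Icc_succ_top (by omega), ih]; simp

end Rank

/-! ### The density as a sum of step functions, and its primitive. -/

section Weight

variable {η h : ℝ} {m : ℕ} {y y' : ℕ → ℝ}

open Classical in
/-- The number of values that lie below `x` by more than `h`. -/
noncomputable def countBelow (h : ℝ) (m : ℕ) (y : ℕ → ℝ) (x : ℝ) : ℕ :=
  ((Finset.range m).filter fun i => y i + h < x).card

open Classical in
/-- The number of values that lie above `x` by more than `h`. -/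
noncomputable def countAbove (h : ℝ) (m : ℕ) (y : ℕ → ℝ) (x : ℝ) : ℕ :=
  ((Finset.range m).filter fun i => x < y i - h).card

/-- The density of the selection rule, up to normalization. -/
noncomputable def weight (η h : ℝ) (m : ℕ) (y : ℕ → ℝ) (x : ℝ) : ℝ :=
  expPos η (2 * countBelow h m y x - 1 - m) * expPos η (2 * countAbove h m y x - 1 - m)

theorem countBelow_add_countAbove_le (hh : 0 ≤ h) (x : ℝ) :
    countBelow h m y x + countAbove h m y x ≤ m := by
  classical
  rw [countBelow, countAbove, ← Finset.card_union_of_disjoint]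
  · refine (Finset.card_le_card (Finset.union_subset (Finset.filter_subset _ _)
      (Finset.filter_subset _ _))).trans (by simp)
  · rw [Finset.disjoint_filter]
    intro i _ h1 h2
    linarith

theorem weight_pos (x : ℝ) : 0 < weight η h m y x := mul_pos (expPos_pos _ _) (expPos_pos _ _)

open Classical in
-- The values below `x - h` form an initial segment of the lexicographic order and those above `x +
-- h` a final one, so the increments of the penalty along the ranks telescope to the two factors of
-- the weight. The sum form is what makes the primitive computable term by term.
theorem weight_eq_sum (hh : 0 ≤ h) (x : ℝ) :
    weight η h m y x = 1 + ∑ i ∈ Finset.range m,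
      ((expPos η (centeredRank m y i) - expPos η (centeredRank m y i - 2)) *
          (if y i + h < x then 1 else 0) +
        (expPos η (-centeredRank m y i) - expPos η (-centeredRank m y i - 2)) *
          (if x < y i - h then 1 else 0)) := by
  have hpos : ∀ i ∈ Finset.range m, 1 ≤ lexRank m y i := fun i hi =>
    Finset.card_pos.2 ⟨i, by simpa [LexLE.refl] using hi⟩
  have hbelow : ∑ i ∈ Finset.range m,
      (expPos η (centeredRank m y i) - expPos η (centeredRank m y i - 2)) *
        (if y i + h < x then 1 else 0) = expPos η (2 * countBelow h m y x - 1 - m) - 1 := by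
    have key := sum_lexRank_sub (m := m) (y := y)
      (S := (Finset.range m).filter fun i => y i + h < x) (Finset.filter_subset _ _)
      (by
        intro i hi j hj hle
        rw [Finset.mem_filter, Finset.mem_range] at hi ⊢
        exact ⟨hj, by linarith [hle.le]⟩)
      (fun r => expPos η (2 * r - 1 - m))
    simp only [Nat.cast_zero] at key
    rw [expPos_of_nonpos (show (2 * 0 - 1 - (m : ℝ)) ≤ 0 by
      have : (0 : ℝ) ≤ m := Nat.cast_nonneg m
      linarith)] at key
    rw [countBelow, ← key, Finset.sum_filter]
    refine Finset.sum_congr rfl fun i hi => ?_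
    rw [centeredRank_eq, Nat.cast_sub (hpos i hi)]
    split_ifs
    · rw [mul_one]; push_cast; ring_nf
    · simp
  have habove : ∑ i ∈ Finset.range m,
      (expPos η (-centeredRank m y i) - expPos η (-centeredRank m y i - 2)) *
        (if x < y i - h then 1 else 0) = expPos η (2 * countAbove h m y x - 1 - m) - 1 := by
    -- Telescoping is available for initial segments only, so the final segment is treated as the
    -- difference of the whole range and its complement.
    have key1 := sum_lexRank_sub (m := m) (y := y)
      (S := (Finset.range m).filter fun i => ¬ x < y i - h) (Finset.filter_subset _ _)
      (by
        intro i hi j hj hle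
        rw [Finset.mem_filter, Finset.mem_range] at hi ⊢
        exact ⟨hj, by linarith [hle.le, not_lt.1 hi.2]⟩)
      (fun r => expPos η (m - 1 - 2 * r))
    have key2 := sum_lexRank_sub (m := m) (y := y) (S := Finset.range m) le_rfl
      (by intro i _ j hj _; simpa using hj) (fun r => expPos η (m - 1 - 2 * r))
    have hsplit := Finset.sum_filter_add_sum_filter_not (Finset.range m) (fun i => x < y i - h)
      (fun i => expPos η (m - 1 - 2 * (lexRank m y i : ℕ))
        - expPos η (m - 1 - 2 * ((lexRank m y i - 1 : ℕ) : ℝ)))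
    have hcard := Finset.card_filter_add_card_filter_not (s := Finset.range m)
      (fun i => x < y i - h)
    rw [Finset.card_range] at hcard key2
    have hcast : (((Finset.range m).filter fun i => ¬ x < y i - h).card : ℝ)
        = m - countAbove h m y x := by
      rw [eq_sub_iff_add_eq', countAbove, ← Nat.cast_add, hcard]
    rw [key1, key2, hcast] at hsplit
    rw [expPos_of_nonpos (show ((m : ℝ) - 1 - 2 * (m : ℕ)) ≤ 0 by
      have : (0 : ℝ) ≤ m := Nat.cast_nonneg m
      linarith)] at hsplit
    have e : ((m : ℝ) - 1 - 2 * (m - countAbove h m y x)) = 2 * countAbove h m y x - 1 - m := by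
      ring
    rw [e] at hsplit
    rw [Finset.sum_filter] at hsplit
    have hneg : ∑ i ∈ Finset.range m,
      (expPos η (-centeredRank m y i) - expPos η (-centeredRank m y i - 2)) *
        (if x < y i - h then 1 else 0) = - ∑ i ∈ Finset.range m, (if x < y i - h then
          expPos η (m - 1 - 2 * (lexRank m y i : ℕ))
        - expPos η (m - 1 - 2 * ((lexRank m y i - 1 : ℕ) : ℝ)) else 0) := by
      rw [← Finset.sum_neg_distrib]
      refine Finset.sum_congr rfl fun i hi => ?_
      rw [centeredRank_eq, Nat.cast_sub (hpos i hi)]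
      split_ifs
      · rw [mul_one]; push_cast; ring_nf
      · simp
    rw [hneg]
    linarith
  rw [Finset.sum_add_distrib, hbelow, habove, weight]
  -- Both counts cannot exceed half of `m`, so one of the factors is one, and then `a * b = a + b -
  -- 1`.
  have hle : ((countBelow h m y x : ℝ)) + countAbove h m y x ≤ m := by
    exact_mod_cast countBelow_add_countAbove_le hh x
  rcases le_total (2 * (countBelow h m y x : ℝ) - 1 - m) 0 with h0 | h0
  · rw [expPos_of_nonpos h0]; ring
  · rw [expPos_of_nonpos (show 2 * (countAbove h m y x : ℝ) - 1 - m ≤ 0 by linarith)]; ring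

theorem integral_ite_lt {c x : ℝ} (hc : -1 ≤ c) (hx : -1 ≤ x) :
    (open Classical in ∫ z in (-1 : ℝ)..x, if c < z then (1 : ℝ) else 0) = max (x - c) 0 := by
  classical
  have : (fun z => if c < z then (1 : ℝ) else 0) = (Set.Ioi c).indicator 1 := by
    ext z; simp [Set.indicator_apply]
  rw [this, intervalIntegral.integral_of_le hx, integral_indicator_one measurableSet_Ioi,
    measureReal_restrict_apply measurableSet_Ioi, Set.inter_comm, Set.Ioc_inter_Ioi,
    max_eq_right hc, Real.volume_real_Ioc]

/-- Here `c` may lie below `-1`, as happens for `c = y - h`; the outer maximum covers that case. For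
`c = y + h` the companion formula can assume `-1 ≤ c`. -/
theorem integral_ite_gt {c x : ℝ} (hx : -1 ≤ x) :
    (open Classical in ∫ z in (-1 : ℝ)..x, if z < c then (1 : ℝ) else 0)
      = max (x + 1 - max (x - c) 0) 0 := by
  classical
  have : (fun z => if z < c then (1 : ℝ) else 0) = (Set.Iio c).indicator 1 := by
    ext z; simp [Set.indicator_apply]
  rw [this, intervalIntegral.integral_of_le hx, integral_indicator_one measurableSet_Iio,
    measureReal_restrict_apply measurableSet_Iio, Set.inter_comm,
    measureReal_congr (show (Set.Ioc (-1) x ∩ Set.Iio c : Set ℝ) =ᵐ[volume]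
      (Set.Ioc (-1) x ∩ Set.Iic c : Set ℝ) from
      Filter.EventuallyEq.inter (ae_eq_refl _) Iio_ae_eq_Iic),
    Set.Ioc_inter_Iic, Real.volume_real_Ioc]
  congr 1
  rcases le_total x c with h | h
  · rw [min_eq_left h, max_eq_right (by linarith)]; ring
  · rw [min_eq_right h, max_eq_left (by linarith)]; ring

theorem intervalIntegrable_ite (p : ℝ → Prop) [DecidablePred p] (hp : MeasurableSet {z | p z})
    (a b : ℝ) : IntervalIntegrable (fun z => if p z then (1 : ℝ) else 0) volume a b := by
  have hf : Measurable (fun z => if p z then (1 : ℝ) else 0) :=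
    Measurable.ite hp measurable_const measurable_const
  refine (intervalIntegrable_const (c := (1 : ℝ))).mono_fun hf.aestronglyMeasurable ?_
  refine Filter.Eventually.of_forall fun z => ?_
  simp only
  split_ifs <;> simp

theorem IntervalIntegrable.finset_sum {ι : Type*} {s : Finset ι} {f : ι → ℝ → ℝ} {a b : ℝ}
    (hf : ∀ i, IntervalIntegrable (f i) volume a b) :
    IntervalIntegrable (fun z => ∑ i ∈ s, f i z) volume a b := by
  simpa only [Finset.sum_fn] using IntervalIntegrable.sum s fun i _ => hf i

theorem intervalIntegrable_weight (hh : 0 ≤ h) (a b : ℝ) :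
    IntervalIntegrable (weight η h m y) volume a b := by
  classical
  rw [funext (weight_eq_sum (η := η) (m := m) (y := y) hh)]
  refine intervalIntegrable_const.add (IntervalIntegrable.finset_sum fun i => ?_)
  exact ((intervalIntegrable_ite _ measurableSet_Ioi a b).const_mul _).add
    ((intervalIntegrable_ite _ measurableSet_Iio a b).const_mul _)

/-- Identifies what the program evaluates with the distribution function of the density;
monotonicity, stability and accuracy are all read off the integral. -/
theorem cumWeight_eq_integral (hh : 0 ≤ h) (hy : ∀ i, -1 ≤ y i) {x : ℝ} (hx : -1 ≤ x) :
    cumWeight η h m y x = ∫ z in (-1 : ℝ)..x, weight η h m y z := by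
  classical
  rw [funext (weight_eq_sum (η := η) (m := m) (y := y) hh)]
  have i1 : ∀ i, IntervalIntegrable (fun z =>
      (expPos η (centeredRank m y i) - expPos η (centeredRank m y i - 2)) *
          (if y i + h < z then (1 : ℝ) else 0)) volume (-1) x := fun i =>
    (intervalIntegrable_ite _ measurableSet_Ioi _ _).const_mul _
  have i2 : ∀ i, IntervalIntegrable (fun z =>
      (expPos η (-centeredRank m y i) - expPos η (-centeredRank m y i - 2)) *
          (if z < y i - h then (1 : ℝ) else 0)) volume (-1) x := fun i =>
    (intervalIntegrable_ite _ measurableSet_Iio _ _).const_mul _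
  simp only
  rw [intervalIntegral.integral_add intervalIntegrable_const
    (IntervalIntegrable.finset_sum fun i => (i1 i).add (i2 i)),
    intervalIntegral.integral_finsetSum fun i _ => (i1 i).add (i2 i), cumWeight]
  congr 1
  · simp
  · refine Finset.sum_congr rfl fun i _ => ?_
    rw [intervalIntegral.integral_add (i1 i) (i2 i), intervalIntegral.integral_const_mul,
      intervalIntegral.integral_const_mul, integral_ite_lt (by linarith [hy i]) hx,
      integral_ite_gt hx, rankTerm, ← sub_sub, ← sub_add]

end Weight

/-! ### Cell probabilities: stability, accuracy, exact sampling and measurability. -/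

section Cells

variable {η h : ℝ} {m : ℕ} {y y' : ℕ → ℝ}

theorem countBelow_le_of_eq_off {i : ℕ} (hy : ∀ j, j ≠ i → y j = y' j) (x : ℝ) :
    countBelow h m y' x ≤ countBelow h m y x + 1 := by
  classical
  refine (Finset.card_le_card (t := insert i ((Finset.range m).filter fun i => y i + h < x))
    fun j hj => ?_).trans (Finset.card_insert_le _ _)
  rw [Finset.mem_filter] at hj
  by_cases hji : j = i
  · simp [hji]
  · rw [Finset.mem_insert, Finset.mem_filter, hy j hji]
    exact Or.inr hj

theorem countAbove_le_of_eq_off {i : ℕ} (hy : ∀ j, j ≠ i → y j = y' j) (x : ℝ) :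
    countAbove h m y' x ≤ countAbove h m y x + 1 := by
  classical
  refine (Finset.card_le_card (t := insert i ((Finset.range m).filter fun i => x < y i - h))
    fun j hj => ?_).trans (Finset.card_insert_le _ _)
  rw [Finset.mem_filter] at hj
  by_cases hji : j = i
  · simp [hji]
  · rw [Finset.mem_insert, Finset.mem_filter, hy j hji]
    exact Or.inr hj

/-- Changing one value changes the weight by a factor of at most `exp (4 η)`. -/
theorem weight_le_of_eq_off (hη : 0 ≤ η) {i : ℕ} (hy : ∀ j, j ≠ i → y j = y' j) (x : ℝ) :
    weight η h m y x ≤ Real.exp (4 * η) * weight η h m y' x := by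
  have hb : ((countBelow h m y' x : ℕ) : ℝ) ≤ countBelow h m y x + 1 := by
    exact_mod_cast countBelow_le_of_eq_off hy x
  have ha : ((countAbove h m y' x : ℕ) : ℝ) ≤ countAbove h m y x + 1 := by
    exact_mod_cast countAbove_le_of_eq_off hy x
  have h1 : expPos η (2 * countBelow h m y x - 1 - m) ≤
      Real.exp (2 * η) * expPos η (2 * countBelow h m y' x - 1 - m) :=
    expPos_le_mul_expPos hη (by linarith)
  have h2 : expPos η (2 * countAbove h m y x - 1 - m) ≤
      Real.exp (2 * η) * expPos η (2 * countAbove h m y' x - 1 - m) :=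
    expPos_le_mul_expPos hη (by linarith)
  calc weight η h m y x
      ≤ (Real.exp (2 * η) * expPos η (2 * countBelow h m y' x - 1 - m)) *
        (Real.exp (2 * η) * expPos η (2 * countAbove h m y' x - 1 - m)) :=
        mul_le_mul h1 h2 (expPos_pos _ _).le ((expPos_pos _ _).le.trans h1)
    _ = Real.exp (4 * η) * weight η h m y' x := by
        rw [show 4 * η = 2 * η + 2 * η by ring, Real.exp_add, weight]; ring

/-- The endpoints of the `2 ^ D` cells of `[-1,1]`. -/
noncomputable def gridPoint (D g : ℕ) : ℝ := -1 + g * (2 / 2 ^ D)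

theorem gridPoint_zero (D : ℕ) : gridPoint D 0 = -1 := by simp [gridPoint]

theorem gridPoint_last (D : ℕ) : gridPoint D (2 ^ D) = 1 := by
  rw [gridPoint]; push_cast; field_simp; norm_num

theorem gridPoint_succ (D g : ℕ) : gridPoint D (g + 1) = gridPoint D g + 2 / 2 ^ D := by
  rw [gridPoint, gridPoint]; push_cast; ring

theorem gridPoint_strictMono (D : ℕ) : StrictMono (gridPoint D) :=
  strictMono_nat_of_lt_succ fun g => by
    rw [gridPoint_succ]
    have : (0 : ℝ) < 2 / 2 ^ D := by positivity
    linarith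

theorem neg_one_le_gridPoint (D g : ℕ) : -1 ≤ gridPoint D g :=
  (gridPoint_zero D).ge.trans ((gridPoint_strictMono D).monotone (Nat.zero_le g))

theorem cumWeight_sub (hh : 0 ≤ h) (hy : ∀ i, -1 ≤ y i) {a b : ℝ} (ha : -1 ≤ a) (hb : -1 ≤ b) :
    cumWeight η h m y b - cumWeight η h m y a = ∫ z in a..b, weight η h m y z := by
  rw [cumWeight_eq_integral hh hy ha, cumWeight_eq_integral hh hy hb,
    intervalIntegral.integral_interval_sub_left (intervalIntegrable_weight hh _ _)
      (intervalIntegrable_weight hh _ _)]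

theorem cumWeight_neg_one (hh : 0 ≤ h) (hy : ∀ i, -1 ≤ y i) : cumWeight η h m y (-1) = 0 := by
  rw [cumWeight_eq_integral hh hy le_rfl, intervalIntegral.integral_same]

theorem cumWeight_lt (hh : 0 ≤ h) (hy : ∀ i, -1 ≤ y i) {a b : ℝ} (ha : -1 ≤ a) (hab : a < b) :
    cumWeight η h m y a < cumWeight η h m y b := by
  rw [← sub_pos, cumWeight_sub hh hy ha (ha.trans hab.le)]
  exact intervalIntegral.intervalIntegral_pos_of_pos (intervalIntegrable_weight hh _ _)
    (fun x => weight_pos x) hab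

theorem cumWeight_one_pos (hh : 0 ≤ h) (hy : ∀ i, -1 ≤ y i) : 0 < cumWeight η h m y 1 := by
  rw [← cumWeight_neg_one (η := η) (m := m) hh hy]
  exact cumWeight_lt hh hy le_rfl (by norm_num)

theorem cumWeight_sub_le_of_eq_off (hη : 0 ≤ η) (hh : 0 ≤ h) (hy : ∀ i, -1 ≤ y i)
    (hy' : ∀ i, -1 ≤ y' i) {i : ℕ} (hyy' : ∀ j, j ≠ i → y j = y' j) {a b : ℝ} (ha : -1 ≤ a)
    (hab : a ≤ b) :
    cumWeight η h m y b - cumWeight η h m y a ≤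
      Real.exp (4 * η) * (cumWeight η h m y' b - cumWeight η h m y' a) := by
  rw [cumWeight_sub hh hy ha (ha.trans hab), cumWeight_sub hh hy' ha (ha.trans hab),
    ← intervalIntegral.integral_const_mul]
  exact intervalIntegral.integral_mono hab (intervalIntegrable_weight hh _ _)
    ((intervalIntegrable_weight hh _ _).const_mul _) fun x => weight_le_of_eq_off hη hyy' x

/-- The probability with which the cell `g` is selected. -/
noncomputable def cellProb (η h : ℝ) (m D : ℕ) (y : ℕ → ℝ) (g : ℕ) : ℝ :=
  (cumWeight η h m y (gridPoint D (g + 1)) - cumWeight η h m y (gridPoint D g)) /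
    cumWeight η h m y 1

theorem cellProb_pos (hh : 0 ≤ h) (hy : ∀ i, -1 ≤ y i) (D g : ℕ) :
    0 < cellProb η h m D y g :=
  div_pos (sub_pos.2 (cumWeight_lt hh hy (neg_one_le_gridPoint D g)
    (gridPoint_strictMono D g.lt_succ_self))) (cumWeight_one_pos hh hy)

theorem sum_cellProb (hh : 0 ≤ h) (hy : ∀ i, -1 ≤ y i) (D : ℕ) :
    ∑ g : Fin (2 ^ D), cellProb η h m D y g = 1 := by
  rw [Fin.sum_univ_eq_sum_range (fun g => cellProb η h m D y g)]
  simp only [cellProb]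
  rw [← Finset.sum_div,
    Finset.sum_range_sub (fun g => cumWeight η h m y (gridPoint D g)), gridPoint_last,
    gridPoint_zero, cumWeight_neg_one hh hy, sub_zero, div_self (cumWeight_one_pos hh hy).ne']

/-- Changing one value changes the probability of a cell by a factor of at most `exp (8 η)`. -/
theorem cellProb_le_of_eq_off (hη : 0 ≤ η) (hh : 0 ≤ h) (hy : ∀ i, -1 ≤ y i)
    (hy' : ∀ i, -1 ≤ y' i) {i : ℕ} (hyy' : ∀ j, j ≠ i → y j = y' j) (D g : ℕ) :
    cellProb η h m D y g ≤ Real.exp (8 * η) * cellProb η h m D y' g := by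
  have h1 := cumWeight_sub_le_of_eq_off (m := m) hη hh hy hy' hyy' (neg_one_le_gridPoint D g)
    ((gridPoint_strictMono D).monotone g.le_succ)
  -- The numerator and the normalization each contribute a factor `exp (4 η)`.
  have h2 := cumWeight_sub_le_of_eq_off (m := m) hη hh hy' hy (fun j hj => (hyy' j hj).symm)
    (le_refl (-1)) (show (-1 : ℝ) ≤ 1 by norm_num)
  rw [cumWeight_neg_one hh hy, cumWeight_neg_one hh hy', sub_zero, sub_zero] at h2
  have hpos := cumWeight_one_pos (η := η) (m := m) hh hy
  have hpos' := cumWeight_one_pos (η := η) (m := m) hh hy'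
  have hnum : 0 ≤ cumWeight η h m y' (gridPoint D (g + 1)) - cumWeight η h m y' (gridPoint D g) :=
    sub_nonneg.2 (cumWeight_lt hh hy' (neg_one_le_gridPoint D g)
      (gridPoint_strictMono D g.lt_succ_self)).le
  rw [cellProb, cellProb, ← mul_div_assoc, div_le_div_iff₀ hpos hpos',
    show 8 * η = 4 * η + 4 * η by ring, Real.exp_add]
  calc _ ≤ (Real.exp (4 * η) * (cumWeight η h m y' (gridPoint D (g + 1))
          - cumWeight η h m y' (gridPoint D g))) * (Real.exp (4 * η) * cumWeight η h m y 1) :=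
        mul_le_mul h1 h2 hpos'.le (mul_nonneg (Real.exp_pos _).le hnum)
    _ = _ := by ring

/-! ### Accuracy of the selection rule -/

open Classical in
/-- A median: at most half of the values lie on either side. -/
theorem exists_median (hm : 0 < m) (y : ℕ → ℝ) : ∃ i < m,
    2 * ((Finset.range m).filter fun j => y j < y i).card ≤ m ∧
      2 * ((Finset.range m).filter fun j => y i < y j).card ≤ m := by
  have hne : (Finset.range m).Nonempty := ⟨0, by simpa using hm⟩
  let S := (Finset.range m).filter fun i =>
    2 * ((Finset.range m).filter fun j => y i < y j).card ≤ m
  have hS : S.Nonempty := by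
    obtain ⟨i, hi, hmax⟩ := Finset.exists_max_image (Finset.range m) y hne
    refine ⟨i, Finset.mem_filter.2 ⟨hi, ?_⟩⟩
    rw [Finset.filter_false_of_mem fun j hj => not_lt.2 (hmax j hj)]
    simp
  -- Take the smallest value with at most half of the values above it. If more than half were below
  -- it, the largest of those would also have at most half above it, against minimality.
  obtain ⟨i, hi, hmin⟩ := Finset.exists_min_image S y hS
  rw [Finset.mem_filter, Finset.mem_range] at hi
  refine ⟨i, hi.1, ?_, hi.2⟩
  by_contra hcon
  push Not at hcon
  let T := (Finset.range m).filter fun j => y j < y i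
  have hT : T.Nonempty := Finset.card_pos.1 (by simp only [T]; omega)
  obtain ⟨l, hl, hmaxl⟩ := Finset.exists_max_image T y hT
  have hl' := Finset.mem_filter.1 hl
  have hsub : ((Finset.range m).filter fun j => y l < y j) ⊆
      (Finset.range m).filter fun j => ¬ y j < y i := by
    intro j hj
    rw [Finset.mem_filter] at hj ⊢
    exact ⟨hj.1, fun hlt => absurd (hmaxl j (Finset.mem_filter.2 ⟨hj.1, hlt⟩)) (not_le.2 hj.2)⟩
  have hcard := Finset.card_filter_add_card_filter_not (s := Finset.range m) fun j => y j < y i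
  rw [Finset.card_range] at hcard
  have := Finset.card_le_card hsub
  exact absurd (hmin l (Finset.mem_filter.2 ⟨hl'.1, by omega⟩)) (not_le.2 hl'.2)

/-- Within distance `h` of a median both penalties vanish and the weight is one. A piece of length
`h` of that neighbourhood lies in `[-1,1]`. -/
theorem le_cumWeight_one (hh : 0 < h) (hh' : h ≤ 1) (hm : 0 < m)
    (hy : ∀ i, y i ∈ Set.Icc (-1 : ℝ) 1) : h ≤ cumWeight η h m y 1 := by
  classical
  obtain ⟨i, -, hbelow, habove⟩ := exists_median hm y
  have hweight : ∀ x ∈ Set.Icc (y i - h) (y i + h), weight η h m y x = 1 := by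
    intro x hx
    have hb : 2 * countBelow h m y x ≤ m := by
      refine (Nat.mul_le_mul_left 2 (Finset.card_le_card fun j hj => ?_)).trans hbelow
      rw [Finset.mem_filter] at hj ⊢
      exact ⟨hj.1, by linarith [hj.2, hx.2]⟩
    have ha : 2 * countAbove h m y x ≤ m := by
      refine (Nat.mul_le_mul_left 2 (Finset.card_le_card fun j hj => ?_)).trans habove
      rw [Finset.mem_filter] at hj ⊢
      exact ⟨hj.1, by linarith [hj.2, hx.1]⟩
    have hb' : 2 * (countBelow h m y x : ℝ) ≤ m := by exact_mod_cast hb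
    have ha' : 2 * (countAbove h m y x : ℝ) ≤ m := by exact_mod_cast ha
    rw [weight, expPos_of_nonpos (by linarith), expPos_of_nonpos (by linarith), one_mul]
  -- Take the half of the neighbourhood that points towards zero; it stays in `[-1,1]` because `h ≤
  -- 1`.
  obtain ⟨a, ha1, ha2, hsub⟩ : ∃ a, -1 ≤ a ∧ a + h ≤ 1 ∧
      Set.Icc a (a + h) ⊆ Set.Icc (y i - h) (y i + h) := by
    rcases le_total 0 (y i) with h0 | h0
    · exact ⟨y i - h, by linarith, by linarith [(hy i).2],
        Set.Icc_subset_Icc le_rfl (by linarith)⟩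
    · exact ⟨y i, (hy i).1, by linarith, Set.Icc_subset_Icc (by linarith) le_rfl⟩
  have hy1 : ∀ i, -1 ≤ y i := fun i => (hy i).1
  have hpiece : cumWeight η h m y (a + h) - cumWeight η h m y a = h := by
    rw [cumWeight_sub hh.le hy1 ha1 (by linarith),
      intervalIntegral.integral_congr (g := fun _ => (1 : ℝ))]
    · simp
    · intro x hx
      rw [Set.uIcc_of_le (by linarith)] at hx
      exact hweight x (hsub hx)
  have hmono : ∀ {b c : ℝ}, -1 ≤ b → b ≤ c → cumWeight η h m y b ≤ cumWeight η h m y c := by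
    intro b c hb hbc
    rcases hbc.eq_or_lt with rfl | hlt
    exacts [le_rfl, (cumWeight_lt hh.le hy1 hb hlt).le]
  have h0 := cumWeight_neg_one (η := η) (m := m) hh.le hy1
  have := hmono (le_refl (-1)) ha1
  have := hmono (show -1 ≤ a + h by linarith) ha2
  linarith

open Classical in
/-- At least three eighths of the values are at least `v - h`, and at least three eighths are at
most `v + δ + h`. -/
def AccurateAt (h δ : ℝ) (m : ℕ) (y : ℕ → ℝ) (v : ℝ) : Prop :=
  3 * m ≤ 8 * ((Finset.range m).filter fun i => v - h ≤ y i).card ∧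
    3 * m ≤ 8 * ((Finset.range m).filter fun i => y i ≤ v + δ + h).card

/-- Inaccuracy puts more than five eighths of the values on one side of the whole cell, beyond
distance `h`. The argument of that penalty then exceeds `m/4 - 1`, which is at least `m/8` since `m
≥ 8`. -/
theorem weight_le_of_not_accurateAt (hη : 0 ≤ η) (hm : 8 ≤ m) {δ v x : ℝ}
    (hv : ¬ AccurateAt h δ m y v) (hx : x ∈ Set.Icc v (v + δ)) :
    weight η h m y x ≤ Real.exp (-(η * (m / 8))) := by
  classical
  have hm' : (8 : ℝ) ≤ m := by exact_mod_cast hm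
  have hbound : ∀ c : ℕ, 5 * m < 8 * c → expPos η (2 * c - 1 - m) ≤ Real.exp (-(η * (m / 8))) := by
    intro c hc
    have : (5 * m : ℝ) < 8 * c := by exact_mod_cast hc
    exact expPos_le_exp hη (by linarith)
  rw [AccurateAt, not_and_or, not_le, not_le] at hv
  rcases hv with hv | hv
  · have hcard := Finset.card_filter_add_card_filter_not (s := Finset.range m)
      fun i => v - h ≤ y i
    rw [Finset.card_range] at hcard
    have hsub : ((Finset.range m).filter fun i => ¬ v - h ≤ y i).card ≤ countBelow h m y x := by
      refine Finset.card_le_card fun j hj => ?_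
      rw [Finset.mem_filter] at hj ⊢
      exact ⟨hj.1, by linarith [not_le.1 hj.2, hx.1]⟩
    exact (mul_le_of_le_one_right (expPos_pos _ _).le (expPos_le_one hη)).trans
      (hbound _ (by omega))
  · have hcard := Finset.card_filter_add_card_filter_not (s := Finset.range m)
      fun i => y i ≤ v + δ + h
    rw [Finset.card_range] at hcard
    have hsub : ((Finset.range m).filter fun i => ¬ y i ≤ v + δ + h).card
        ≤ countAbove h m y x := by
      refine Finset.card_le_card fun j hj => ?_
      rw [Finset.mem_filter] at hj ⊢
      exact ⟨hj.1, by linarith [not_le.1 hj.2, hx.2]⟩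
    exact (mul_le_of_le_one_left (expPos_pos _ _).le (expPos_le_one hη)).trans
      (hbound _ (by omega))

open Classical in
-- The bad cells have total length at most two and small density, while the normalization is at
-- least `h`.
theorem sum_cellProb_not_accurateAt_le (hη : 0 ≤ η) (hh : 0 < h) (hh' : h ≤ 1) (hm : 8 ≤ m)
    (hy : ∀ i, y i ∈ Set.Icc (-1 : ℝ) 1) (D : ℕ) :
    ∑ g : Fin (2 ^ D), (if AccurateAt h (2 / 2 ^ D) m y (gridPoint D g) then 0
      else cellProb η h m D y g) ≤ 2 * Real.exp (-(η * (m / 8))) / h := by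
  have hy1 : ∀ i, -1 ≤ y i := fun i => (hy i).1
  have hW := le_cumWeight_one (η := η) hh hh' (by omega : 0 < m) hy
  have hcell : ∀ g : Fin (2 ^ D), (if AccurateAt h (2 / 2 ^ D) m y (gridPoint D g) then 0
      else cellProb η h m D y g) ≤ 2 / 2 ^ D * Real.exp (-(η * (m / 8))) / h := by
    intro g
    split_ifs with hacc
    · positivity
    · rw [cellProb, cumWeight_sub hh.le hy1 (neg_one_le_gridPoint _ _)
        (neg_one_le_gridPoint _ _)]
      refine div_le_div₀ (by positivity) ?_ hh hW
      have hle := (gridPoint_strictMono D).monotone (Nat.le_succ (g : ℕ))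
      calc ∫ z in gridPoint D g..gridPoint D (g + 1), weight η h m y z
          ≤ ∫ _ in gridPoint D g..gridPoint D (g + 1), Real.exp (-(η * (m / 8))) := by
            refine intervalIntegral.integral_mono_on hle (intervalIntegrable_weight hh.le _ _)
              intervalIntegrable_const fun x hx => ?_
            exact weight_le_of_not_accurateAt hη hm hacc (by rwa [gridPoint_succ] at hx)
        _ = _ := by
            rw [intervalIntegral.integral_const, gridPoint_succ, smul_eq_mul]; ring
  refine (Finset.sum_le_sum fun g _ => hcell g).trans (le_of_eq ?_)
  rw [Finset.sum_const, Finset.card_univ, Fintype.card_fin, nsmul_eq_mul]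
  push_cast
  field_simp

/-! ### Bisection -/

open Classical in
/-- The index of the cell found after `r` rounds of bisection. -/
noncomputable def bisectIdx (F : ℝ → ℝ) (τ : ℝ) : ℕ → ℕ
  | 0 => 0
  | r + 1 => if F (gridPoint (r + 1) (2 * bisectIdx F τ r + 1)) ≤ τ then 2 * bisectIdx F τ r + 1
      else 2 * bisectIdx F τ r

theorem gridPoint_double (r g : ℕ) : gridPoint (r + 1) (2 * g) = gridPoint r g := by
  rw [gridPoint, gridPoint, pow_succ]; push_cast; field_simp

theorem bisect_eq_gridPoint (F : ℝ → ℝ) (τ : ℝ) (r : ℕ) :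
    bisect F τ r = gridPoint r (bisectIdx F τ r) := by
  induction r with
  | zero => simp [bisect, bisectIdx, gridPoint]
  | succ r ih =>
    rw [bisect, bisectIdx, ih, ← gridPoint_double, ← gridPoint_succ]
    split_ifs <;> rfl

theorem bisectIdx_lt (F : ℝ → ℝ) (τ : ℝ) (r : ℕ) : bisectIdx F τ r < 2 ^ r := by
  induction r with
  | zero => simp [bisectIdx]
  | succ r ih =>
    rw [bisectIdx, pow_succ]
    split_ifs <;> omega

/-- This is the invariant of bisection; it needs no monotonicity of `F`. -/
theorem bisectIdx_spec (F : ℝ → ℝ) (τ : ℝ) (h0 : F (-1) ≤ τ) (h1 : τ ≤ F 1) (r : ℕ) :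
    F (gridPoint r (bisectIdx F τ r)) ≤ τ ∧ τ ≤ F (gridPoint r (bisectIdx F τ r + 1)) := by
  induction r with
  | zero =>
    have := gridPoint_last 0
    rw [pow_zero] at this
    simp only [bisectIdx, gridPoint_zero, zero_add, this]
    exact ⟨h0, h1⟩
  | succ r ih =>
    rw [bisectIdx]
    split_ifs with hF
    · refine ⟨hF, ?_⟩
      rw [show 2 * bisectIdx F τ r + 1 + 1 = 2 * (bisectIdx F τ r + 1) by ring, gridPoint_double]
      exact ih.2
    · refine ⟨?_, (not_le.1 hF).le⟩
      rw [gridPoint_double]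
      exact ih.1

/-- The index of the cell selected for the random number `w`. -/
noncomputable def selectCell (η h : ℝ) (m D : ℕ) (y : ℕ → ℝ) (w : ℝ) : ℕ :=
  bisectIdx (cumWeight η h m y) (w * cumWeight η h m y 1) D

/-- This is inverse transform sampling. Selecting `g` forces `w` into a closed interval, and the
open interval forces the selection of `g` by strict monotonicity. Both intervals have the length
`cellProb`, so the behaviour at the endpoints is irrelevant. -/
theorem volume_selectCell (hh : 0 ≤ h) (hy : ∀ i, -1 ≤ y i) {D g : ℕ} (hg : g < 2 ^ D) :
    volume {w : unitInterval | selectCell η h m D y w = g}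
      = ENNReal.ofReal (cellProb η h m D y g) := by
  set F := cumWeight η h m y with hF
  have hW : 0 < F 1 := cumWeight_one_pos hh hy
  have h0 : F (-1) = 0 := cumWeight_neg_one hh hy
  have hmono : StrictMono fun g => F (gridPoint D g) := fun a b hab =>
    cumWeight_lt hh hy (neg_one_le_gridPoint D a) (gridPoint_strictMono D hab)
  have hnn : ∀ g, 0 ≤ F (gridPoint D g) := fun g => by
    have := hmono.monotone (Nat.zero_le g)
    simpa only [gridPoint_zero, h0] using this
  have hle : ∀ g ≤ 2 ^ D, F (gridPoint D g) ≤ F 1 := fun g hg => by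
    have := hmono.monotone hg
    simpa only [gridPoint_last] using this
  let pt : (g : ℕ) → g ≤ 2 ^ D → unitInterval := fun g hg =>
    ⟨F (gridPoint D g) / F 1, div_nonneg (hnn g) hW.le, (div_le_one hW).2 (hle g hg)⟩
  have hspec : ∀ w : unitInterval,
      F (gridPoint D (selectCell η h m D y w)) ≤ w * F 1 ∧
        w * F 1 ≤ F (gridPoint D (selectCell η h m D y w + 1)) := fun w =>
    bisectIdx_spec F (w * F 1) (by rw [h0]; exact mul_nonneg w.2.1 hW.le)
      (mul_le_of_le_one_left hW.le w.2.2) D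
  have hcell : ENNReal.ofReal (cellProb η h m D y g)
      = ENNReal.ofReal ((pt (g + 1) hg : ℝ) - pt g hg.le) := by
    rw [cellProb, sub_div]
  apply le_antisymm
  · rw [hcell, ← unitInterval.volume_Icc]
    refine measure_mono ?_
    rintro w rfl
    obtain ⟨h1, h2⟩ := hspec w
    exact ⟨(div_le_iff₀ hW).2 h1, (le_div_iff₀ hW).2 h2⟩
  · rw [hcell, ← unitInterval.volume_Ioo]
    refine measure_mono ?_
    rintro w ⟨h1, h2⟩
    replace h1 : F (gridPoint D g) < w * F 1 := (div_lt_iff₀ hW).1 h1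
    replace h2 : w * F 1 < F (gridPoint D (g + 1)) := (lt_div_iff₀ hW).1 h2
    obtain ⟨h3, h4⟩ := hspec w
    have h5 := hmono.lt_iff_lt.1 (h1.trans_le h4)
    have h6 := hmono.lt_iff_lt.1 (h3.trans_lt h2)
    change selectCell η h m D y w = g
    omega

/-! ### Measurability of the selection rule -/

theorem measurable_expPos (η : ℝ) : Measurable (expPos η) := by
  unfold expPos; fun_prop

theorem measurableSet_lexLE (j i : ℕ) : MeasurableSet {y : ℕ → ℝ | LexLE y j i} := by
  unfold LexLE
  split_ifs
  · exact measurableSet_le (measurable_pi_apply j) (measurable_pi_apply i)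
  · exact measurableSet_lt (measurable_pi_apply j) (measurable_pi_apply i)

theorem measurable_centeredRank (m i : ℕ) : Measurable fun y : ℕ → ℝ => centeredRank m y i := by
  classical
  unfold centeredRank
  refine measurable_const.add (Finset.measurable_sum _ fun j _ => ?_)
  exact Measurable.ite (measurableSet_lexLE j i) measurable_const measurable_const

theorem measurable_cumWeight (η h : ℝ) (m : ℕ) (x : ℝ) :
    Measurable fun y : ℕ → ℝ => cumWeight η h m y x := by
  unfold cumWeight rankTerm
  have h1 := measurable_expPos η
  refine measurable_const.add (Finset.measurable_sum _ fun i _ => ?_)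
  have h2 := measurable_centeredRank m i
  fun_prop

theorem measurable_cellProb (η h : ℝ) (m D g : ℕ) :
    Measurable fun y : ℕ → ℝ => cellProb η h m D y g :=
  ((measurable_cumWeight _ _ _ _).sub (measurable_cumWeight _ _ _ _)).div
    (measurable_cumWeight _ _ _ _)

/-- The evaluation point depends on the data only through a countable index, so measurability at
each fixed point is enough. -/
theorem measurable_cumWeight_comp (η h : ℝ) (m : ℕ) {α : Type*} [MeasurableSpace α]
    {y : α → ℕ → ℝ} {idx : α → ℕ} (hy : Measurable y) (hidx : Measurable idx) (x : ℕ → ℝ) :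
    Measurable fun q => cumWeight η h m (y q) (x (idx q)) := by
  have hcurry : Measurable fun q : (ℕ → ℝ) × ℕ => cumWeight η h m q.1 (x q.2) :=
    measurable_from_prod_countable_left fun g => measurable_cumWeight η h m (x g)
  exact hcurry.comp (hy.prodMk hidx)

theorem measurable_selectCell (η h : ℝ) (m D : ℕ) :
    Measurable fun q : (ℕ → ℝ) × ℝ => selectCell η h m D q.1 q.2 := by
  classical
  unfold selectCell
  induction D with
  | zero => exact measurable_const
  | succ D ih =>
    simp only [bisectIdx]
    have hset := measurableSet_le (measurable_cumWeight_comp η h m measurable_fst ih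
        (fun g => gridPoint (D + 1) (2 * g + 1)))
      (measurable_snd.mul ((measurable_cumWeight η h m 1).comp measurable_fst))
    refine Measurable.ite hset ?_ ?_
    · exact (measurable_from_nat (f := fun g => 2 * g + 1)).comp ih
    · exact (measurable_from_nat (f := fun g => 2 * g)).comp ih

end Cells

/-! ### Adaptive composition -/

section Composition

variable {G : Type*}

/-- The product of the values `c (v₀, …, v_{j-1}) v_j` along the sequence `v`. -/
noncomputable def treeProd {k : ℕ} (c : List G → G → ℝ) (v : Fin k → G) : ℝ :=
  ∏ j : Fin k, c (List.ofFn fun i : Fin j.val => v ⟨i.val, i.isLt.trans j.isLt⟩) (v j)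

/-- After the first outcome `g`, the rest is again a composition, with `g` put in front of every
history. The inductions on `k` therefore keep `c` general. -/
theorem treeProd_cons {k : ℕ} (c : List G → G → ℝ) (g : G) (v : Fin k → G) :
    treeProd c (Fin.cons g v : Fin (k + 1) → G) = c [] g * treeProd (fun l => c (g :: l)) v := by
  rw [treeProd, Fin.prod_univ_succ]
  congr 1
  refine Finset.prod_congr rfl fun j _ => ?_
  congr 1
  simp only [Fin.val_succ]
  rw [List.ofFn_succ]
  congr 1

theorem sum_treeProd_succ [Fintype G] {k : ℕ} (c : List G → G → ℝ) :
    ∑ v : Fin (k + 1) → G, treeProd c v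
      = ∑ g, c [] g * ∑ v : Fin k → G, treeProd (fun l => c (g :: l)) v := by
  rw [← (Fin.consEquiv fun _ : Fin (k + 1) => G).sum_comp, Fintype.sum_prod_type]
  refine Finset.sum_congr rfl fun g _ => ?_
  rw [Finset.mul_sum]
  exact Finset.sum_congr rfl fun v _ => treeProd_cons c g v

theorem treeProd_nonneg {k : ℕ} {c : List G → G → ℝ} (hc : ∀ l g, 0 ≤ c l g) (v : Fin k → G) :
    0 ≤ treeProd c v := Finset.prod_nonneg fun _ _ => hc _ _

theorem sum_treeProd_le [Fintype G] {c : List G → G → ℝ} {B : ℝ} (hc : ∀ l g, 0 ≤ c l g)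
    (hB : 0 ≤ B) (hsum : ∀ l, ∑ g, c l g ≤ B) (k : ℕ) :
    ∑ v : Fin k → G, treeProd c v ≤ B ^ k := by
  induction k generalizing c with
  | zero => simp [treeProd]
  | succ k ih =>
    rw [sum_treeProd_succ, pow_succ']
    calc _ ≤ ∑ g, c [] g * B ^ k := Finset.sum_le_sum fun g _ =>
          mul_le_mul_of_nonneg_left (ih (fun l => hc _) fun l => hsum _) (hc _ _)
      _ ≤ B * B ^ k := by
          rw [← Finset.sum_mul]
          exact mul_le_mul_of_nonneg_right (hsum _) (pow_nonneg hB k)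

theorem le_sum_treeProd [Fintype G] {c : List G → G → ℝ} {B : ℝ} (hc : ∀ l g, 0 ≤ c l g)
    (hB : 0 ≤ B) (hsum : ∀ l, B ≤ ∑ g, c l g) (k : ℕ) :
    B ^ k ≤ ∑ v : Fin k → G, treeProd c v := by
  induction k generalizing c with
  | zero => simp [treeProd]
  | succ k ih =>
    rw [sum_treeProd_succ, pow_succ']
    calc B * B ^ k ≤ ∑ g, c [] g * B ^ k := by
          rw [← Finset.sum_mul]
          exact mul_le_mul_of_nonneg_right (hsum _) (pow_nonneg hB k)
      _ ≤ _ := Finset.sum_le_sum fun g _ =>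
          mul_le_mul_of_nonneg_left (ih (fun l => hc _) fun l => hsum _) (hc _ _)

theorem sum_treeProd_eq_one [Fintype G] {c : List G → G → ℝ} (hc : ∀ l g, 0 ≤ c l g)
    (hsum : ∀ l, ∑ g, c l g = 1) (k : ℕ) : ∑ v : Fin k → G, treeProd c v = 1 := by
  apply le_antisymm
  · simpa using sum_treeProd_le hc zero_le_one (fun l => (hsum l).le) k
  · simpa using le_sum_treeProd hc zero_le_one (fun l => (hsum l).ge) k

/-- The moments of a likelihood ratio that lies in `[exp (-ε), exp ε]`. -/
theorem sum_mul_div_pow_le [Fintype G] {p p' : G → ℝ} {ε : ℝ} (hε : 0 < ε) (hp' : ∀ g, 0 < p' g)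
    (hsum : ∑ g, p g = 1) (hsum' : ∑ g, p' g = 1)
    (hle : ∀ g, p g ≤ Real.exp ε * p' g) (hle' : ∀ g, p' g ≤ Real.exp ε * p g) (a : ℕ) :
    ∑ g, p' g * (p g / p' g) ^ a ≤ Real.exp ((a * ε) ^ 2 / 2) := by
  set b := Real.exp ε with hb
  have hb1 : 1 < b := Real.one_lt_exp_iff.2 hε
  have hb0 : 0 < b := by linarith
  have hbinv : b⁻¹ < 1 := inv_lt_one_of_one_lt₀ hb1
  have hgap : 0 < b - b⁻¹ := by linarith
  have hmul : b * b⁻¹ = 1 := mul_inv_cancel₀ hb0.ne'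
  -- By convexity the power lies below its chord. The ratio has mean one under `p'`, so the worst
  -- case is a two-point law on `b⁻¹` and `b` with mean one.
  have chord : ∀ r, b⁻¹ ≤ r → r ≤ b →
      r ^ a ≤ (b - r) / (b - b⁻¹) * b⁻¹ ^ a + (r - b⁻¹) / (b - b⁻¹) * b ^ a := by
    intro r h1 h2
    have := (convexOn_pow (𝕜 := ℝ) a).2
      (show b⁻¹ ∈ Set.Ici (0 : ℝ) from (inv_pos.2 hb0).le) (show b ∈ Set.Ici (0 : ℝ) from hb0.le)
      (show 0 ≤ (b - r) / (b - b⁻¹) from div_nonneg (by linarith) hgap.le)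
      (show 0 ≤ (r - b⁻¹) / (b - b⁻¹) from div_nonneg (by linarith) hgap.le)
      (by rw [← add_div, div_eq_one_iff_eq hgap.ne']; ring)
    simp only [smul_eq_mul] at this
    have e : (b - r) / (b - b⁻¹) * b⁻¹ + (r - b⁻¹) / (b - b⁻¹) * b = r := by
      rw [div_mul_eq_mul_div, div_mul_eq_mul_div, ← add_div, div_eq_iff hgap.ne']; ring
    rwa [e] at this
  have hterm : ∀ g, p' g * (p g / p' g) ^ a ≤
      (b * p' g - p g) / (b - b⁻¹) * b⁻¹ ^ a + (p g - b⁻¹ * p' g) / (b - b⁻¹) * b ^ a := by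
    intro g
    have h1 : b⁻¹ ≤ p g / p' g := by
      rw [le_div_iff₀ (hp' g), inv_mul_le_iff₀ hb0]; exact hle' g
    have h2 : p g / p' g ≤ b := (div_le_iff₀ (hp' g)).2 (hle g)
    refine (mul_le_mul_of_nonneg_left (chord _ h1 h2) (hp' g).le).trans (le_of_eq ?_)
    have := (hp' g).ne'
    field_simp
  have htotal : ∑ g, p' g * (p g / p' g) ^ a ≤
      (b - 1) / (b - b⁻¹) * b⁻¹ ^ a + (1 - b⁻¹) / (b - b⁻¹) * b ^ a := by
    refine (Finset.sum_le_sum fun g _ => hterm g).trans (le_of_eq ?_)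
    rw [Finset.sum_add_distrib, ← Finset.sum_mul, ← Finset.sum_mul, ← Finset.sum_div,
      ← Finset.sum_div, Finset.sum_sub_distrib, Finset.sum_sub_distrib, ← Finset.mul_sum,
      ← Finset.mul_sum, hsum, hsum', mul_one, mul_one]
  -- The two-point law of mean one puts at least half of its mass on the smaller value, so equal
  -- masses give an upper bound. The excess is controlled by `b + b⁻¹ ≥ 2`.
  have hcosh : (b - 1) / (b - b⁻¹) * b⁻¹ ^ a + (1 - b⁻¹) / (b - b⁻¹) * b ^ a
      ≤ Real.cosh (a * ε) := by
    have e1 : b ^ a = Real.exp (a * ε) := by rw [hb, ← Real.exp_nat_mul]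
    have e2 : b⁻¹ ^ a = Real.exp (-(a * ε)) := by rw [inv_pow, e1, Real.exp_neg]
    have hpow : b⁻¹ ^ a ≤ b ^ a := pow_le_pow_left₀ (inv_pos.2 hb0).le (by linarith) a
    rw [Real.cosh_eq, ← e1, ← e2, div_mul_eq_mul_div, div_mul_eq_mul_div, ← add_div,
      div_le_div_iff₀ hgap (by norm_num)]
    have h2 : 2 ≤ b + b⁻¹ := by nlinarith [sq_nonneg (b - 1), inv_pos.2 hb0]
    nlinarith [mul_nonneg (sub_nonneg.2 hpow) (sub_nonneg.2 h2)]
  exact htotal.trans (hcosh.trans (Real.cosh_le_exp_half_sq _))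

/-- A pointwise Chernoff bound: where the ratio `p / p'` exceeds `exp θ`, the factor `exp (-(a * θ))
* (p / p') ^ a` is at least one. -/
theorem le_exp_mul_add_moment {p p' θ : ℝ} (hp' : 0 < p') (a : ℕ) (hp : 0 ≤ p) :
    p ≤ Real.exp θ * p' + Real.exp (-(a * θ)) * (p' * (p / p') ^ (a + 1)) := by
  rcases le_total p (Real.exp θ * p') with h | h
  · have : 0 ≤ Real.exp (-(a * θ)) * (p' * (p / p') ^ (a + 1)) := by positivity
    linarith
  · have hr : Real.exp θ ≤ p / p' := (le_div_iff₀ hp').2 h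
    have hpow : Real.exp (a * θ) ≤ (p / p') ^ a := by
      rw [Real.exp_nat_mul]; exact pow_le_pow_left₀ (Real.exp_pos _).le hr a
    have : p ≤ Real.exp (-(a * θ)) * (p' * (p / p') ^ (a + 1)) := by
      rw [pow_succ, Real.exp_neg, ← div_eq_inv_mul, le_div_iff₀ (Real.exp_pos _),
        show p' * ((p / p') ^ a * (p / p')) = p * (p / p') ^ a by field_simp]
      exact mul_le_mul_of_nonneg_left hpow hp
    have := mul_pos (Real.exp_pos θ) hp'
    linarith

/-- Approximate stability of an adaptive composition of stable steps. -/
theorem sum_treeProd_mul_le [Fintype G] {c c' : List G → G → ℝ} {ε : ℝ} (hε : 0 < ε)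
    (hc : ∀ l g, 0 < c l g) (hc' : ∀ l g, 0 < c' l g)
    (hsum : ∀ l, ∑ g, c l g = 1) (hsum' : ∀ l, ∑ g, c' l g = 1)
    (hle : ∀ l g, c l g ≤ Real.exp ε * c' l g) (hle' : ∀ l g, c' l g ≤ Real.exp ε * c l g)
    (k a : ℕ) (θ : ℝ) {f : (Fin k → G) → ℝ} (hf : ∀ v, f v ∈ Set.Icc (0 : ℝ) 1) :
    ∑ v, treeProd c v * f v ≤ Real.exp θ * ∑ v, treeProd c' v * f v +
      Real.exp (-(a * θ) + k * (((a + 1) * ε) ^ 2 / 2)) := by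
  have hpos : ∀ v : Fin k → G, 0 < treeProd c v := fun v => Finset.prod_pos fun _ _ => hc _ _
  have hpos' : ∀ v : Fin k → G, 0 < treeProd c' v := fun v => Finset.prod_pos fun _ _ => hc' _ _
  -- The likelihood ratio of a transcript is the product of the stepwise ratios, so its moment is
  -- again a product along the tree and is bounded step by step.
  let d : List G → G → ℝ := fun l g => c' l g * (c l g / c' l g) ^ (a + 1)
  have hd0 : ∀ l g, 0 ≤ d l g := fun l g =>
    mul_nonneg (hc' l g).le (pow_nonneg (div_nonneg (hc l g).le (hc' l g).le) _)
  have hd : ∀ v : Fin k → G, treeProd c' v * (treeProd c v / treeProd c' v) ^ (a + 1)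
      = treeProd d v := fun v => by
    simp only [treeProd, d, ← Finset.prod_div_distrib, ← Finset.prod_pow,
      ← Finset.prod_mul_distrib]
  have hmoment : ∑ v : Fin k → G, treeProd d v ≤ Real.exp (k * (((a + 1) * ε) ^ 2 / 2)) := by
    rw [Real.exp_nat_mul]
    refine sum_treeProd_le hd0 (Real.exp_pos _).le (fun l => ?_) k
    have := sum_mul_div_pow_le hε (hc' l) (hsum l) (hsum' l) (hle l) (hle' l) (a + 1)
    push_cast at this
    exact this
  calc ∑ v, treeProd c v * f v
      ≤ ∑ v, (Real.exp θ * (treeProd c' v * f v) + Real.exp (-(a * θ)) * treeProd d v) := by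
        refine Finset.sum_le_sum fun v _ => ?_
        have h1 := le_exp_mul_add_moment (θ := θ) (hpos' v) a (hpos v).le
        rw [hd] at h1
        have h2 := mul_le_mul_of_nonneg_right h1 (hf v).1
        have h3 : Real.exp (-(a * θ)) * treeProd d v * f v ≤ Real.exp (-(a * θ)) * treeProd d v :=
          mul_le_of_le_one_right (mul_nonneg (Real.exp_pos _).le (treeProd_nonneg hd0 v)) (hf v).2
        nlinarith
    _ ≤ _ := by
        rw [Finset.sum_add_distrib, ← Finset.mul_sum, ← Finset.mul_sum, Real.exp_add]
        gcongr

/-- The probability that some step of an adaptive composition falls outside the set of good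
outcomes. -/
theorem sum_treeProd_bad_le [Fintype G] {c : List G → G → ℝ} {b : ℝ} (hc : ∀ l g, 0 ≤ c l g)
    (hsum : ∀ l, ∑ g, c l g = 1) (good : List G → G → Prop) [∀ l g, Decidable (good l g)]
    (hbad : ∀ l, ∑ g, (if good l g then 0 else c l g) ≤ b) (hb : b ≤ 1) (k : ℕ) :
    (open Classical in ∑ v : Fin k → G, if ∀ j : Fin k,
      good (List.ofFn fun i : Fin j.val => v ⟨i.val, i.isLt.trans j.isLt⟩) (v j)
      then 0 else treeProd c v) ≤ k * b := by
  classical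
  let d : List G → G → ℝ := fun l g => if good l g then c l g else 0
  have hd : ∀ v : Fin k → G, treeProd d v = if ∀ j : Fin k,
      good (List.ofFn fun i : Fin j.val => v ⟨i.val, i.isLt.trans j.isLt⟩) (v j)
      then treeProd c v else 0 := by
    intro v
    split_ifs with hv
    · exact Finset.prod_congr rfl fun j _ => if_pos (hv j)
    · push Not at hv
      obtain ⟨j, hj⟩ := hv
      exact Finset.prod_eq_zero (Finset.mem_univ j) (if_neg hj)
  have hdsum : ∀ l, 1 - b ≤ ∑ g, d l g := by
    intro l
    have : ∑ g, d l g + ∑ g, (if good l g then 0 else c l g) = 1 := by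
      rw [← hsum l, ← Finset.sum_add_distrib]
      refine Finset.sum_congr rfl fun g _ => ?_
      simp only [d]
      split_ifs <;> simp
    linarith [hbad l]
  have hlow := le_sum_treeProd (c := d) (fun l g => by
    simp only [d]; split_ifs; exacts [hc l g, le_rfl]) (by linarith : 0 ≤ 1 - b) hdsum k
  -- Each step keeps good mass at least `1 - b`, so the all-good mass is at least `(1 - b) ^ k`,
  -- which Bernoulli's inequality bounds below by `1 - k b`.
  have hbern : 1 + (k : ℝ) * (-b) ≤ (1 + -b) ^ k := one_add_mul_le_pow (by linarith) k
  rw [← sub_eq_add_neg] at hbern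
  have hone := sum_treeProd_eq_one hc hsum k
  have hsplit : ∑ v : Fin k → G, (if ∀ j : Fin k,
      good (List.ofFn fun i : Fin j.val => v ⟨i.val, i.isLt.trans j.isLt⟩) (v j)
      then 0 else treeProd c v) + ∑ v : Fin k → G, treeProd d v = 1 := by
    rw [← hone, ← Finset.sum_add_distrib]
    refine Finset.sum_congr rfl fun v _ => ?_
    rw [hd]
    split_ifs <;> simp
  linarith

end Composition

/-! ### From stability and sample accuracy to accuracy for the distribution -/

theorem integrable_of_mem_unit {α : Type*} [MeasurableSpace α] {μ : Measure α}
    [IsFiniteMeasure μ] {f : α → ℝ} (hf : Measurable f) (h : ∀ a, f a ∈ Set.Icc (0 : ℝ) 1) :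
    Integrable f μ :=
  Integrable.of_bound hf.aestronglyMeasurable 1
    (Filter.Eventually.of_forall fun a => by
      rw [Real.norm_eq_abs, abs_of_nonneg (h a).1]; exact (h a).2)

/-- If a stable randomized choice of a test `f v` from the sample is typically such that the test
holds on three eighths of the sample, then tests of probability at most `1/4` are rarely chosen. -/
theorem integral_sum_le_of_stable {S Z V : Type*} [MeasurableSpace S] [MeasurableSpace Z]
    [Fintype V] {μ : Measure S} {Q : Measure Z} [IsProbabilityMeasure μ] [IsProbabilityMeasure Q]
    {m : ℕ} (hm : 0 < m) {B : Fin m → S → Z} {R : Fin m → S × Z → S}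
    (hswap : ∀ i, MeasurePreserving (fun q : S × Z => (R i q, B i q.1)) (μ.prod Q) (μ.prod Q))
    {pr : S → V → ℝ} (hprm : ∀ v, Measurable fun s => pr s v) (hpr0 : ∀ s v, 0 ≤ pr s v)
    (hpr1 : ∀ s, ∑ v, pr s v = 1) {a δ b : ℝ} (ha0 : 0 ≤ a) (ha : a ≤ 5 / 4)
    (hstab : ∀ i s z (f : V → ℝ), (∀ v, f v ∈ Set.Icc (0 : ℝ) 1) →
      ∑ v, pr s v * f v ≤ a * ∑ v, pr (R i (s, z)) v * f v + δ)
    {f : V → Z → ℝ} (hfm : ∀ v, Measurable (f v)) (hf : ∀ v z, f v z ∈ Set.Icc (0 : ℝ) 1)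
    {E : V → ℝ} (hE : ∀ v, E v ∈ Set.Icc (0 : ℝ) 1)
    (hfE : ∀ v, E v * ∫ z, f v z ∂Q ≤ E v * (1 / 4))
    (hacc : ∀ s, 3 / 8 * m * (∑ v, pr s v * E v - b) ≤
      ∑ i : Fin m, ∑ v, pr s v * (E v * f v (B i s))) :
    ∫ s, ∑ v, pr s v * E v ∂μ ≤ 16 * δ + 6 * b := by
  have hBm : ∀ i, Measurable (B i) := fun i => by
    have h1 : Measurable fun q : S × Z => B i q.1 := (hswap i).measurable.snd
    obtain ⟨z⟩ : Nonempty Z := Q.nonempty_of_neZero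
    exact h1.comp (measurable_id.prodMk (measurable_const (a := z)))
  have hpr_le : ∀ s v, pr s v ≤ 1 := fun s v => by
    rw [← hpr1 s]
    exact Finset.single_le_sum (fun v _ => hpr0 s v) (Finset.mem_univ v)
  have hEf : ∀ v z, E v * f v z ∈ Set.Icc (0 : ℝ) 1 := fun v z =>
    ⟨mul_nonneg (hE v).1 (hf v z).1, mul_le_one₀ (hE v).2 (hf v z).1 (hf v z).2⟩
  have hsum01 : ∀ s (w : V → ℝ), (∀ v, w v ∈ Set.Icc (0 : ℝ) 1) →
      ∑ v, pr s v * w v ∈ Set.Icc (0 : ℝ) 1 := fun s w hw =>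
    ⟨Finset.sum_nonneg fun v _ => mul_nonneg (hpr0 s v) (hw v).1, by
      rw [← hpr1 s]
      exact Finset.sum_le_sum fun v _ => mul_le_of_le_one_right (hpr0 s v) (hw v).2⟩
  let e : S → ℝ := fun s => ∑ v, pr s v * E v
  have he : Integrable e μ := integrable_of_mem_unit
    (Finset.measurable_sum _ fun v _ => (hprm v).mul_const _) fun s => hsum01 s E hE
  let A : Fin m → S → ℝ := fun i s => ∑ v, pr s v * (E v * f v (B i s))
  have hA : ∀ i, Integrable (A i) μ := fun i => integrable_of_mem_unit
    (Finset.measurable_sum _ fun v _ =>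
      (hprm v).mul (((hfm v).comp (hBm i)).const_mul _)) fun s => hsum01 s _ fun v => hEf v _
  let g : S × Z → ℝ := fun q => ∑ v, pr q.1 v * (E v * f v q.2)
  have hgm : Measurable g := Finset.measurable_sum _ fun v _ =>
    ((hprm v).comp measurable_fst).mul (((hfm v).comp measurable_snd).const_mul _)
  have hg : Integrable g (μ.prod Q) := integrable_of_mem_unit hgm fun q =>
    hsum01 q.1 _ fun v => hEf v _
  -- On a fresh block, independent of the choice of `v`, every selected test has probability at most
  -- `1/4`.
  have hg_le : ∫ q, g q ∂(μ.prod Q) ≤ 1 / 4 * ∫ s, e s ∂μ := by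
    have hint_prod : ∀ v, Integrable (fun q : S × Z => pr q.1 v * (E v * f v q.2)) (μ.prod Q) :=
      fun v => integrable_of_mem_unit
        (((hprm v).comp measurable_fst).mul (((hfm v).comp measurable_snd).const_mul _))
        fun q => ⟨mul_nonneg (hpr0 _ _) (hEf v _).1,
          mul_le_one₀ (hpr_le _ _) (hEf v _).1 (hEf v _).2⟩
    have hint_E : ∀ v, Integrable (fun s => pr s v * E v) μ := fun v =>
      integrable_of_mem_unit ((hprm v).mul_const _)
        fun s => ⟨mul_nonneg (hpr0 _ _) (hE v).1, mul_le_one₀ (hpr_le _ _) (hE v).1 (hE v).2⟩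
    rw [integral_finsetSum _ fun v _ => hint_prod v, integral_finsetSum _ fun v _ => hint_E v,
      Finset.mul_sum]
    refine Finset.sum_le_sum fun v _ => ?_
    rw [integral_prod_mul (fun s => pr s v) (fun z => E v * f v z), integral_const_mul,
      integral_mul_const]
    have h0 : 0 ≤ ∫ s, pr s v ∂μ := integral_nonneg fun s => hpr0 s v
    nlinarith [mul_le_mul_of_nonneg_left (hfE v) h0]
  -- Replace the `i`-th block in the sample that drives the choice, at the cost of `a` and `δ`. The
  -- block being tested is then independent of that sample, and the exchange identifies the
  -- expectation with that of `g`.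
  have hAi : ∀ i, ∫ s, A i s ∂μ ≤ a * (1 / 4 * ∫ s, e s ∂μ) + δ := by
    intro i
    have hmap : ∫ q, g (R i q, B i q.1) ∂(μ.prod Q) = ∫ q, g q ∂(μ.prod Q) := by
      have := integral_map (μ := μ.prod Q) (hswap i).measurable.aemeasurable
        (f := g) hgm.aestronglyMeasurable
      rw [(hswap i).map_eq] at this
      exact this.symm
    have hfst : ∫ s, A i s ∂μ = ∫ q, A i q.1 ∂(μ.prod Q) := by
      rw [integral_prod _ ((hA i).comp_fst Q)]
      simp
    have hgi : Integrable (fun q : S × Z => g (R i q, B i q.1)) (μ.prod Q) :=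
      (hswap i).integrable_comp_of_integrable hg
    calc ∫ s, A i s ∂μ = ∫ q, A i q.1 ∂(μ.prod Q) := hfst
      _ ≤ ∫ q, (a * g (R i q, B i q.1) + δ) ∂(μ.prod Q) := by
          refine integral_mono ((hA i).comp_fst Q)
            ((hgi.const_mul a).add (integrable_const δ)) fun q => ?_
          exact hstab i q.1 q.2 (fun v => E v * f v (B i q.1)) fun v => hEf v _
      _ = a * ∫ q, g q ∂(μ.prod Q) + δ := by
          rw [integral_add (hgi.const_mul a) (integrable_const δ), integral_const_mul, hmap]
          simp
      _ ≤ _ := by gcongr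
  have htotal : 3 / 8 * m * (∫ s, e s ∂μ - b) ≤ m * (a * (1 / 4 * ∫ s, e s ∂μ) + δ) := by
    calc 3 / 8 * m * (∫ s, e s ∂μ - b) = ∫ s, 3 / 8 * m * (e s - b) ∂μ := by
          rw [integral_const_mul, integral_sub he (integrable_const b)]
          simp
      _ ≤ ∫ s, ∑ i, A i s ∂μ := integral_mono ((he.sub (integrable_const b)).const_mul _)
          (integrable_finsetSum _ fun i _ => hA i) hacc
      _ = ∑ i, ∫ s, A i s ∂μ := integral_finsetSum _ fun i _ => hA i
      _ ≤ ∑ _i : Fin m, (a * (1 / 4 * ∫ s, e s ∂μ) + δ) := Finset.sum_le_sum fun i _ => hAi i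
      _ = _ := by rw [Finset.sum_const, Finset.card_univ, Fintype.card_fin, nsmul_eq_mul]
  have hm' : (0 : ℝ) < m := by exact_mod_cast hm
  have he0 : 0 ≤ ∫ s, e s ∂μ := integral_nonneg fun s => (hsum01 s E hE).1
  -- As `a ≤ 5/4`, the right side is at most `5/16` of the mean of `e` plus `δ`. The gap `3/8 - 5/16
  -- = 1/16` yields the constants `16` and `6`.
  have h1 : 3 / 8 * (∫ s, e s ∂μ - b) ≤ a * (1 / 4 * ∫ s, e s ∂μ) + δ := by
    refine le_of_mul_le_mul_left ?_ hm'
    linarith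
  have h2 := mul_le_mul_of_nonneg_right ha (show 0 ≤ 1 / 4 * ∫ s, e s ∂μ by linarith)
  change ∫ s, e s ∂μ ≤ _
  linarith

/-! ### Blocks of the sample -/

section Blocks

variable {X : Type*} {n t : ℕ}

theorem block_add_lt (i : Fin (n / t)) (l : Fin t) : i * t + l < n := by
  have h1 : (i + 1) * t ≤ n := (Nat.le_div_iff_mul_le (by have := l.isLt; omega)).1 i.isLt
  have := l.isLt
  rw [add_mul, one_mul] at h1
  omega

/-- The `i`-th block of length `t` of the sample. -/
def sampleBlock (i : Fin (n / t)) (s : Fin n → X) : Fin t → X :=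
  fun l => s ⟨i * t + l, block_add_lt i l⟩

/-- The sample with the `i`-th block replaced by `z`. -/
def replaceBlock (i : Fin (n / t)) (q : (Fin n → X) × (Fin t → X)) : Fin n → X :=
  fun r => if h : (i : ℕ) * t ≤ r ∧ (r : ℕ) < i * t + t then q.2 ⟨r - i * t, by omega⟩ else q.1 r

/-- The exchange of the `i`-th block with a block of `t` further places. -/
def blockSwap (i : Fin (n / t)) : Equiv.Perm (Fin n ⊕ Fin t) :=
  Function.Involutive.toPerm
    (Sum.elim (fun r => if h : (i : ℕ) * t ≤ r ∧ (r : ℕ) < i * t + t then Sum.inr ⟨r - i * t, by omega⟩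
      else Sum.inl r) fun l => Sum.inl ⟨i * t + l, block_add_lt i l⟩) (by
    rintro (r | l)
    · by_cases h : (i : ℕ) * t ≤ r ∧ (r : ℕ) < i * t + t
      · simp only [Sum.elim_inl, dif_pos h, Sum.elim_inr, Sum.inl.injEq, Fin.ext_iff]
        omega
      · simp only [Sum.elim_inl, dif_neg h]
    · have h : (i : ℕ) * t ≤ i * t + l ∧ (i : ℕ) * t + l < i * t + t := ⟨by omega, by omega⟩
      simp only [Sum.elim_inr, Sum.elim_inl, dif_pos h, Sum.inr.injEq, Fin.ext_iff]
      omega)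

/-- Joined together, the sample and the fresh block are `n + t` independent draws from `P`, and the
exchange only permutes them. -/
theorem measurePreserving_replaceBlock [MeasurableSpace X] (P : Measure X)
    [IsProbabilityMeasure P] (i : Fin (n / t)) :
    MeasurePreserving (fun q : (Fin n → X) × (Fin t → X) => (replaceBlock i q, sampleBlock i q.1))
      ((Measure.pi fun _ => P).prod (iidLaw P t)) ((Measure.pi fun _ => P).prod (iidLaw P t)) := by
  have h1 := measurePreserving_sumPiEquivProdPi (ι := Fin n) (ι' := Fin t) (X := fun _ => X)
    (fun _ => P)
  have h2 := measurePreserving_arrowCongr' (fun _ : Fin n ⊕ Fin t => P) (fun _ => P) (blockSwap i)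
    (MeasurableEquiv.refl X) fun _ => MeasurePreserving.id P
  convert (h1.comp h2).comp (measurePreserving_sumPiEquivProdPi_symm (ι := Fin n) (ι' := Fin t)
    (X := fun _ => X) (fun _ => P)) using 1
  funext q
  refine Prod.ext ?_ ?_
  · funext r
    change _ = (Equiv.sumPiEquivProdPi fun _ => X).symm q ((blockSwap i).symm (Sum.inl r))
    change _ = (Equiv.sumPiEquivProdPi fun _ => X).symm q (blockSwap i (Sum.inl r))
    have hsw : blockSwap i (Sum.inl r) = if h : (i : ℕ) * t ≤ r ∧ (r : ℕ) < i * t + t then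
        Sum.inr ⟨r - i * t, by omega⟩ else Sum.inl r := rfl
    rw [hsw]
    simp only [replaceBlock]
    split_ifs <;> rfl
  · funext l
    rfl

theorem blockEval_mul (s : Fin n → X) (φ : (Fin t → X) → ℝ) (i : Fin (n / t)) :
    blockEval s φ (i * t) = φ (sampleBlock i s) := by
  rw [blockEval]
  split_ifs with h
  · rfl
  · rcases Nat.eq_zero_or_pos t with rfl | ht
    · exact absurd i.isLt (by simp)
    · exact absurd ((MedianProgram.block_le_iff ht).2 i.isLt) h

theorem sampleBlock_replaceBlock_of_ne {i j : Fin (n / t)} (hij : j ≠ i)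
    (q : (Fin n → X) × (Fin t → X)) : sampleBlock j (replaceBlock i q) = sampleBlock j q.1 := by
  funext l
  rw [sampleBlock, replaceBlock, dif_neg]
  · rfl
  · rintro ⟨h1, h2⟩
    simp only at h1 h2
    have hl := l.isLt
    rcases lt_or_gt_of_ne (Fin.val_ne_of_ne hij) with h | h
    · have := Nat.mul_le_mul_right t (show (j : ℕ) + 1 ≤ i from h)
      rw [add_mul, one_mul] at this
      omega
    · have := Nat.mul_le_mul_right t (show (i : ℕ) + 1 ≤ j from h)
      rw [add_mul, one_mul] at this
      omega

theorem blockEval_eq_zero {s : Fin n → X} {φ : (Fin t → X) → ℝ} {j : ℕ} (ht : 0 < t)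
    (hj : n / t ≤ j) : blockEval s φ (j * t) = 0 := by
  rw [blockEval, dif_neg]
  rw [MedianProgram.block_le_iff ht]
  omega

theorem clampUnit_eq (x : ℝ) : clampUnit x = max (-1) (min 1 x) := by
  unfold clampUnit
  rcases le_total x (-1) with h | h
  · rw [max_eq_right (by linarith : x + 1 ≤ 0), max_eq_left (by norm_num),
      min_eq_right (by linarith), max_eq_left h]
    norm_num
  · rw [max_eq_left (by linarith : 0 ≤ x + 1)]
    rcases le_total x 1 with h' | h'
    · rw [max_eq_left (by linarith), min_eq_right h', max_eq_right h]; ring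
    · rw [max_eq_right (by linarith), min_eq_left h', max_eq_right (by norm_num)]; ring

theorem clampUnit_mem (x : ℝ) : clampUnit x ∈ Set.Icc (-1 : ℝ) 1 := by
  rw [clampUnit_eq]
  exact ⟨le_max_left _ _, max_le (by norm_num) (min_le_left _ _)⟩

theorem measurable_clampUnit : Measurable clampUnit := by
  unfold clampUnit; fun_prop

/-- The truncated values of the query `φ` on the blocks of the sample `s`. -/
noncomputable def queryValues (s : Fin n → X) (φ : (Fin t → X) → ℝ) : ℕ → ℝ :=
  MedianProgram.blockValues (blockEval s φ) t

theorem queryValues_mem (s : Fin n → X) (φ : (Fin t → X) → ℝ) (j : ℕ) :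
    queryValues s φ j ∈ Set.Icc (-1 : ℝ) 1 := clampUnit_mem _

theorem queryValues_apply (s : Fin n → X) (φ : (Fin t → X) → ℝ) (i : Fin (n / t)) :
    queryValues s φ i = clampUnit (φ (sampleBlock i s)) := by
  rw [queryValues, MedianProgram.blockValues, blockEval_mul]

/-- The stability lemmas ask for agreement at all indices other than `i`, including those beyond the
last block. -/
theorem queryValues_replaceBlock (ht : 0 < t) (s : Fin n → X) (z : Fin t → X)
    (φ : (Fin t → X) → ℝ) (i : Fin (n / t)) {j : ℕ} (hj : j ≠ i) :
    queryValues s φ j = queryValues (replaceBlock i (s, z)) φ j := by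
  by_cases hjm : j < n / t
  · have hne : (⟨j, hjm⟩ : Fin (n / t)) ≠ i := fun h => hj (congrArg Fin.val h)
    have h1 := queryValues_apply s φ ⟨j, hjm⟩
    have h2 := queryValues_apply (replaceBlock i (s, z)) φ ⟨j, hjm⟩
    rw [sampleBlock_replaceBlock_of_ne hne] at h2
    exact h1.trans h2.symm
  -- Beyond the last block both sides are the default value `0` of `blockEval`, truncated.
  · rw [queryValues, queryValues, MedianProgram.blockValues, MedianProgram.blockValues,
      blockEval_eq_zero ht (not_lt.1 hjm), blockEval_eq_zero ht (not_lt.1 hjm)]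

theorem measurable_sampleBlock [MeasurableSpace X] (i : Fin (n / t)) :
    Measurable (sampleBlock i : (Fin n → X) → Fin t → X) :=
  measurable_pi_lambda _ fun _ => measurable_pi_apply _

theorem measurable_queryValues [MeasurableSpace X] {α : Type*} [MeasurableSpace α] (ht : 0 < t)
    {s : α → Fin n → X} (hs : Measurable s) {φ : α → (Fin t → X) → ℝ}
    (hφ : Measurable fun q : α × (Fin t → X) => φ q.1 q.2) :
    Measurable fun a => queryValues (s a) (φ a) := by
  refine measurable_pi_lambda _ fun j => ?_
  by_cases hjm : j < n / t
  · have : (fun a => queryValues (s a) (φ a) j)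
        = fun a => clampUnit (φ a (sampleBlock ⟨j, hjm⟩ (s a))) := by
      funext a
      exact queryValues_apply (s a) (φ a) ⟨j, hjm⟩
    rw [this]
    exact measurable_clampUnit.comp (hφ.comp (measurable_id.prodMk
      ((measurable_sampleBlock _).comp hs)))
  · have : (fun a => queryValues (s a) (φ a) j) = fun _ => clampUnit 0 := by
      funext a
      rw [queryValues, MedianProgram.blockValues, blockEval_eq_zero ht (not_lt.1 hjm)]
    rw [this]
    exact measurable_const

end Blocks

/-! ### Transcripts of a deterministic analyst -/

section Transcript

variable {X : Type*} [MeasurableSpace X] {n t k D : ℕ} {η h : ℝ}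

/-- The answers that precede the `j`-th one in the transcript `v`. -/
def historyOf {G : Type*} {k : ℕ} (v : Fin k → G) (j : Fin k) : List G :=
  List.ofFn fun i : Fin j.val => v ⟨i.val, i.isLt.trans j.isLt⟩

/-- The law of the next answer on the sample `s` for an analyst with queries `q`. -/
noncomputable def stepProb (η h : ℝ) (D : ℕ) (q : List (Fin (2 ^ D)) → (Fin t → X) → ℝ)
    (s : Fin n → X) (l : List (Fin (2 ^ D))) (g : Fin (2 ^ D)) : ℝ :=
  cellProb η h (n / t) D (queryValues s (q l)) g

theorem measurable_stepProb (ht : 0 < t) {q : List (Fin (2 ^ D)) → (Fin t → X) → ℝ}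
    {l : List (Fin (2 ^ D))} (hq : Measurable (q l)) (g : Fin (2 ^ D)) :
    Measurable fun s : Fin n → X => stepProb η h D q s l g := by
  have h1 : Measurable fun s : Fin n → X => queryValues s (q l) :=
    measurable_queryValues ht measurable_id (hq.comp measurable_snd)
  exact Measurable.comp (g := fun y : ℕ → ℝ => cellProb η h (n / t) D y g)
    (measurable_cellProb η h (n / t) D g) h1

/-- The answer `v` to the query `φ` is far in the tail of the distribution of the query. -/
def FarAnswer (P : Measure X) (h δ : ℝ) (φ : (Fin t → X) → ℝ) (v : ℝ) : Prop :=
  iidLaw P t {z | v - h ≤ clampUnit (φ z)} ≤ 1 / 4 ∨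
    iidLaw P t {z | clampUnit (φ z) ≤ v + δ + h} ≤ 1 / 4

open Classical in
theorem card_filter_queryValues {X : Type*} {n t : ℕ} (p : ℝ → Prop) (φ : (Fin t → X) → ℝ) (s : Fin n → X) :
    (((Finset.range (n / t)).filter fun i => p (queryValues s φ i)).card : ℝ)
      = ∑ i : Fin (n / t), {z | p (clampUnit (φ z))}.indicator (1 : (Fin t → X) → ℝ)
          (sampleBlock i s) := by
  rw [Finset.card_filter]
  push_cast
  rw [← Fin.sum_univ_eq_sum_range (fun i => if p (queryValues s φ i) then (1 : ℝ) else 0)]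
  refine Finset.sum_congr rfl fun i _ => ?_
  simp only [queryValues_apply, Set.indicator_apply, Set.mem_ofPred_eq, Pi.one_apply]

open Classical in
/-- A far answer is rarely given. -/
theorem integral_sum_farAnswer_le (P : Measure X) [IsProbabilityMeasure P] (ht : 0 < t)
    (hη : 0 < η) (hh : 0 < h) (hh' : h ≤ 1) (hm : 8 ≤ n / t)
    (q : List (Fin (2 ^ D)) → (Fin t → X) → ℝ) (hq : ∀ l, Measurable (q l))
    (a : ℕ) {θ b : ℝ} (hθ : Real.exp θ ≤ 5 / 4)
    (hb : 2 * Real.exp (-(η * ((n / t : ℕ) / 8))) / h ≤ b) (hb1 : b ≤ 1) :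
    ∫ s, ∑ v : Fin k → Fin (2 ^ D), treeProd (stepProb η h D q s) v *
        (if ∃ j, FarAnswer P h (2 / 2 ^ D) (q (historyOf v j)) (gridPoint D (v j)) then 1 else 0)
      ∂(Measure.pi fun _ : Fin n => P)
      ≤ 16 * Real.exp (-(a * θ) + k * (((a + 1) * (8 * η)) ^ 2 / 2)) + 6 * (k * b) := by
  have hy1 : ∀ (s : Fin n → X) (φ : (Fin t → X) → ℝ) i, -1 ≤ queryValues s φ i :=
    fun s φ i => (queryValues_mem s φ i).1
  have hc : ∀ (s : Fin n → X) l g, 0 < stepProb η h D q s l g := fun s l g =>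
    cellProb_pos hh.le (hy1 s _) D g
  have hc1 : ∀ (s : Fin n → X) l, ∑ g, stepProb η h D q s l g = 1 := fun s l =>
    sum_cellProb hh.le (hy1 s _) D
  -- To each transcript with a far answer attach a single tail event of one such answer. Accuracy on
  -- the sample then forces this improbable event on three eighths of the blocks.
  have hF : ∀ v : Fin k → Fin (2 ^ D), ∃ F : Set (Fin t → X), MeasurableSet F ∧
      ((∃ j, FarAnswer P h (2 / 2 ^ D) (q (historyOf v j)) (gridPoint D (v j))) →
        iidLaw P t F ≤ 1 / 4 ∧ ∀ s : Fin n → X,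
          (∀ j, AccurateAt h (2 / 2 ^ D) (n / t) (queryValues s (q (historyOf v j)))
            (gridPoint D (v j))) →
          3 / 8 * ((n / t : ℕ) : ℝ) ≤
            ∑ i : Fin (n / t), F.indicator (1 : (Fin t → X) → ℝ) (sampleBlock i s)) := by
    intro v
    by_cases hv : ∃ j, FarAnswer P h (2 / 2 ^ D) (q (historyOf v j)) (gridPoint D (v j))
    · obtain ⟨j, hj⟩ := hv
      have hmeas : Measurable fun z => clampUnit (q (historyOf v j) z) :=
        measurable_clampUnit.comp (hq _)
      rcases hj with hj | hj
      · refine ⟨_, measurableSet_le measurable_const hmeas, fun _ => ⟨hj, fun s hs => ?_⟩⟩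
        rw [← card_filter_queryValues (fun y => gridPoint D (v j) - h ≤ y)]
        have := (Nat.cast_le (α := ℝ)).2 (hs j).1
        push_cast at this
        linarith
      · refine ⟨_, measurableSet_le hmeas measurable_const, fun _ => ⟨hj, fun s hs => ?_⟩⟩
        rw [← card_filter_queryValues (fun y => y ≤ gridPoint D (v j) + 2 / 2 ^ D + h)]
        have := (Nat.cast_le (α := ℝ)).2 (hs j).2
        push_cast at this
        linarith
    · exact ⟨∅, MeasurableSet.empty, fun h => absurd h hv⟩
  choose F hFm hFE using hF
  have hind : ∀ v z, (F v).indicator (1 : (Fin t → X) → ℝ) z ∈ Set.Icc (0 : ℝ) 1 := by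
    intro v z
    rw [Set.indicator_apply]
    split_ifs <;> simp
  refine integral_sum_le_of_stable (Q := iidLaw P t) (m := n / t) (by omega)
    (B := sampleBlock) (R := replaceBlock) (measurePreserving_replaceBlock P)
    (pr := fun s v => treeProd (stepProb η h D q s) v)
    (E := fun v => if ∃ j, FarAnswer P h (2 / 2 ^ D) (q (historyOf v j)) (gridPoint D (v j))
      then 1 else 0)
    (a := Real.exp θ) (f := fun v => (F v).indicator 1) ?_ ?_ ?_ (Real.exp_pos _).le hθ ?_
    (fun v => measurable_const.indicator (hFm v)) hind ?_ ?_ ?_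
  · intro v
    refine Finset.measurable_prod _ fun j _ => ?_
    exact measurable_stepProb ht (hq _) (v j)
  · exact fun s v => treeProd_nonneg (fun l g => (hc s l g).le) v
  · exact fun s => sum_treeProd_eq_one (fun l g => (hc s l g).le) (hc1 s) k
  · intro i s z f hf
    exact sum_treeProd_mul_le (by positivity) (hc s) (hc _) (hc1 s) (hc1 _)
      (fun l g => cellProb_le_of_eq_off hη.le hh.le (hy1 _ _) (hy1 _ _)
        (fun j hj => queryValues_replaceBlock ht s z (q l) i hj) D g)
      (fun l g => cellProb_le_of_eq_off hη.le hh.le (hy1 _ _) (hy1 _ _)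
        (fun j hj => (queryValues_replaceBlock ht s z (q l) i hj).symm) D g) k a θ hf
  · intro v
    split_ifs <;> simp
  · intro v
    split_ifs with hv
    · rw [one_mul, one_mul, integral_indicator_one (hFm v), measureReal_def]
      refine (ENNReal.toReal_mono (by simp) (hFE v hv).1).trans (by simp)
    · simp
  · intro s
    let acc : (Fin k → Fin (2 ^ D)) → Prop := fun v => ∀ j : Fin k,
      AccurateAt h (2 / 2 ^ D) (n / t) (queryValues s (q (historyOf v j))) (gridPoint D (v j))
    have hbad : ∑ v : Fin k → Fin (2 ^ D),
        (if acc v then 0 else treeProd (stepProb η h D q s) v) ≤ k * b :=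
      sum_treeProd_bad_le (fun l g => (hc s l g).le) (hc1 s)
        (fun l g => AccurateAt h (2 / 2 ^ D) (n / t) (queryValues s (q l)) (gridPoint D g))
        (fun l => (sum_cellProb_not_accurateAt_le hη.le hh hh' hm (queryValues_mem s _) D).trans
          hb) hb1 k
    rw [Finset.sum_comm]
    -- Transcripts that are inaccurate on the sample give no lower bound; their mass is subtracted
    -- and totals at most `k * b`.
    have hterm : ∀ v : Fin k → Fin (2 ^ D), 3 / 8 * ((n / t : ℕ) : ℝ) *
        (treeProd (stepProb η h D q s) v * (if ∃ j, FarAnswer P h (2 / 2 ^ D)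
          (q (historyOf v j)) (gridPoint D (v j)) then 1 else 0) -
          if acc v then 0 else treeProd (stepProb η h D q s) v) ≤
        ∑ i : Fin (n / t), treeProd (stepProb η h D q s) v *
          ((if ∃ j, FarAnswer P h (2 / 2 ^ D) (q (historyOf v j)) (gridPoint D (v j))
            then 1 else 0) * (F v).indicator 1 (sampleBlock i s)) := by
      intro v
      have hp : 0 ≤ treeProd (stepProb η h D q s) v :=
        treeProd_nonneg (fun l g => (hc s l g).le) v
      have hm0 : (0 : ℝ) ≤ 3 / 8 * ((n / t : ℕ) : ℝ) := by positivity
      rw [← Finset.mul_sum, ← Finset.mul_sum]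
      have hsum0 : 0 ≤ ∑ i : Fin (n / t), (F v).indicator (1 : (Fin t → X) → ℝ)
          (sampleBlock i s) := Finset.sum_nonneg fun i _ => (hind v _).1
      by_cases hv : ∃ j, FarAnswer P h (2 / 2 ^ D) (q (historyOf v j)) (gridPoint D (v j))
      · rw [if_pos hv, mul_one, one_mul]
        by_cases ha : acc v
        · rw [if_pos ha, sub_zero, mul_comm]
          exact mul_le_mul_of_nonneg_left ((hFE v hv).2 s ha) hp
        · rw [if_neg ha, sub_self, mul_zero]
          exact mul_nonneg hp hsum0
      · rw [if_neg hv, mul_zero, zero_mul, mul_zero, zero_sub]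
        refine mul_nonpos_of_nonneg_of_nonpos hm0 (neg_nonpos.2 ?_)
        split_ifs
        exacts [le_rfl, hp]
    refine le_trans ?_ (Finset.sum_le_sum fun v _ => hterm v)
    rw [← Finset.mul_sum, Finset.sum_sub_distrib]
    refine mul_le_mul_of_nonneg_left ?_ (by positivity)
    linarith

end Transcript

/-! ### Deviations of the answers -/

section Deviation

variable {X : Type*} [MeasurableSpace X] {t : ℕ}

/-- Since the mean lies in `[-1,1]` and the answer errs by more than `ζ ≥ δ + h`, the tail threshold
falls strictly inside the truncation bound on the side of the mean. Hence a truncated value in the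
tail comes from a value of `φ` in the same tail. -/
theorem farAnswer_of_tail {P : Measure X} {φ : (Fin t → X) → ℝ} {μ v h δ ζ : ℝ}
    (hμ : μ ∈ Set.Icc (-1 : ℝ) 1) (hδ : 0 ≤ δ) (hζ : δ + h ≤ ζ) (hv : ζ < |v - μ|)
    (htail : iidLaw P t {z | |v - μ| - ζ ≤ |φ z - μ|} ≤ 1 / 4) : FarAnswer P h δ φ v := by
  rcases le_total 0 (v - μ) with hs | hs
  · left
    refine (measure_mono fun z hz => ?_).trans htail
    rw [abs_of_nonneg hs] at hv
    simp only [Set.mem_ofPred_eq, clampUnit_eq] at hz ⊢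
    have h1 : -1 < v - h := by linarith [hμ.1]
    rw [le_max_iff] at hz
    have h2 : v - h ≤ φ z := by
      rcases hz with hz | hz
      · linarith
      · exact hz.trans (min_le_right _ _)
    rw [abs_of_nonneg hs]
    exact le_trans (by linarith) (le_abs_self _)
  · right
    refine (measure_mono fun z hz => ?_).trans htail
    rw [abs_of_nonpos hs] at hv
    simp only [Set.mem_ofPred_eq, clampUnit_eq] at hz ⊢
    have h1 : v + δ + h < 1 := by linarith [hμ.2]
    rw [max_le_iff, min_le_iff] at hz
    have h2 : φ z ≤ v + δ + h := by
      rcases hz.2 with hz | hz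
      · linarith
      · exact hz
    rw [abs_of_nonpos hs]
    exact le_trans (by linarith) (neg_le_abs _)

theorem meanAbsDev_nonneg {Z : Type*} [MeasurableSpace Z] (f : Z → ℝ) (μ : Measure Z) :
    0 ≤ meanAbsDev f μ := integral_nonneg fun _ => abs_nonneg _

/-- Markov's inequality; the strict bound on `T` keeps it positive even when the deviation vanishes.
-/
theorem measure_abs_sub_ge_le_of_meanAbsDev {Z : Type*} [MeasurableSpace Z] {Q : Measure Z}
    [IsProbabilityMeasure Q] {f : Z → ℝ} (hf : Integrable f Q) {T : ℝ}
    (hT : 4 * meanAbsDev f Q < T) : Q {z | T ≤ |f z - ∫ y, f y ∂Q|} ≤ 1 / 4 := by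
  have hT0 : 0 < T := lt_of_le_of_lt (by linarith [meanAbsDev_nonneg f Q]) hT
  have hmarkov := mul_meas_ge_le_integral_of_nonneg
    (Filter.Eventually.of_forall fun z => abs_nonneg (f z - ∫ y, f y ∂Q))
    (hf.sub (integrable_const (∫ y, f y ∂Q))).abs T
  have hreal : Q.real {z | T ≤ |f z - ∫ y, f y ∂Q|} ≤ 1 / 4 := by
    have : T * Q.real {z | T ≤ |f z - ∫ y, f y ∂Q|} ≤ meanAbsDev f Q := hmarkov
    by_contra hcon
    push Not at hcon
    nlinarith
  rw [← ENNReal.ofReal_toReal (measure_ne_top Q _)]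
  exact (ENNReal.ofReal_le_ofReal hreal).trans (by
    rw [ENNReal.ofReal_div_of_pos (by norm_num)]; simp)

/-- Chebyshev's inequality: the factor `2` becomes `1/4` after squaring. -/
theorem measure_abs_sub_ge_le_of_stdDev {Z : Type*} [MeasurableSpace Z] {Q : Measure Z}
    [IsProbabilityMeasure Q] {f : Z → ℝ} (hf : MemLp f 2 Q) {T : ℝ}
    (hT : 2 * stdDev f Q < T) : Q {z | T ≤ |f z - ∫ y, f y ∂Q|} ≤ 1 / 4 := by
  have hsd : 0 ≤ stdDev f Q := Real.sqrt_nonneg _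
  have hT0 : 0 < T := by linarith
  refine (meas_ge_le_variance_div_sq hf hT0).trans ?_
  have hvar : variance f Q = stdDev f Q ^ 2 := (Real.sq_sqrt (variance_nonneg f Q)).symm
  have : variance f Q / T ^ 2 ≤ 1 / 4 := by
    rw [div_le_div_iff₀ (by positivity) (by norm_num), hvar]
    nlinarith
  exact (ENNReal.ofReal_le_ofReal this).trans (by
    rw [ENNReal.ofReal_div_of_pos (by norm_num)]; simp)

theorem farAnswer_of_madClass {P : Measure X} [IsProbabilityMeasure P] {φ : (Fin t → X) → ℝ}
    (hφ : φ ∈ madClass P t) {v h δ ζ : ℝ} (hδ : 0 ≤ δ) (hζ : δ + h ≤ ζ)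
    (hv : ¬ |v - ∫ z, φ z ∂(iidLaw P t)| ≤ 4 * meanAbsDev φ (iidLaw P t) + ζ) :
    FarAnswer P h δ φ v := by
  rw [not_le] at hv
  exact farAnswer_of_tail hφ.2.1 hδ hζ (by linarith [meanAbsDev_nonneg φ (iidLaw P t)])
    (measure_abs_sub_ge_le_of_meanAbsDev hφ.1 (by linarith))

theorem farAnswer_of_sdClass {P : Measure X} [IsProbabilityMeasure P] {φ : (Fin t → X) → ℝ}
    (hφ : φ ∈ sdClass P t) {v h δ ζ : ℝ} (hδ : 0 ≤ δ) (hζ : δ + h ≤ ζ)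
    (hv : ¬ |v - ∫ z, φ z ∂(iidLaw P t)| ≤ 2 * stdDev φ (iidLaw P t) + ζ) :
    FarAnswer P h δ φ v := by
  rw [not_le] at hv
  have hsd : 0 ≤ stdDev φ (iidLaw P t) := Real.sqrt_nonneg _
  exact farAnswer_of_tail hφ.2.1 hδ hζ (by linarith)
    (measure_abs_sub_ge_le_of_stdDev hφ.1 (by linarith))

end Deviation

/-! ### The interaction with the program -/

section Interaction

open MedianProgram

variable {X : Type*} [MeasurableSpace X] {Ω : Type*} [MeasurableSpace Ω] {p : Params} {D : ℕ}

/-- The queries of the analyst as functions of the cells selected so far. -/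
noncomputable def cellQuery (A : Analyst X p.t Ω) (D : ℕ) (ω : Ω) (l : List (Fin (2 ^ D))) :
    (Fin p.t → X) → ℝ :=
  A.query ω (l.map fun g : Fin (2 ^ D) => gridPoint D g)

/-- The event that the transcript of cells is `v`. -/
def TranscriptIs (A : Analyst X p.t Ω) (v : Fin p.k → Fin (2 ^ D))
    (x : (Fin p.n → X) × (Fin p.k → ℕ → unitInterval) × Ω) : Prop :=
  ∀ j, selectCell (rate p) (p.ζ / 2) (p.n / p.t) D
    (queryValues x.1 (cellQuery A D x.2.2 (historyOf v j))) (x.2.1 j 0) = v j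

/-- Some answer of the transcript `v` is far in the tail of the distribution of its query. -/
def HasFarAnswer (P : Measure X) (A : Analyst X p.t Ω) (v : Fin p.k → Fin (2 ^ D)) (ω : Ω) : Prop :=
  ∃ j, FarAnswer P (p.ζ / 2) (2 / 2 ^ D) (cellQuery A D ω (historyOf v j)) (gridPoint D (v j))

theorem measurable_cellQuery (A : Analyst X p.t Ω) (l : List (Fin (2 ^ D))) :
    Measurable fun q : Ω × (Fin p.t → X) => cellQuery A D q.1 l q.2 :=
  A.measurable_query _

theorem measurableSet_hasFarAnswer (P : Measure X) [IsProbabilityMeasure P]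
    (A : Analyst X p.t Ω) (v : Fin p.k → Fin (2 ^ D)) :
    MeasurableSet {ω | HasFarAnswer P A v ω} := by
  have hcl : ∀ j, Measurable fun q : Ω × (Fin p.t → X) =>
      clampUnit (cellQuery A D q.1 (historyOf v j) q.2) := fun j =>
    measurable_clampUnit.comp (measurable_cellQuery A _)
  simp only [HasFarAnswer, FarAnswer, Set.ofPred_exists, Set.ofPred_or]
  refine MeasurableSet.iUnion fun j => MeasurableSet.union ?_ ?_
  · exact measurableSet_le (measurable_measure_prodMk_left
      (measurableSet_le measurable_const (hcl j))) measurable_const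
  · exact measurableSet_le (measurable_measure_prodMk_left
      (measurableSet_le (hcl j) measurable_const)) measurable_const

theorem measurableSet_transcriptIs (ht : 0 < p.t) (A : Analyst X p.t Ω)
    (v : Fin p.k → Fin (2 ^ D)) : MeasurableSet {x | TranscriptIs A v x} := by
  simp only [TranscriptIs, Set.ofPred_forall]
  refine MeasurableSet.iInter fun j => ?_
  have h1 : Measurable fun x : (Fin p.n → X) × (Fin p.k → ℕ → unitInterval) × Ω =>
      queryValues x.1 (cellQuery A D x.2.2 (historyOf v j)) :=
    measurable_queryValues ht measurable_fst ((measurable_cellQuery A (historyOf v j)).comp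
      ((measurable_snd.comp (measurable_snd.comp measurable_fst)).prodMk measurable_snd))
  have h2 : Measurable fun x : (Fin p.n → X) × (Fin p.k → ℕ → unitInterval) × Ω =>
      ((x.2.1 j 0 : unitInterval) : ℝ) := by fun_prop
  have h3 := (measurable_selectCell (rate p) (p.ζ / 2) (p.n / p.t) D).comp (h1.prodMk h2)
  exact h3 (measurableSet_singleton ((v j : ℕ)))

/-- Once `v` is prescribed, all queries are determined, so the event is a product set in the
independent random numbers of the rounds. Only the first draw of each round matters. -/
theorem measure_transcriptIs (hζ : 0 < p.ζ) (A : Analyst X p.t Ω) (v : Fin p.k → Fin (2 ^ D))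
    (s : Fin p.n → X) (ω : Ω) :
    (Measure.pi fun _ : Fin p.k => Measure.infinitePi fun _ : ℕ => (volume : Measure unitInterval))
        {u | TranscriptIs A v (s, u, ω)}
      = ENNReal.ofReal (treeProd (stepProb (rate p) (p.ζ / 2) D (cellQuery A D ω) s) v) := by
  have hset : {u : Fin p.k → ℕ → unitInterval | TranscriptIs A v (s, u, ω)}
      = Set.univ.pi fun j => (fun r : ℕ → unitInterval => r 0) ⁻¹' {w : unitInterval |
        selectCell (rate p) (p.ζ / 2) (p.n / p.t) D
          (queryValues s (cellQuery A D ω (historyOf v j))) w = v j} := by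
    ext u
    simp [TranscriptIs]
  have hmeas : ∀ (y : ℕ → ℝ) (g : ℕ), MeasurableSet {w : unitInterval |
      selectCell (rate p) (p.ζ / 2) (p.n / p.t) D y w = g} := fun y g => by
    have h3 := (measurable_selectCell (rate p) (p.ζ / 2) (p.n / p.t) D).comp
      ((measurable_const (a := y)).prodMk measurable_subtype_coe (α := unitInterval))
    exact h3 (measurableSet_singleton g)
  have hy1 : ∀ (φ : (Fin p.t → X) → ℝ) i, -1 ≤ queryValues s φ i :=
    fun φ i => (queryValues_mem s φ i).1
  have hpos : ∀ l g, 0 ≤ stepProb (rate p) (p.ζ / 2) D (cellQuery A D ω) s l g := fun l g =>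
    (cellProb_pos (by positivity) (hy1 _) D _).le
  rw [hset, Measure.pi_pi, treeProd, ENNReal.ofReal_prod_of_nonneg fun j _ => hpos _ _]
  refine Finset.prod_congr rfl fun j _ => ?_
  rw [(measurePreserving_eval_infinitePi (fun _ : ℕ => (volume : Measure unitInterval)) 0
    ).measure_preimage (hmeas _ _).nullMeasurableSet,
    volume_selectCell (by positivity) (hy1 _) (v j).isLt]
  rfl

open Classical in
/-- The conditional probability, given the sample and the randomness of the analyst, that some
answer is far. -/
noncomputable def farProb (P : Measure X) (A : Analyst X p.t Ω) (D : ℕ) (ω : Ω)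
    (s : Fin p.n → X) : ℝ :=
  ∑ v : Fin p.k → Fin (2 ^ D),
    treeProd (stepProb (rate p) (p.ζ / 2) D (cellQuery A D ω) s) v *
      if HasFarAnswer P A v ω then 1 else 0

theorem stepProb_nonneg (hζ : 0 < p.ζ) (A : Analyst X p.t Ω) (ω : Ω) (s : Fin p.n → X)
    (l : List (Fin (2 ^ D))) (g : Fin (2 ^ D)) :
    0 ≤ stepProb (rate p) (p.ζ / 2) D (cellQuery A D ω) s l g :=
  (cellProb_pos (by positivity) (fun i => (queryValues_mem s _ i).1) D _).le

open Classical in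
theorem farProb_term_nonneg (hζ : 0 < p.ζ) (P : Measure X) (A : Analyst X p.t Ω) (ω : Ω)
    (s : Fin p.n → X) (v : Fin p.k → Fin (2 ^ D)) :
    0 ≤ treeProd (stepProb (rate p) (p.ζ / 2) D (cellQuery A D ω) s) v *
      if HasFarAnswer P A v ω then 1 else 0 := by
  refine mul_nonneg (treeProd_nonneg (stepProb_nonneg hζ A ω s) v) ?_
  split_ifs <;> norm_num

theorem farProb_mem (hζ : 0 < p.ζ) (P : Measure X) (A : Analyst X p.t Ω) (ω : Ω)
    (s : Fin p.n → X) : farProb P A D ω s ∈ Set.Icc (0 : ℝ) 1 := by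
  classical
  refine ⟨Finset.sum_nonneg fun v _ => farProb_term_nonneg hζ P A ω s v, ?_⟩
  rw [← sum_treeProd_eq_one (stepProb_nonneg hζ A ω s)
    (fun l => sum_cellProb (by positivity) (fun i => (queryValues_mem s _ i).1) D) p.k]
  refine Finset.sum_le_sum fun v _ =>
    mul_le_of_le_one_right (treeProd_nonneg (stepProb_nonneg hζ A ω s) v) ?_
  split_ifs <;> norm_num

theorem measurable_farProb (ht : 0 < p.t) (P : Measure X) [IsProbabilityMeasure P]
    (A : Analyst X p.t Ω) (D : ℕ) :
    Measurable fun q : (Fin p.n → X) × Ω => farProb P A D q.2 q.1 := by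
  classical
  refine Finset.measurable_sum _ fun v _ => Measurable.mul ?_ ?_
  · refine Finset.measurable_prod _ fun j _ => ?_
    have h1 : Measurable fun q : (Fin p.n → X) × Ω =>
        queryValues q.1 (cellQuery A D q.2 (historyOf v j)) :=
      measurable_queryValues ht measurable_fst ((measurable_cellQuery A (historyOf v j)).comp
        ((measurable_snd.comp measurable_fst).prodMk measurable_snd))
    exact Measurable.comp
      (g := fun y : ℕ → ℝ => cellProb (rate p) (p.ζ / 2) (p.n / p.t) D y (v j))
      (measurable_cellProb _ _ _ _ _) h1
  · exact (Measurable.ite (measurableSet_hasFarAnswer P A v) measurable_const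
      measurable_const).comp measurable_snd

theorem measure_section_le (hζ : 0 < p.ζ) (P : Measure X) (A : Analyst X p.t Ω)
    (s : Fin p.n → X) (ω : Ω) :
    (Measure.pi fun _ : Fin p.k => Measure.infinitePi fun _ : ℕ => (volume : Measure unitInterval))
        {u | ∃ v : Fin p.k → Fin (2 ^ D), HasFarAnswer P A v ω ∧ TranscriptIs A v (s, u, ω)}
      ≤ ENNReal.ofReal (farProb P A D ω s) := by
  classical
  rw [Set.ofPred_exists]
  refine (measure_iUnion_le _).trans ?_
  rw [tsum_fintype, farProb,
    ENNReal.ofReal_sum_of_nonneg fun v _ => farProb_term_nonneg hζ P A ω s v]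
  refine Finset.sum_le_sum fun v _ => ?_
  by_cases hv : HasFarAnswer P A v ω
  · simp only [hv, true_and, if_true, mul_one]
    exact (measure_transcriptIs hζ A v s ω).le
  · simp [hv]

theorem measurableSet_exists_hasFarAnswer (ht : 0 < p.t) (P : Measure X) [IsProbabilityMeasure P]
    (A : Analyst X p.t Ω) (D : ℕ) :
    MeasurableSet {x : (Fin p.n → X) × (Fin p.k → ℕ → unitInterval) × Ω |
      ∃ v : Fin p.k → Fin (2 ^ D), HasFarAnswer P A v x.2.2 ∧ TranscriptIs A v x} := by
  rw [Set.ofPred_exists]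
  exact MeasurableSet.iUnion fun v => MeasurableSet.inter
    ((measurableSet_hasFarAnswer P A v).preimage (measurable_snd.comp measurable_snd))
    (measurableSet_transcriptIs ht A v)

/-- A far answer is rarely given in the interaction. -/
theorem interactMeasure_hasFarAnswer_le (P : Measure X) [IsProbabilityMeasure P]
    (ν : Measure Ω) [IsProbabilityMeasure ν] (A : Analyst X p.t Ω) (ht : 0 < p.t)
    (hη : 0 < rate p) (hζ : 0 < p.ζ) (hζ1 : p.ζ < 1) (hm : 8 ≤ p.n / p.t)
    (a : ℕ) {θ b : ℝ} (hθ : Real.exp θ ≤ 5 / 4)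
    (hb : 2 * Real.exp (-(rate p * ((p.n / p.t : ℕ) / 8))) / (p.ζ / 2) ≤ b) (hb1 : b ≤ 1) :
    interactMeasure p P ν {x | ∃ v : Fin p.k → Fin (2 ^ D), HasFarAnswer P A v x.2.2 ∧
        TranscriptIs A v x}
      ≤ ENNReal.ofReal (16 * Real.exp (-(a * θ) + p.k * (((a + 1) * (8 * rate p)) ^ 2 / 2))
        + 6 * (p.k * b)) := by
  set c := 16 * Real.exp (-(a * θ) + p.k * (((a + 1) * (8 * rate p)) ^ 2 / 2)) + 6 * (p.k * b)
  have hGm := measurable_farProb ht P A D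
  -- For fixed internal randomness the analyst is deterministic; the bound is uniform in `ω` and is
  -- integrated at the end.
  have hω : ∀ ω, ∫⁻ s, ENNReal.ofReal (farProb P A D ω s) ∂(Measure.pi fun _ : Fin p.n => P)
      ≤ ENNReal.ofReal c := by
    intro ω
    have hGω : Measurable fun s => farProb P A D ω s := by
      have hmk : Measurable fun s : Fin p.n → X => (s, ω) := measurable_prodMk_right
      have h := hGm.comp hmk
      simpa only [Function.comp_def] using h
    rw [← ofReal_integral_eq_lintegral_ofReal (integrable_of_mem_unit hGω (farProb_mem hζ P A ω))
      (Filter.Eventually.of_forall fun s => (farProb_mem hζ P A ω s).1)]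
    have hquery : ∀ l, Measurable (cellQuery A D ω l) := fun l =>
      (measurable_cellQuery A l).comp (measurable_prodMk_left (x := ω))
    refine ENNReal.ofReal_le_ofReal (le_trans (le_of_eq ?_) (integral_sum_farAnswer_le (k := p.k)
      P ht hη (by positivity) (by linarith) hm (cellQuery A D ω) hquery a hθ hb hb1))
    refine integral_congr_ae (Filter.Eventually.of_forall fun s => ?_)
    refine Finset.sum_congr rfl fun v _ => congrArg _ ?_
    by_cases hv : HasFarAnswer P A v ω
    · exact (if_pos hv).trans (if_pos hv).symm
    · exact (if_neg hv).trans (if_neg hv).symm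
  have hmeas := measurableSet_exists_hasFarAnswer ht P A D
  rw [interactMeasure, Measure.prod_apply hmeas]
  calc _ ≤ ∫⁻ s, ∫⁻ ω, ENNReal.ofReal (farProb P A D ω s) ∂ν
          ∂(Measure.pi fun _ : Fin p.n => P) := by
        refine lintegral_mono fun s => ?_
        rw [Measure.prod_apply_symm (hmeas.preimage measurable_prodMk_left)]
        exact lintegral_mono fun ω => measure_section_le hζ P A s ω
    _ = ∫⁻ ω, ∫⁻ s, ENNReal.ofReal (farProb P A D ω s) ∂(Measure.pi fun _ : Fin p.n => P) ∂ν :=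
        lintegral_lintegral_swap (ENNReal.measurable_ofReal.comp hGm).aemeasurable
    _ ≤ ∫⁻ _, ENNReal.ofReal c ∂ν := lintegral_mono hω
    _ = ENNReal.ofReal c := by simp

/-- The link between the machine and the selection rule; the probabilistic argument uses no other
fact about the program when `ζ < 1`. -/
theorem answer_eq {X : Type*} {p : Params} (hζ : p.ζ < 1) (ht : 0 < p.t) {D : ℕ}
    (hD : 2 / 2 ^ D ≤ p.ζ / 2) (hD' : ∀ r < D, p.ζ / 2 < 2 / 2 ^ r)
    (s : Fin p.n → X) (φ : (Fin p.t → X) → ℝ) (r : ℕ → unitInterval) :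
    (∃ T ≤ (D + 1) * (p.n / p.t * (p.n / p.t * 30 + 200) + 30) + 150,
        main.HaltedAt p s φ r T) ∧
      main.answer p s φ r = gridPoint D
        (selectCell (rate p) (p.ζ / 2) (p.n / p.t) D (queryValues s φ) (r 0)) := by
  obtain ⟨σ, hrun, hσ⟩ := runs_main (ev := blockEval s φ) (u := r) hζ ht hD hD'
  obtain ⟨hhalt, hans⟩ := Program.halts_and_answer_of_runsWithin hrun
  refine ⟨hhalt, ?_⟩
  rw [hans, hσ, bisect_eq_gridPoint]
  rfl

/-- Every outcome has a transcript of cells, which determines the queries and the answers. -/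
theorem exists_transcriptIs (hζ : p.ζ < 1) (ht : 0 < p.t)
    (hD : 2 / 2 ^ D ≤ p.ζ / 2) (hD' : ∀ r < D, p.ζ / 2 < 2 / 2 ^ r) (A : Analyst X p.t Ω)
    (x : (Fin p.n → X) × (Fin p.k → ℕ → unitInterval) × Ω) :
    ∃ v : Fin p.k → Fin (2 ^ D), TranscriptIs A v x ∧ ∀ j,
      interactQuery main p A x.1 x.2.1 x.2.2 j = cellQuery A D x.2.2 (historyOf v j) ∧
        interactAnswer main p A x.1 x.2.1 x.2.2 j = gridPoint D (v j) := by
  let v : Fin p.k → Fin (2 ^ D) := fun j =>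
    ⟨selectCell (rate p) (p.ζ / 2) (p.n / p.t) D
      (queryValues x.1 (interactQuery main p A x.1 x.2.1 x.2.2 j)) (x.2.1 j 0),
      bisectIdx_lt _ _ _⟩
  have hans : ∀ j, interactAnswer main p A x.1 x.2.1 x.2.2 j = gridPoint D (v j) := fun j => by
    rw [interactAnswer]
    exact (answer_eq hζ ht hD hD' _ _ _).2
  have hquery : ∀ j, interactQuery main p A x.1 x.2.1 x.2.2 j
      = cellQuery A D x.2.2 (historyOf v j) := fun j => by
    rw [interactQuery, cellQuery, historyOf, List.map_ofFn]
    congr 2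
    funext i
    exact hans _
  refine ⟨v, fun j => ?_, fun j => ⟨hquery j, hans j⟩⟩
  rw [← hquery]

end Interaction

/-! ### The choice of the constants -/

section Constants

open MedianProgram

variable {p : Params}

theorem half_le_log_two : (1 / 2 : ℝ) ≤ Real.log 2 := by
  have := Real.log_two_gt_d9
  linarith

theorem half_le_log_one_div (hβ : 0 < p.β) :
    1 / 2 ≤ Real.log (1 / min p.β (1 / 2)) := by
  have hb : 0 < min p.β (1 / 2) := lt_min hβ (by norm_num)
  refine half_le_log_two.trans (Real.log_le_log (by norm_num) ?_)
  rw [le_div_iff₀ hb]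
  linarith [min_le_right p.β (1 / 2)]

theorem ratio_le_half (hk : 0 < p.k) (hζ : 0 < p.ζ) (hζ1 : p.ζ < 1) :
    p.ζ * min p.β (1 / 2) / p.k ≤ 1 / 2 := by
  have hk' : (1 : ℝ) ≤ p.k := by exact_mod_cast hk
  rw [div_le_div_iff₀ (by linarith) (by norm_num)]
  nlinarith [mul_le_mul_of_nonneg_left (min_le_right p.β (1 / 2)) hζ.le]

theorem log_one_div_le_log_ratio (hk : 0 < p.k) (hζ : 0 < p.ζ) (hβ : 0 < p.β) :
    Real.log (1 / p.ζ) ≤ Real.log (p.k / (p.ζ * min p.β (1 / 2))) := by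
  have hk' : (1 : ℝ) ≤ p.k := by exact_mod_cast hk
  have hb : 0 < min p.β (1 / 2) := lt_min hβ (by norm_num)
  refine Real.log_le_log (by positivity) ?_
  rw [div_le_div_iff₀ hζ (by positivity)]
  nlinarith [mul_le_mul_of_nonneg_left (min_le_right p.β (1 / 2)) hζ.le]

theorem half_le_log_ratio (hk : 0 < p.k) (hζ : 0 < p.ζ) (hζ1 : p.ζ < 1) (hβ : 0 < p.β) :
    1 / 2 ≤ Real.log (p.k / (p.ζ * min p.β (1 / 2))) := by
  have hk' : (0 : ℝ) < p.k := by exact_mod_cast hk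
  have hb : 0 < min p.β (1 / 2) := lt_min hβ (by norm_num)
  refine half_le_log_two.trans (Real.log_le_log (by norm_num) ?_)
  have := ratio_le_half (p := p) hk hζ hζ1
  rw [div_le_iff₀ hk'] at this
  rw [le_div_iff₀ (by positivity)]
  linarith

theorem half_le_sqrt (hk : 0 < p.k) (hβ : 0 < p.β) :
    1 / 2 ≤ Real.sqrt (p.k * Real.log (1 / min p.β (1 / 2))) := by
  have hk' : (1 : ℝ) ≤ p.k := by exact_mod_cast hk
  refine Real.le_sqrt_of_sq_le ?_
  nlinarith [half_le_log_one_div hβ]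

/-- The consequences of the lower bound on the size of the sample that the proof uses. -/
theorem sample_bounds (ht : 0 < p.t) (hk : 0 < p.k) (hζ : 0 < p.ζ) (hζ1 : p.ζ < 1) (hβ : 0 < p.β)
    (hn : 100000 * p.sampleRate ≤ p.n) :
    8 ≤ p.n / p.t ∧ Real.log (1 / p.ζ) ≤ p.n ∧ 0 < rate p ∧
      p.k * Real.log (1 / min p.β (1 / 2)) * (8 * rate p) ^ 2 ≤ 1 / 9000 := by
  have ht' : (1 : ℝ) ≤ p.t := by exact_mod_cast ht
  have hk' : (1 : ℝ) ≤ p.k := by exact_mod_cast hk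
  have hr : rate p = Real.log (p.k / (p.ζ * min p.β (1 / 2))) * p.t / p.n * 128 := rfl
  have hlζ := log_one_div_le_log_ratio hk hζ hβ
  have hL := half_le_log_ratio hk hζ hζ1 hβ
  have hl := half_le_log_one_div hβ
  have hs := half_le_sqrt hk hβ
  rw [Params.sampleRate] at hn
  have hsq : Real.sqrt (p.k * Real.log (1 / min p.β (1 / 2))) ^ 2
      = p.k * Real.log (1 / min p.β (1 / 2)) := Real.sq_sqrt (by positivity)
  set L := Real.log (p.k / (p.ζ * min p.β (1 / 2)))
  set S := Real.sqrt (p.k * Real.log (1 / min p.β (1 / 2)))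
  have hL0 : 0 < L := by linarith
  have hS0 : 0 < S := by linarith
  have htL : 0 < p.t * L := by positivity
  have hnS : 100000 * S * (p.t * L) ≤ p.n := by linarith
  have hn1 : 50000 * (p.t * L) ≤ p.n := by nlinarith
  have hn0 : (0 : ℝ) < p.n := by linarith
  refine ⟨?_, ?_, ?_, ?_⟩
  · rw [Nat.le_div_iff_mul_le ht]
    have : (8 * p.t : ℝ) ≤ p.n := by nlinarith
    exact_mod_cast this
  · nlinarith
  · rw [hr]; positivity
  · rw [← hsq, ← mul_pow, hr]
    -- Here `1024 = 8 * 128` comes from the stability exponent and the rate, and `100000` is the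
    -- sample constant.
    have h1 : S * (8 * (L * p.t / p.n * 128)) ≤ 1024 / 100000 := by
      rw [show S * (8 * (L * p.t / p.n * 128)) = 1024 * (S * (p.t * L)) / p.n by ring,
        div_le_div_iff₀ hn0 (by norm_num)]
      linarith
    have h0 : 0 ≤ S * (8 * (L * p.t / p.n * 128)) := by positivity
    calc _ ≤ (1024 / 100000 : ℝ) ^ 2 := pow_le_pow_left₀ h0 h1 2
      _ ≤ 1 / 9000 := by norm_num

/-- At least half of the sample is covered by full blocks, so the exponent is at least `8 L`. The
exponential is then at most the eighth power of `ρ = ζ β' / k ≤ 1/2`: one factor cancels `ζ` and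
`k`, the other seven pay for the constants. -/
theorem inaccuracy_bound (ht : 0 < p.t) (hk : 0 < p.k) (hζ : 0 < p.ζ) (hζ1 : p.ζ < 1)
    (hβ : 0 < p.β) (hm : 8 ≤ p.n / p.t) :
    2 * Real.exp (-(rate p * ((p.n / p.t : ℕ) / 8))) / (p.ζ / 2) ≤
      min p.β (1 / 2) / (32 * p.k) := by
  have hk' : (0 : ℝ) < p.k := by exact_mod_cast hk
  have ht' : (0 : ℝ) < p.t := by exact_mod_cast ht
  have hb : 0 < min p.β (1 / 2) := lt_min hβ (by norm_num)
  have hr : rate p = Real.log (p.k / (p.ζ * min p.β (1 / 2))) * p.t / p.n * 128 := rfl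
  have hL := half_le_log_ratio hk hζ hζ1 hβ
  have hρ := ratio_le_half (p := p) hk hζ hζ1
  have hLρ : Real.log (p.k / (p.ζ * min p.β (1 / 2)))
      = -Real.log (p.ζ * min p.β (1 / 2) / p.k) := by
    rw [← Real.log_inv, inv_div]
  set b := min p.β (1 / 2)
  set ρ := p.ζ * b / p.k with hρdef
  have hρ0 : 0 < ρ := by positivity
  set L := Real.log (p.k / (p.ζ * b))
  have hnm : (p.n : ℝ) ≤ 2 * (p.t * (p.n / p.t : ℕ)) := by
    have h1 := Nat.div_add_mod p.n p.t
    have h2 := Nat.mod_lt p.n ht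
    have h3 := Nat.mul_le_mul_left p.t hm
    have : p.n ≤ 2 * (p.t * (p.n / p.t)) := by omega
    exact_mod_cast this
  have hn0 : (0 : ℝ) < p.n := by
    have : 0 < p.n := Nat.pos_of_ne_zero fun h => by simp [h] at hm
    exact_mod_cast this
  have hexp : 8 * L ≤ rate p * ((p.n / p.t : ℕ) / 8) := by
    rw [hr, show L * p.t / p.n * 128 * ((p.n / p.t : ℕ) / 8)
      = L * (16 * (p.t * (p.n / p.t : ℕ))) / p.n by ring, le_div_iff₀ hn0]
    nlinarith
  have hle : Real.exp (-(rate p * ((p.n / p.t : ℕ) / 8))) ≤ ρ ^ 8 := by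
    rw [← Real.exp_log hρ0, ← Real.exp_nat_mul, Real.exp_le_exp]
    push_cast
    linarith
  have hρ7 : ρ ^ 7 ≤ (1 / 2) ^ 7 := pow_le_pow_left₀ hρ0.le hρ 7
  calc 2 * Real.exp (-(rate p * ((p.n / p.t : ℕ) / 8))) / (p.ζ / 2)
      ≤ 2 * ρ ^ 8 / (p.ζ / 2) := by gcongr
    _ = 4 * (b / p.k) * ρ ^ 7 := by
        rw [show ρ ^ 8 = ρ * ρ ^ 7 by ring]
        nth_rewrite 1 [hρdef]
        field_simp
        norm_num
    _ ≤ 4 * (b / p.k) * (1 / 2) ^ 7 := by gcongr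
    _ = b / (32 * p.k) := by field_simp; norm_num

theorem instability_bound (hβ : 0 < p.β)
    (hrate : p.k * Real.log (1 / min p.β (1 / 2)) * (8 * rate p) ^ 2 ≤ 1 / 9000) :
    ∃ a : ℕ, Real.exp (-(a * (1 / 5)) + p.k * (((a + 1) * (8 * rate p)) ^ 2 / 2))
      ≤ min p.β (1 / 2) / 128 := by
  have hl := half_le_log_one_div hβ
  have hb : 0 < min p.β (1 / 2) := lt_min hβ (by norm_num)
  have hb2 : min p.β (1 / 2) ≤ 1 / 2 := min_le_right _ _
  have hlb : Real.log (1 / min p.β (1 / 2)) = -Real.log (min p.β (1 / 2)) := by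
    rw [one_div, Real.log_inv]
  set b := min p.β (1 / 2)
  set l := Real.log (1 / b)
  -- With `θ = 1/5` this gives `a θ ≥ 9 l`. The quadratic term costs at most `l`, since `a + 1 ≤ 49
  -- l` by `l ≥ 1/2`, and `exp (-8 l) = b ^ 8` is left.
  refine ⟨⌈45 * l⌉₊, ?_⟩
  have h1 : 45 * l ≤ (⌈45 * l⌉₊ : ℝ) := Nat.le_ceil _
  have h2 : (⌈45 * l⌉₊ : ℝ) < 45 * l + 1 := Nat.ceil_lt_add_one (by linarith)
  set a := (⌈45 * l⌉₊ : ℝ)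
  have h3 : (a + 1) ^ 2 ≤ (49 * l) ^ 2 := pow_le_pow_left₀ (by linarith) (by linarith) 2
  have h4 : p.k * (((a + 1) * (8 * rate p)) ^ 2 / 2) ≤ l := by
    have h5 : (0 : ℝ) ≤ p.k * (8 * rate p) ^ 2 := by positivity
    calc p.k * (((a + 1) * (8 * rate p)) ^ 2 / 2)
        = (a + 1) ^ 2 * (p.k * (8 * rate p) ^ 2) / 2 := by ring
      _ ≤ (49 * l) ^ 2 * (p.k * (8 * rate p) ^ 2) / 2 := by gcongr
      _ = 49 ^ 2 / 2 * l * (p.k * l * (8 * rate p) ^ 2) := by ring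
      _ ≤ 49 ^ 2 / 2 * l * (1 / 9000) := by gcongr
      _ ≤ l := by linarith
  calc Real.exp (-(a * (1 / 5)) + p.k * (((a + 1) * (8 * rate p)) ^ 2 / 2))
      ≤ Real.exp (8 * Real.log b) := by
        rw [Real.exp_le_exp]
        linarith
    _ = b ^ 8 := by
        rw [show (8 : ℝ) = (8 : ℕ) by norm_num, Real.exp_nat_mul, Real.exp_log hb]
    _ = b * b ^ 7 := by ring
    _ ≤ b * (1 / 2) ^ 7 := by
        have := pow_le_pow_left₀ hb.le hb2 7
        gcongr
    _ = b / 128 := by ring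

theorem exp_one_fifth_le : Real.exp (1 / 5) ≤ 5 / 4 := by
  have h := Real.one_sub_le_exp_neg (1 / 5)
  rw [Real.exp_neg] at h
  have hpos := Real.exp_pos (1 / 5)
  rw [le_inv_comm₀ (by norm_num) hpos] at h
  linarith

/-- The number of rounds of bisection. -/
theorem exists_rounds (hζ : 0 < p.ζ) (hζ1 : p.ζ < 1) (hn : Real.log (1 / p.ζ) ≤ p.n) :
    ∃ D : ℕ, 2 / 2 ^ D ≤ p.ζ / 2 ∧ (∀ r < D, p.ζ / 2 < 2 / 2 ^ r) ∧ D ≤ 2 * p.n + 5 := by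
  classical
  have hex : ∃ D : ℕ, (2 : ℝ) / 2 ^ D ≤ p.ζ / 2 := by
    obtain ⟨D, hD⟩ := pow_unbounded_of_one_lt (4 / p.ζ) (one_lt_two (α := ℝ))
    refine ⟨D, ?_⟩
    rw [div_lt_iff₀ hζ] at hD
    rw [div_le_div_iff₀ (by positivity) (by norm_num)]
    linarith
  refine ⟨Nat.find hex, Nat.find_spec hex, fun r hr => not_le.1 (Nat.find_min hex hr), ?_⟩
  set D := Nat.find hex with hDdef
  rcases Nat.eq_zero_or_pos D with h0 | hpos
  · omega
  · have hlt : p.ζ / 2 < 2 / 2 ^ (D - 1) := not_le.1 (Nat.find_min hex (by omega))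
    -- By minimality of `D` the previous width still exceeds `ζ / 2`. Taking logarithms bounds `D`
    -- in terms of `log (1/ζ)`, hence of `n`.
    have hpow : (2 : ℝ) ^ (D - 1) ≤ 4 * (1 / p.ζ) := by
      rw [mul_one_div, le_div_iff₀ hζ]
      rw [div_lt_div_iff₀ (by norm_num) (by positivity)] at hlt
      linarith
    have hlog := Real.log_le_log (by positivity) hpow
    rw [Real.log_pow, Real.log_mul (by norm_num) (by positivity),
      show (4 : ℝ) = 2 ^ 2 by norm_num, Real.log_pow] at hlog
    have h2 := half_le_log_two
    have h3 : Real.log 2 ≤ 1 := by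
      have := Real.log_two_lt_d9
      linarith
    have h4 : ((D - 1 : ℕ) : ℝ) * (1 / 2) ≤ 2 + p.n := by
      have : ((D - 1 : ℕ) : ℝ) * (1 / 2) ≤ (D - 1 : ℕ) * Real.log 2 := by gcongr
      push_cast at hlog
      linarith
    have h5 : ((D - 1 : ℕ) : ℝ) ≤ 4 + 2 * p.n := by linarith
    have h6 : D - 1 ≤ 4 + 2 * p.n := by exact_mod_cast h5
    omega

theorem steps_le {n m D c : ℕ} (hm : m ≤ n) (hD : D ≤ 2 * n + 5) (hc : 1530 ≤ c) :
    (D + 1) * (m * (m * 30 + 200) + 30) + 150 ≤ c * (n + 1) ^ c := by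
  have h1 : m * (m * 30 + 200) + 30 ≤ 230 * (n + 1) ^ 2 := by nlinarith
  have h2 : D + 1 ≤ 6 * (n + 1) := by omega
  have h3 : (n + 1) ^ 3 ≤ (n + 1) ^ c := Nat.pow_le_pow_right (by omega) (by omega)
  have h4 : 1 ≤ (n + 1) ^ 3 := Nat.one_le_pow _ _ (by omega)
  calc (D + 1) * (m * (m * 30 + 200) + 30) + 150
      ≤ 6 * (n + 1) * (230 * (n + 1) ^ 2) + 150 := by gcongr
    _ = 1380 * (n + 1) ^ 3 + 150 := by ring
    _ ≤ 1530 * (n + 1) ^ 3 := by omega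
    _ ≤ c * (n + 1) ^ c := Nat.mul_le_mul hc h3

end Constants

/-! ### Assembly: failure probability, running time and range of the answers. -/

section Failure

open MedianProgram

variable {X : Type*} [MeasurableSpace X] {Ω : Type*} [MeasurableSpace Ω] {p : Params}

theorem gridPoint_mem {D g : ℕ} (hg : g < 2 ^ D) : gridPoint D g ∈ Set.Icc (-1 : ℝ) 1 :=
  ⟨neg_one_le_gridPoint D g, (gridPoint_last D) ▸ (gridPoint_strictMono D).monotone hg.le⟩

/-- If every wrong answer is far, then the failure probability is at most `β`. -/
theorem interactMeasure_failure_le (ht : 0 < p.t) (hk : 0 < p.k) (hζ : 0 < p.ζ) (hζ1 : p.ζ < 1)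
    (hβ : 0 < p.β) (hn : 100000 * p.sampleRate ≤ p.n) (P : Measure X) [IsProbabilityMeasure P]
    (ν : Measure Ω) [IsProbabilityMeasure ν] (A : Analyst X p.t Ω)
    (ok : ((Fin p.t → X) → ℝ) → ℝ → Prop)
    (hok : ∀ φ v δ, 0 ≤ δ → δ + p.ζ / 2 ≤ p.ζ → ¬ ok φ v → FarAnswer P (p.ζ / 2) δ φ v) :
    interactMeasure p P ν {x | ∀ j : Fin p.k, ok (interactQuery main p A x.1 x.2.1 x.2.2 j)
      (interactAnswer main p A x.1 x.2.1 x.2.2 j)}ᶜ ≤ ENNReal.ofReal p.β := by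
  obtain ⟨hm, hlog, hη, hrate⟩ := sample_bounds ht hk hζ hζ1 hβ hn
  obtain ⟨D, hD, hD', -⟩ := exists_rounds hζ hζ1 hlog
  obtain ⟨a, ha⟩ := instability_bound hβ hrate
  have hk' : (1 : ℝ) ≤ p.k := by exact_mod_cast hk
  have hb : 0 < min p.β (1 / 2) := lt_min hβ (by norm_num)
  have hb1 : min p.β (1 / 2) / (32 * p.k) ≤ 1 := by
    rw [div_le_one (by positivity)]
    linarith [min_le_right p.β (1 / 2)]
  -- The failure set, possibly not measurable, is contained in the measurable event that a far
  -- transcript occurs.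
  refine (measure_mono fun x hx => ?_).trans ((interactMeasure_hasFarAnswer_le (D := D) P ν A ht
    hη hζ hζ1 hm a exp_one_fifth_le (inaccuracy_bound ht hk hζ hζ1 hβ hm) hb1).trans
    (ENNReal.ofReal_le_ofReal ?_))
  · obtain ⟨v, hv, hqa⟩ := exists_transcriptIs hζ1 ht hD hD' A x
    rw [Set.mem_compl_iff, Set.mem_ofPred_eq, not_forall] at hx
    obtain ⟨j, hj⟩ := hx
    rw [(hqa j).1, (hqa j).2] at hj
    exact ⟨v, ⟨j, hok _ _ _ (by positivity) (by linarith) hj⟩, hv⟩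
  -- The two contributions are `16/128` and `6/32` of `min β (1/2)`, together less than `β`.
  · have h1 : (p.k : ℝ) * (min p.β (1 / 2) / (32 * p.k)) = min p.β (1 / 2) / 32 := by
      field_simp
    rw [h1]
    linarith [min_le_left p.β (1 / 2)]

theorem main_halts_and_answer_mem (ht : 0 < p.t) (hk : 0 < p.k) (hζ : 0 < p.ζ) (hβ : 0 < p.β)
    (hn : 100000 * p.sampleRate ≤ p.n) {c : ℕ} (hc : 1530 ≤ c) {X : Type*} (s : Fin p.n → X)
    (φ : (Fin p.t → X) → ℝ) (r : ℕ → unitInterval) :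
    (∃ T ≤ c * (p.n + 1) ^ c, main.HaltedAt p s φ r T) ∧
      main.answer p s φ r ∈ Set.Icc (-1 : ℝ) 1 := by
  rcases lt_or_ge p.ζ 1 with hζ1 | hζ1
  · obtain ⟨-, hlog, -, -⟩ := sample_bounds ht hk hζ hζ1 hβ hn
    obtain ⟨D, hD, hD', hDn⟩ := exists_rounds hζ hζ1 hlog
    obtain ⟨⟨T, hT, hhalt⟩, hans⟩ := answer_eq hζ1 ht hD hD' s φ r
    refine ⟨⟨T, hT.trans (steps_le (Nat.div_le_self _ _) hDn hc), hhalt⟩, ?_⟩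
    rw [hans]
    exact gridPoint_mem (bisectIdx_lt _ _ _)
  · obtain ⟨σ, hrun, hσ⟩ := runs_main_of_one_le (ev := blockEval s φ) (u := r) hζ1
    obtain ⟨⟨T, hT, hhalt⟩, hans⟩ := Program.halts_and_answer_of_runsWithin hrun
    refine ⟨⟨T, hT.trans ?_, hhalt⟩, by rw [hans, hσ]; norm_num⟩
    have : 1 ≤ (p.n + 1) ^ c := Nat.one_le_pow _ _ (by omega)
    nlinarith

theorem interactAnswer_of_one_le (hζ : 1 ≤ p.ζ) (A : Analyst X p.t Ω) (s : Fin p.n → X)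
    (u : Fin p.k → ℕ → unitInterval) (ω : Ω) (j : Fin p.k) :
    interactAnswer main p A s u ω j = 0 := by
  rw [interactAnswer]
  obtain ⟨σ, hrun, hσ⟩ := runs_main_of_one_le hζ
  rw [(Program.halts_and_answer_of_runsWithin hrun).2, hσ]

end Failure

/-- One program `M` and universal constants `C`, `c` serve all parameters, data universes,
distributions and analysts.  Each query is answered within `c (n+1)^c` steps by a number in
`[-1,1]`.  The failure events are bounded in outer measure, so that no measurability of the
events is presupposed. -/
theorem corollary4p4 :
    ∃ (M : Program) (C : ℝ) (c : ℕ), 0 < C ∧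
      ∀ p : Params, 0 < p.t → 0 < p.k → 0 < p.ζ → 0 < p.β → C * p.sampleRate ≤ p.n →
      ∀ (X : Type*) [MeasurableSpace X],
        (∀ (s : Fin p.n → X) (φ : (Fin p.t → X) → ℝ) (r : ℕ → unitInterval),
          (∃ T ≤ c * (p.n + 1) ^ c, M.HaltedAt p s φ r T) ∧
            M.answer p s φ r ∈ Set.Icc (-1 : ℝ) 1) ∧
        ∀ (P : Measure X) [IsProbabilityMeasure P] (Ω : Type*) [MeasurableSpace Ω]
          (ν : Measure Ω) [IsProbabilityMeasure ν] (A : Analyst X p.t Ω),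
          interactMeasure p P ν
              {x | ∀ j : Fin p.k,
                interactQuery M p A x.1 x.2.1 x.2.2 j ∈ madClass P p.t →
                |interactAnswer M p A x.1 x.2.1 x.2.2 j
                    - ∫ z, interactQuery M p A x.1 x.2.1 x.2.2 j z ∂(iidLaw P p.t)|
                  ≤ 4 * meanAbsDev (interactQuery M p A x.1 x.2.1 x.2.2 j) (iidLaw P p.t)
                    + p.ζ}ᶜ ≤ ENNReal.ofReal p.β ∧
          interactMeasure p P ν
              {x | ∀ j : Fin p.k,
                interactQuery M p A x.1 x.2.1 x.2.2 j ∈ sdClass P p.t →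
                |interactAnswer M p A x.1 x.2.1 x.2.2 j
                    - ∫ z, interactQuery M p A x.1 x.2.1 x.2.2 j z ∂(iidLaw P p.t)|
                  ≤ 2 * stdDev (interactQuery M p A x.1 x.2.1 x.2.2 j) (iidLaw P p.t)
                    + p.ζ}ᶜ ≤ ENNReal.ofReal p.β := by
  refine ⟨MedianProgram.main, 100000, 1530, by norm_num, ?_⟩
  intro p ht hk hζ hβ hn X _
  refine ⟨fun s φ r => main_halts_and_answer_mem ht hk hζ hβ hn le_rfl s φ r, ?_⟩
  intro P _ Ω _ ν _ A
  rcases lt_or_ge p.ζ 1 with hζ1 | hζ1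
  · constructor
    · refine interactMeasure_failure_le ht hk hζ hζ1 hβ hn P ν A (fun φ v => φ ∈ madClass P p.t →
        |v - ∫ z, φ z ∂(iidLaw P p.t)| ≤ 4 * meanAbsDev φ (iidLaw P p.t) + p.ζ) ?_
      intro φ v δ hδ hδζ hnot
      rw [Classical.not_imp] at hnot
      exact farAnswer_of_madClass hnot.1 hδ hδζ hnot.2
    · refine interactMeasure_failure_le ht hk hζ hζ1 hβ hn P ν A (fun φ v => φ ∈ sdClass P p.t →
        |v - ∫ z, φ z ∂(iidLaw P p.t)| ≤ 2 * stdDev φ (iidLaw P p.t) + p.ζ) ?_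
      intro φ v δ hδ hδζ hnot
      rw [Classical.not_imp] at hnot
      exact farAnswer_of_sdClass hnot.1 hδ hδζ hnot.2
  -- For `ζ ≥ 1` the answer `0` errs by at most one, so no outcome fails.
  · have hempty : ∀ S : Set ((Fin p.n → X) × (Fin p.k → ℕ → unitInterval) × Ω), (∀ x, x ∈ S) →
        interactMeasure p P ν Sᶜ ≤ ENNReal.ofReal p.β := fun S hS => by
      rw [Set.eq_univ_of_forall hS]
      simp
    constructor
    · refine hempty _ fun x j hφ => ?_
      rw [interactAnswer_of_one_le hζ1, zero_sub, abs_neg]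
      have := abs_le.2 hφ.2.1
      linarith [meanAbsDev_nonneg (interactQuery MedianProgram.main p A x.1 x.2.1 x.2.2 j)
        (iidLaw P p.t)]
    · refine hempty _ fun x j hφ => ?_
      rw [interactAnswer_of_one_le hζ1, zero_sub, abs_neg]
      have := abs_le.2 hφ.2.1
      have h0 : 0 ≤ stdDev (interactQuery MedianProgram.main p A x.1 x.2.1 x.2.2 j)
        (iidLaw P p.t) := Real.sqrt_nonneg _
      linarith
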